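/- **Setting.** A newsvendor chooses a price $p\in[\underline p,\bar p]$ and an order quantity $q\in[\underline q,\bar q]$, where $s<c\le\underline p<\bar p$ and $0\le\underline q<\bar q$; $c$ is the unit cost and $s$ the salvage value. The profit is $\pi(p,q,D)=p\min(D,q)-cq+s(q-D)^+$, and $$\partial\pi(p,q,D)=\Big\{\big(\min(D,q),\,(p-c)-(p-s)e\big):\ e\in\big[\mathbb 1\{q>D\},\mathbb 1\{q\ge D\}\big]\Big\}.$$ By $\partial_{p,q}\pi(p,q,D)$ we denote an arbitrary but fixed selection from this set. Let $(z^i,p^i,q^i,D^i)_{i\ge1}$ be i.i.d., with $z^i\in\mathbb R^m$ and $p^i,q^i,D^i\in\mathbb R$. Assume: * the joint law of $(z^1,p^1,q^1)$ is absolutely continuous, its density is twice continuously differentiable and bounded away from $0$ and $\infty$ on the support $S$ of the law, and the historical decisions $(p^i,q^i)$ are bounded; * the conditional law of $D^1$ given $(p^1,z^1)$ is $f_D(p^1,z^1)$, where, for $(p,z)$ in the support of the law of $(p^1,z^1)$, $f_D(p,z)$ is a probability distribution on $[0,\infty)$ without atoms that depends continuously on $(p,z)$ (weak convergence). Let $z$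 be a feature such that $(z,p,q)\in S$ for all feasible $(p,q)$. For weights $w^i=w^i_N(p,z)$ put $G^N(p,q;z)=\sum_{i=1}^N w^i(p,z)\,\partial_{p,q}\pi(p,q,D^i)$. **Claim.** The expectations $\mathbb E_{D\sim f_D(p,z)}[\partial_{p,q}\pi(p,q,D)]$ exist for all feasible $(p,q)$ and, almost surely, $$\lim_{N\to\infty}\ \sup_{(p,q)\in[\underline p,\bar p]\times[\underline q,\bar q]}\Big\|G^N(p,q;z)-\mathbb E_{D\sim f_D(p,z)}[\partial_{p,q}\pi(p,q,D)]\Big\|=0$$ for each of the following weights, where $x=(p,z)$, $x^i=(p^i,z^i)$ and $\|\cdot\|$ is the Euclidean norm: 1. *kNN*: $w^i(x)=\frac1{k_N}\mathbb 1\big\{|\{j\le N,\ j\ne i:\|x^j-x\|<\|x^i-x\|\}|<k_N\big\}$, with $k_N/\log N\to\infty$ and $k_N/N\to0$. 2. *Kernel regression*: $w^i(x)=K\big(\tfrac{x-x^i}{h_N}\big)\big/\sum_{j\le N}K\big(\tfrac{x-x^j}{h_N}\big)$ (with $0/0=0$), where $K$ is the uniform kernel $\mathbb 1\{\|u\|\le1\}$,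 the triangular kernel $(1-\|u\|)^+$ or the Gaussian kernel $\frac1{\sqrt{2\pi}}e^{-\|u\|^2/2}$, with $h_N>0$, $h_N\to0$ and $Nh_N^{m+1}/\log N\to\infty$; here it is also assumed that, for some $a>0$, every ball of radius $r\in(0,1]$ around a point $(z,p,q)$ with $(p,q)$ feasible meets $S$ in Lebesgue measure at least $a\,r^{m+2}$ (as it does if $S$ is a box). 3. *CART*: $w^i(x)=\mathbb 1\{R_N(x)=R_N(x^i)\}\big/|\{j\le N:R_N(x^j)=R_N(x)\}|$, where $R_N$ maps $\mathbb R^{m+1}$ to finitely many leaves, each an axis-parallel, possibly unbounded box, and may depend on the data; almost surely there are $\delta_N\to0$ and $a_N$ with $a_N/\log N\to\infty$ such that, for all large $N$ and every $x=(p,z)$ with $p\in[\underline p,\bar p]$, the leaf of $x$ contains at least $a_N$ of the points $x^1,\dots,x^N$, and all points of this leaf in the support of the law of $(p^1,z^1)$ are within $\delta_N$ of $x$. 4. *Random forest*: the average of the CART weights of $n_N\ge1$ trees, which may depend on the data and satisfy the condition in 3 with common $\delta_N$ and $a_N$. -/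

import Mathlib

open Set Filter Topology MeasureTheory ProbabilityTheory
open scoped ENNReal BoundedContinuousFunction

noncomputable section

/-- The newsvendor profit `π(p, q, D) = p (D ∧ q) - c q + s (q - D)⁺`. -/
def profit (c s p q D : ℝ) : ℝ := p * min D q - c * q + s * max (q - D) 0

/-- The set `∂_{p,q} π(p, q, D)`: first component `D ∧ q`, second component
`(p - c) - (p - s) e`, where `e` ranges over `[𝟙{q > D}, 𝟙{q ≥ D}]`. -/
def profitSubgrad (c s p q D : ℝ) : Set (EuclideanSpace ℝ (Fin 2)) :=
  {v | ∃ e ∈ Icc (if D < q then (1 : ℝ) else 0) (if D ≤ q then (1 : ℝ) else 0),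
    v = !₂[min D q, (p - c) - (p - s) * e]}

/-- The components of an element of `profitSubgrad` are the derivative of the profit in `p` and a
supergradient of the profit in `q`. -/
theorem profitSubgrad_spec {c s p q D : ℝ} (hsp : s ≤ p) {v : EuclideanSpace ℝ (Fin 2)}
    (hv : v ∈ profitSubgrad c s p q D) :
    HasDerivAt (fun p' => profit c s p' q D) (v 0) p ∧
      ∀ q', profit c s p q' D ≤ profit c s p q D + v 1 * (q' - q) := by
  obtain ⟨e, ⟨he0, he1⟩, rfl⟩ := hv
  constructor
  · have h := (((hasDerivAt_id p).mul_const (min D q)).sub_const (c * q)).add_const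
      (s * max (q - D) 0)
    simpa [profit] using h
  · intro q'
    have h1 : ∀ t : ℝ, profit c s p t D = (p - c) * t - (p - s) * max (t - D) 0 := by
      intro t
      unfold profit
      rcases le_total D t with h | h
      · rw [min_eq_left h, max_eq_left (by linarith)]; ring
      · rw [min_eq_right h, max_eq_right (by linarith)]; ring
    have h2 : max (q - D) 0 + e * (q' - q) ≤ max (q' - D) 0 := by
      rcases lt_trichotomy D q with h | h | h
      · have : e = 1 := le_antisymm (by simpa [h.le] using he1) (by simpa [h] using he0)
        rw [this, max_eq_left (by linarith)]
        exact le_trans (by linarith) (le_max_left _ _)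
      · subst h
        have e0 : 0 ≤ e := by simpa using he0
        have e1 : e ≤ 1 := by simpa using he1
        rcases le_total D q' with h' | h'
        · rw [max_eq_left (a := q' - D) (by linarith)]; simp; nlinarith
        · rw [max_eq_right (a := q' - D) (by linarith)]; simp; nlinarith
      · have : e = 0 := le_antisymm (by simpa [h.not_ge] using he1)
          (by simpa [h.not_gt] using he0)
        rw [this, max_eq_right (by linarith)]
        simp
    rw [h1, h1]
    simp only [Matrix.cons_val_one, Matrix.cons_val_fin_one]
    nlinarith [mul_le_mul_of_nonneg_left h2 (sub_nonneg.2 hsp)]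

/-- The vector `(p, z)` in Euclidean space. -/
def covariate {m : ℕ} (p : ℝ) (z : EuclideanSpace ℝ (Fin m)) : EuclideanSpace ℝ (Fin (m + 1)) :=
  WithLp.toLp 2 (Fin.cons p (fun j => z j))

/-! Weights `w^i(x)` at the query point `x`, built from the first `N` points `X 0, …, X (N - 1)`. -/

open Classical in
/-- `k`-nearest-neighbour weight. -/
def knnWeight {d : ℕ} (k N : ℕ) (X : ℕ → EuclideanSpace ℝ (Fin d)) (i : ℕ)
    (x : EuclideanSpace ℝ (Fin d)) : ℝ :=
  if ((Finset.range N).filter (fun j => j ≠ i ∧ dist (X j) x < dist (X i) x)).card < k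
  then 1 / (k : ℝ) else 0

/-- Kernel regression weight with kernel `K` and bandwidth `h`, where `K_h(u) = K(u / h)`. -/
def kernelWeight {d : ℕ} (K : EuclideanSpace ℝ (Fin d) → ℝ) (h : ℝ) (N : ℕ)
    (X : ℕ → EuclideanSpace ℝ (Fin d)) (i : ℕ) (x : EuclideanSpace ℝ (Fin d)) : ℝ :=
  K (h⁻¹ • (x - X i)) / ∑ j ∈ Finset.range N, K (h⁻¹ • (x - X j))

open Classical in
/-- The uniform kernel. -/
def uniformKernel (d : ℕ) (u : EuclideanSpace ℝ (Fin d)) : ℝ := if ‖u‖ ≤ 1 then 1 else 0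

/-- The triangular kernel. -/
def triangularKernel (d : ℕ) (u : EuclideanSpace ℝ (Fin d)) : ℝ := max (1 - ‖u‖) 0

/-- The Gaussian kernel. -/
def gaussianKernel (d : ℕ) (u : EuclideanSpace ℝ (Fin d)) : ℝ :=
  1 / Real.sqrt (2 * Real.pi) * Real.exp (-‖u‖ ^ 2 / 2)

/-- A regression tree: a map to finitely many leaves, each leaf being a (possibly unbounded)
axis-parallel box. -/
structure RegTree (d : ℕ) where
  /-- number of leaves -/
  numLeaves : ℕ
  /-- the leaf in which a point lies -/
  leaf : EuclideanSpace ℝ (Fin d) → Fin numLeaves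
  isBox : ∀ l, ∃ I : Fin d → Set ℝ, (∀ c, (I c).OrdConnected) ∧
    ∀ x, leaf x = l ↔ ∀ c, x c ∈ I c

/-- Number of sample points in the leaf of `x`. -/
def RegTree.count {d : ℕ} (T : RegTree d) (N : ℕ) (X : ℕ → EuclideanSpace ℝ (Fin d))
    (x : EuclideanSpace ℝ (Fin d)) : ℕ :=
  ((Finset.range N).filter (fun j => T.leaf (X j) = T.leaf x)).card

/-- CART weight. -/
def cartWeight {d : ℕ} (T : RegTree d) (N : ℕ) (X : ℕ → EuclideanSpace ℝ (Fin d)) (i : ℕ)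
    (x : EuclideanSpace ℝ (Fin d)) : ℝ :=
  (if T.leaf x = T.leaf (X i) then 1 else 0) / (T.count N X x : ℝ)

/-- Random forest weight: the average of the CART weights of the trees `T 0, …, T (n - 1)`. -/
def forestWeight {d : ℕ} (n : ℕ) (T : ℕ → RegTree d) (N : ℕ)
    (X : ℕ → EuclideanSpace ℝ (Fin d)) (i : ℕ) (x : EuclideanSpace ℝ (Fin d)) : ℝ :=
  1 / (n : ℝ) * ∑ e ∈ Finset.range n, cartWeight (T e) N X i x

/-- Tuning of a sequence of forests (`n N` trees `T N 0, …` for sample size `N`), on the set `A` of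
query points, for sample points `X` from a distribution with support `S`: the leaves of the query
points shrink uniformly, and their smallest sample count grows faster than `log N`. -/
def ForestTuned {d : ℕ} (n : ℕ → ℕ) (T : ℕ → ℕ → RegTree d) (X : ℕ → EuclideanSpace ℝ (Fin d))
    (S A : Set (EuclideanSpace ℝ (Fin d))) : Prop :=
  ∃ δ a : ℕ → ℝ, Tendsto δ atTop (𝓝 0) ∧ Tendsto (fun N => a N / Real.log N) atTop atTop ∧
    ∀ᶠ N in atTop, ∀ e < n N, ∀ x ∈ A, a N ≤ (T N e).count N X x ∧
      ∀ y ∈ S, (T N e).leaf y = (T N e).leaf x → dist y x ≤ δ N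

/-- Approximate gradient `G^N(p, q; z) = ∑ i, w^i(p, z) ∂π(p, q, D^i)`, for weights `w` and a
selection `g p q d ∈ ∂π(p, q, d)`. -/
def approxGrad {m : ℕ} (g : ℝ → ℝ → ℝ → EuclideanSpace ℝ (Fin 2)) (N : ℕ)
    (w : ℕ → EuclideanSpace ℝ (Fin (m + 1)) → ℝ) (D : ℕ → ℝ) (p q : ℝ)
    (z : EuclideanSpace ℝ (Fin m)) : EuclideanSpace ℝ (Fin 2) :=
  ∑ i ∈ Finset.range N, w i (covariate p z) • g p q (D i)

/-- Expectation of the profit gradient, `E_{D ∼ f_D(p, z)} [∂π(p, q, D)]`. -/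
def expectedGrad {m : ℕ} (fD : Kernel (ℝ × EuclideanSpace ℝ (Fin m)) ℝ)
    (g : ℝ → ℝ → ℝ → EuclideanSpace ℝ (Fin 2)) (p q : ℝ) (z : EuclideanSpace ℝ (Fin m)) :
    EuclideanSpace ℝ (Fin 2) :=
  ∫ d, g p q d ∂(fD (p, z))

/-- `sup_{p,q} ‖G^N(p, q; z) - E_{D ∼ f_D(p, z)} [∂π(p, q, D)]‖` over
`(p, q) ∈ [pl, pu] × [ql, qu]`, in `[0, ∞]`. -/
def gradError {m : ℕ} (fD : Kernel (ℝ × EuclideanSpace ℝ (Fin m)) ℝ)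
    (g : ℝ → ℝ → ℝ → EuclideanSpace ℝ (Fin 2)) (pl pu ql qu : ℝ) (N : ℕ)
    (w : ℕ → EuclideanSpace ℝ (Fin (m + 1)) → ℝ) (D : ℕ → ℝ)
    (z : EuclideanSpace ℝ (Fin m)) : ℝ≥0∞ :=
  ⨆ p ∈ Icc pl pu, ⨆ q ∈ Icc ql qu, ‖approxGrad g N w D p q z - expectedGrad fD g p q z‖ₑ

end

/-! Conditionally on the covariates $x^i=(p^i,z^i)$ the demands are independent with laws
$f_D(x^i)$. Tested against a bounded function, a weighted average of demands splits into noise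
(demand minus its conditional mean), bias (conditional mean at $x^i$ against that at $x$) and an
error in the total weight; `ConsistentWeights.eventually_abs_sub_le` is this decomposition.

Noise. kNN and CART average over the sample points in a ball or a box, and radially decreasing
kernels are mixtures of ball indicators. Balls centred on the query segment, and boxes, cut only
polynomially many subsets out of $N$ points, each determined by the covariates and boundedly many
sample indices. For each such subset a conditional exponential moment bound holds. A union bound and
Borel–Cantelli then give, almost surely and for all subsets at once, a residual sum of at most
$\varepsilon\,\#s+C\log N$ (`ae_sum_residual_le`). After normalisation this vanishes, because $k_N$,
$Nh_N^{m+1}$ and the leaf counts all dominate $\log N$. Uniformity over all boxes is what permits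
trees that depend on the demands.

Bias and total weight. The weights concentrate at the query point: Chernoff lower bounds on the
sample counts of balls provide this for kNN and kernels, the tuning assumption for trees. Weak
continuity of $f_D$ is uniform along the compact query segment. For kNN, absolute continuity
excludes triple ties, so at most $k_N+1$ points are selected.

Passage to the gradient. All this is applied to the countably many truncations at rational levels.
Since $\min(D,q)$ is 1-Lipschitz in $q$, a finite grid of $q$ suffices for it. The jump $e$ is
squeezed between two ramps, whose gap is controlled by uniform atomlessness over the compact segment
(`exists_forall_measureReal_Icc_le`); this covers every selection of the subgradient. -/

/-! ### Conditional concentration of residual sums -/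

/-- Tower property: given the first components, the second ones are independent, so the factors
integrate out one at a time. Each factor may look at all first components but only at its own second
one; hence index sets selected from the whole covariate sample can be treated as if deterministic.
-/
theorem lintegral_pi_compProd_prod_le_one {n : ℕ} {α β : Type*} [MeasurableSpace α]
    [MeasurableSpace β] (ν : Measure α) [IsProbabilityMeasure ν] (κ : Kernel α β)
    [IsMarkovKernel κ] (H : Fin n → (Fin n → α) → β → ℝ≥0∞)
    (hH : ∀ i, Measurable (Function.uncurry (H i)))
    (h1 : ∀ i x, ∫⁻ b, H i x b ∂(κ (x i)) ≤ 1) :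
    ∫⁻ y, ∏ i, H i (fun j => (y j).1) (y i).2 ∂(Measure.pi fun _ => ν ⊗ₘ κ) ≤ 1 := by
  have hm : ∀ i, Measurable (fun y : Fin n → α × β => H i (fun j => (y j).1) (y i).2) := by
    intro i
    exact (hH i).comp (f := fun y : Fin n → α × β => ((fun j => (y j).1), (y i).2)) (by fun_prop)
  suffices h : ∀ s : Finset (Fin n), ∫⁻ y, ∏ i ∈ s, H i (fun j => (y j).1) (y i).2
      ∂(Measure.pi fun _ => ν ⊗ₘ κ) ≤ 1 from h Finset.univ
  intro s
  induction s using Finset.induction_on with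
  | empty => simp
  | insert a s ha ih =>
    refine le_trans ?_ ih
    have hF : ∀ t : Finset (Fin n),
        Measurable (fun y : Fin n → α × β => ∏ i ∈ t, H i (fun j => (y j).1) (y i).2) :=
      fun t => Finset.measurable_prod t fun i _ => hm i
    have : Nonempty (α × β) := (ν ⊗ₘ κ).nonempty_of_neZero
    -- The marginal over all coordinates ignores the base point; this form allows coordinate `a` to
    -- be integrated first.
    let x₀ : Fin n → α × β := fun _ => Classical.arbitrary _
    rw [lintegral_eq_lmarginal_univ x₀, lintegral_eq_lmarginal_univ x₀,
      lmarginal_erase' _ (hF _) (Finset.mem_univ a), lmarginal_erase' _ (hF _) (Finset.mem_univ a)]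
    refine lmarginal_mono (fun x => ?_) x₀
    have hupd : ∀ (u : α) (b : β), (fun j => (Function.update x a (u, b) j).1) =
        Function.update (fun j => (x j).1) a u := by
      intro u b
      funext j
      by_cases h : j = a
      · subst h; simp
      · simp [h]
    -- The remaining factors see coordinate `a` only through its first component, so they come out
    -- of the inner integral over `b`.
    have hG : ∀ (u : α) (b : β), ∏ i ∈ s, H i (fun j => (Function.update x a (u, b) j).1)
        (Function.update x a (u, b) i).2 =
        ∏ i ∈ s, H i (Function.update (fun j => (x j).1) a u) (x i).2 := by
      intro u b
      refine Finset.prod_congr rfl fun i hi => ?_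
      have : i ≠ a := fun h => ha (h ▸ hi)
      rw [hupd, Function.update_of_ne this]
    have hc : ∀ t : Finset (Fin n), Measurable (fun w : α × β =>
        ∏ i ∈ t, H i (fun j => (Function.update x a w j).1) (Function.update x a w i).2) :=
      fun t => (hF t).comp (measurable_update x)
    rw [Measure.lintegral_compProd (hc _), Measure.lintegral_compProd (hc _)]
    refine lintegral_mono fun u => ?_
    simp only [Finset.prod_insert ha, hG]
    simp only [hupd, Function.update_self]
    rw [lintegral_mul_const]
    · rw [lintegral_const, measure_univ, mul_one]
      have := h1 a (Function.update (fun j => (x j).1) a u)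
      rw [Function.update_self] at this
      exact mul_le_of_le_one_left zero_le this
    · exact (hH a).of_uncurry_left

theorem ae_eventually_notMem_of_le_inv_sq {Ω : Type*} [MeasurableSpace Ω] {μ : Measure Ω}
    (s : ℕ → Set Ω) (K : ℝ)
    (h : ∀ᶠ n : ℕ in atTop, μ (s n) ≤ ENNReal.ofReal (K / (n : ℝ) ^ 2)) :
    ∀ᵐ ω ∂μ, ∀ᶠ n in atTop, ω ∉ s n := by
  obtain ⟨n₀, hn₀⟩ := eventually_atTop.1 h
  let t : ℕ → Set Ω := fun n => if n₀ ≤ n then s n else ∅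
  have ht : ∑' n, μ (t n) ≠ ∞ := by
    have hsum : Summable (fun n : ℕ => |K| / (n : ℝ) ^ 2) := by
      simpa [div_eq_mul_inv] using (Real.summable_nat_pow_inv.2 one_lt_two).mul_left |K|
    refine ne_top_of_le_ne_top hsum.tsum_ofReal_ne_top (ENNReal.tsum_le_tsum fun n => ?_)
    by_cases hn : n₀ ≤ n
    · simp only [t, hn, if_true]
      refine (hn₀ n hn).trans (ENNReal.ofReal_le_ofReal ?_)
      gcongr
      exact le_abs_self K
    · simp [t, hn]
  filter_upwards [ae_eventually_notMem ht] with ω hω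
  filter_upwards [hω, eventually_ge_atTop n₀] with n hn hn'
  simpa [t, hn'] using hn

/-- Since $e^t\le 1+t+t^2$ for $|t|\le1$ and the linear term has mean zero, only the quadratic term
survives; a centred value is at most $2B$ in size. -/
theorem integral_exp_centered_le {β : Type*} [MeasurableSpace β] (P : Measure β)
    [IsProbabilityMeasure P] {φ : β → ℝ} (hφ : Measurable φ) {B : ℝ} (hB : ∀ b, |φ b| ≤ B)
    {l : ℝ} (hl : 0 ≤ l) (hlB : l * (2 * B) ≤ 1) :
    ∫⁻ b, ENNReal.ofReal (Real.exp (l * (φ b - ∫ y, φ y ∂P))) ∂P ≤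
      ENNReal.ofReal (Real.exp (l ^ 2 * (2 * B) ^ 2)) := by
  set c := ∫ y, φ y ∂P with hc
  have hint : Integrable φ P := Integrable.of_bound hφ.aestronglyMeasurable B
    (Eventually.of_forall fun b => by simpa using hB b)
  have hcB : |c| ≤ B := by
    have := norm_integral_le_of_norm_le_const (μ := P) (f := φ) (C := B)
      (Eventually.of_forall fun b => by simpa using hB b)
    simpa using this
  have hξ : ∀ b, |φ b - c| ≤ 2 * B := fun b => by
    have h1 := abs_le.1 (hB b)
    have h2 := abs_le.1 hcB
    exact abs_le.2 ⟨by linarith, by linarith⟩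
  have h2 : ∀ b, Real.exp (l * (φ b - c)) ≤ (1 + l ^ 2 * (2 * B) ^ 2) + l * (φ b - c) := by
    intro b
    have h3 : |l * (φ b - c)| ≤ 1 := by
      rw [abs_mul, abs_of_nonneg hl]
      exact (mul_le_mul_of_nonneg_left (hξ b) hl).trans hlB
    have h4 := (abs_le.1 (Real.abs_exp_sub_one_sub_id_le h3)).2
    have h5 : (l * (φ b - c)) ^ 2 ≤ l ^ 2 * (2 * B) ^ 2 := by
      rw [mul_pow]
      exact mul_le_mul_of_nonneg_left (sq_le_sq' (abs_le.1 (hξ b)).1 (abs_le.1 (hξ b)).2)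
        (sq_nonneg l)
    linarith
  have hlin : Integrable (fun b => l * (φ b - c)) P :=
    (hint.sub (integrable_const c)).const_mul l
  have hint2 : Integrable (fun b => (1 + l ^ 2 * (2 * B) ^ 2) + l * (φ b - c)) P :=
    (integrable_const _).add hlin
  have hval : ∫ b, ((1 + l ^ 2 * (2 * B) ^ 2) + l * (φ b - c)) ∂P = 1 + l ^ 2 * (2 * B) ^ 2 := by
    rw [integral_add (integrable_const _) hlin, integral_const_mul,
      integral_sub hint (integrable_const c)]
    simp [hc]
  calc ∫⁻ b, ENNReal.ofReal (Real.exp (l * (φ b - c))) ∂P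
      ≤ ∫⁻ b, ENNReal.ofReal ((1 + l ^ 2 * (2 * B) ^ 2) + l * (φ b - c)) ∂P :=
        lintegral_mono fun b => ENNReal.ofReal_le_ofReal (h2 b)
    _ = ENNReal.ofReal (1 + l ^ 2 * (2 * B) ^ 2) := by
        rw [← ofReal_integral_eq_lintegral_ofReal hint2
          (Eventually.of_forall fun b => (Real.exp_pos _).le.trans (h2 b)), hval]
    _ ≤ _ := ENNReal.ofReal_le_ofReal (by linarith [Real.add_one_le_exp (l ^ 2 * (2 * B) ^ 2)])

/-- The deviation of a sample value from its conditional mean, for the `i`-th sample point. -/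
noncomputable def condResidual {α β : Type*} [MeasurableSpace α] [MeasurableSpace β] (κ : Kernel α β)
    (φ : β → ℝ) (x : ℕ → α) (y : ℕ → β) (i : ℕ) : ℝ :=
  φ (y i) - ∫ b, φ b ∂(κ (x i))

/-- Chernoff bound given the covariates, plus a union bound over polynomially many index sets. The
tilt `l` depends on `ε` and the bound on `φ` only, and is so small that each selected point, charged
`ε`, contributes a factor of conditional mean at most one. The random number of selected points
therefore needs no control of its own, and the price of uniformity is a multiple of $\log n$. -/
theorem ae_sum_residual_le {Ω : Type*} [MeasurableSpace Ω] {μ : Measure Ω}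
    [IsProbabilityMeasure μ] {α β : Type*} [MeasurableSpace α] [MeasurableSpace β]
    {ν : Measure α} [IsProbabilityMeasure ν] {κ : Kernel α β} [IsMarkovKernel κ]
    {X : ℕ → Ω → α} {Y : ℕ → Ω → β} (hX : ∀ i, Measurable (X i)) (hY : ∀ i, Measurable (Y i))
    (hindep : iIndepFun (fun i ω => (X i ω, Y i ω)) μ)
    (hlaw : ∀ i, μ.map (fun ω => (X i ω, Y i ω)) = ν ⊗ₘ κ)
    {φ : β → ℝ} (hφ : Measurable φ) {B : ℝ} (hB : ∀ b, |φ b| ≤ B)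
    {ι : ℕ → Type*} [∀ n, Fintype (ι n)] {c : ℕ} (hcard : ∀ n, Fintype.card (ι n) ≤ (n + 1) ^ c)
    (A : ∀ n, ι n → Fin n → Set (Fin n → α)) (hA : ∀ n J i, MeasurableSet (A n J i)) :
    ∀ᵐ ω ∂μ, ∀ ε > 0, ∃ C, 0 ≤ C ∧ ∀ᶠ n : ℕ in atTop, ∀ J : ι n,
      ∑ i : Fin n, (A n J i).indicator (fun _ => (1 : ℝ)) (fun j : Fin n => X j ω) *
        condResidual κ φ (fun i => X i ω) (fun i => Y i ω) i ≤
      ε * ∑ i : Fin n, (A n J i).indicator (fun _ => (1 : ℝ)) (fun j : Fin n => X j ω) +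
        C * Real.log n := by
  -- Only `ε = 1 / (k + 1)` is treated, to intersect countably many almost sure events.
  have key : ∀ k : ℕ, ∀ᵐ ω ∂μ, ∃ C, 0 ≤ C ∧ ∀ᶠ n : ℕ in atTop, ∀ J : ι n,
      ∑ i : Fin n, (A n J i).indicator (fun _ => (1 : ℝ)) (fun j : Fin n => X j ω) *
        condResidual κ φ (fun i => X i ω) (fun i => Y i ω) i ≤
      (1 / ((k : ℝ) + 1)) *
        ∑ i : Fin n, (A n J i).indicator (fun _ => (1 : ℝ)) (fun j : Fin n => X j ω) +
        C * Real.log n := by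
    intro k
    set ε : ℝ := 1 / ((k : ℝ) + 1) with hε
    have hε0 : 0 < ε := by positivity
    set B' : ℝ := max B 1
    have hB' : ∀ b, |φ b| ≤ B' := fun b => (hB b).trans (le_max_left _ _)
    have hB'1 : 1 ≤ B' := le_max_right _ _
    obtain ⟨l, hl0, hl1, hl2⟩ : ∃ l : ℝ, 0 < l ∧ l * (2 * B') ≤ 1 ∧ l * (2 * B') ^ 2 ≤ ε := by
      refine ⟨min (1 / (2 * B')) (ε / (2 * B') ^ 2), by positivity, ?_, ?_⟩
      · calc _ ≤ 1 / (2 * B') * (2 * B') := by gcongr; exact min_le_left _ _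
          _ = 1 := by field_simp
      · calc _ ≤ ε / (2 * B') ^ 2 * (2 * B') ^ 2 := by gcongr; exact min_le_right _ _
          _ = ε := by field_simp
    -- The indicator sits in the exponent, so a point that is not selected contributes the factor
    -- one.
    let H : ∀ n, ι n → Fin n → (Fin n → α) → β → ℝ≥0∞ := fun n J i x b =>
      ENNReal.ofReal (Real.exp ((A n J i).indicator (fun _ => (1 : ℝ)) x *
        (l * (φ b - ∫ y, φ y ∂(κ (x i)) - ε))))
    have hψ : Measurable (fun x => ∫ y, φ y ∂(κ x)) :=
      (hφ.stronglyMeasurable.integral_kernel (κ := κ)).measurable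
    have hHm : ∀ n J i, Measurable (Function.uncurry (H n J i)) := by
      intro n J i
      have h1 : Measurable (fun q : (Fin n → α) × β =>
          (A n J i).indicator (fun _ => (1 : ℝ)) q.1) :=
        (measurable_const.indicator (hA n J i)).comp measurable_fst
      have h2 : Measurable (fun q : (Fin n → α) × β => ∫ y, φ y ∂(κ (q.1 i))) :=
        hψ.comp (by fun_prop)
      have h3 : Measurable (fun q : (Fin n → α) × β => φ q.2) := hφ.comp measurable_snd
      exact (Real.measurable_exp.comp
        (h1.mul (((h3.sub h2).sub measurable_const).const_mul l))).ennreal_ofReal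
    have hH1 : ∀ n J i x, ∫⁻ b, H n J i x b ∂(κ (x i)) ≤ 1 := by
      intro n J i x
      by_cases hx : x ∈ A n J i
      · have h1 := integral_exp_centered_le (κ (x i)) hφ hB' hl0.le hl1
        have h2 : ∀ b, H n J i x b = ENNReal.ofReal (Real.exp (-(l * ε))) *
            ENNReal.ofReal (Real.exp (l * (φ b - ∫ y, φ y ∂(κ (x i))))) := by
          intro b
          rw [← ENNReal.ofReal_mul (Real.exp_pos _).le, ← Real.exp_add]
          simp only [H, indicator_of_mem hx]
          congr 2; ring
        simp_rw [h2]
        rw [lintegral_const_mul' _ _ ENNReal.ofReal_ne_top]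
        refine (mul_le_mul_right h1 _).trans ?_
        rw [← ENNReal.ofReal_mul (Real.exp_pos _).le, ← Real.exp_add, ← ENNReal.ofReal_one]
        refine ENNReal.ofReal_le_ofReal ?_
        rw [← Real.exp_zero]
        refine Real.exp_le_exp.2 ?_
        nlinarith
      · simp [H, indicator_of_notMem hx]
    let S : ∀ n, ι n → Ω → ℝ := fun n J ω =>
      ∑ i : Fin n, (A n J i).indicator (fun _ => (1 : ℝ)) (fun j : Fin n => X j ω) *
        (l * (condResidual κ φ (fun i => X i ω) (fun i => Y i ω) i - ε))
    have hS : ∀ n J, ∫⁻ ω, ENNReal.ofReal (Real.exp (S n J ω)) ∂μ ≤ 1 := by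
      intro n J
      have hmap : μ.map (fun ω (i : Fin n) => (X i ω, Y i ω)) =
          Measure.pi (fun _ : Fin n => ν ⊗ₘ κ) := by
        have h1 : iIndepFun (fun (i : Fin n) ω => (X i ω, Y i ω)) μ :=
          hindep.precomp Fin.val_injective
        rw [iIndepFun_iff_map_fun_eq_pi_map (by fun_prop)] at h1
        rw [h1]
        simp_rw [hlaw]
      have h2 := lintegral_pi_compProd_prod_le_one ν κ (H n J) (hHm n J) (hH1 n J)
      rw [← hmap, lintegral_map _ (by fun_prop)] at h2
      · convert h2 using 3 with ω
        rw [← ENNReal.ofReal_prod_of_nonneg (fun i _ => (Real.exp_pos _).le), ← Real.exp_sum]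
        rfl
      · exact Finset.measurable_prod _ fun i _ => (hHm n J i).comp
          (f := fun y : Fin n → α × β => ((fun j => (y j).1), (y i).2)) (by fun_prop)
    have hSm : ∀ n J, Measurable (S n J) := by
      intro n J
      refine Finset.measurable_sum _ fun i _ => ?_
      refine ((measurable_const.indicator (hA n J i)).comp (by fun_prop)).mul ?_
      exact (((hφ.comp (hY i)).sub (hψ.comp (hX i))).sub measurable_const).const_mul l
    -- Markov's inequality at level $n^{c+2}$ leaves $n^{-2}$ after the union over at most
    -- $(n+1)^c\le(2n)^c$ index sets.
    have hbad := ae_eventually_notMem_of_le_inv_sq (μ := μ)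
      (fun n => ⋃ J : ι n, {ω | ((c : ℝ) + 2) * Real.log n ≤ S n J ω}) (2 ^ c) (by
      filter_upwards [eventually_ge_atTop 1] with n hn
      have hn0 : (0 : ℝ) < n := by exact_mod_cast hn
      have hone : ∀ J : ι n, μ {ω | ((c : ℝ) + 2) * Real.log n ≤ S n J ω} ≤
          ENNReal.ofReal (((n : ℝ) ^ (c + 2))⁻¹) := by
        intro J
        have h1 := mul_meas_ge_le_lintegral (μ := μ)
          (Real.measurable_exp.comp (hSm n J)).ennreal_ofReal (ENNReal.ofReal ((n : ℝ) ^ (c + 2)))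
        have h2 : {ω | ((c : ℝ) + 2) * Real.log n ≤ S n J ω} =
            {ω | ENNReal.ofReal ((n : ℝ) ^ (c + 2)) ≤
              ENNReal.ofReal ((Real.exp ∘ S n J) ω)} := by
          ext ω
          simp only [mem_ofPred_eq, Function.comp]
          rw [ENNReal.ofReal_le_ofReal_iff (Real.exp_pos _).le, ← Real.log_le_iff_le_exp
            (by positivity), Real.log_pow]
          push_cast
          rfl
        rw [h2, ENNReal.ofReal_inv_of_pos (by positivity)]
        rw [← one_div, ENNReal.le_div_iff_mul_le (Or.inl (by positivity))
          (Or.inl ENNReal.ofReal_ne_top), mul_comm]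
        exact h1.trans (hS n J)
      calc μ (⋃ J : ι n, {ω | ((c : ℝ) + 2) * Real.log n ≤ S n J ω})
          ≤ ∑ J : ι n, μ {ω | ((c : ℝ) + 2) * Real.log n ≤ S n J ω} := measure_iUnion_fintype_le _ _
        _ ≤ ∑ _J : ι n, ENNReal.ofReal (((n : ℝ) ^ (c + 2))⁻¹) :=
            Finset.sum_le_sum fun J _ => hone J
        _ = ENNReal.ofReal (Fintype.card (ι n) * ((n : ℝ) ^ (c + 2))⁻¹) := by
            rw [Finset.sum_const, Finset.card_univ, nsmul_eq_mul,
              ENNReal.ofReal_mul (by positivity), ENNReal.ofReal_natCast]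
        _ ≤ ENNReal.ofReal (2 ^ c / (n : ℝ) ^ 2) := by
            refine ENNReal.ofReal_le_ofReal ?_
            have h3 : (Fintype.card (ι n) : ℝ) ≤ (2 * n) ^ c := by
              have h4 : (Fintype.card (ι n) : ℝ) ≤ ((n : ℝ) + 1) ^ c := by exact_mod_cast hcard n
              refine h4.trans ?_
              have : (1 : ℝ) ≤ n := by exact_mod_cast hn
              gcongr
              linarith
            calc _ ≤ (2 * (n : ℝ)) ^ c * ((n : ℝ) ^ (c + 2))⁻¹ := by gcongr
              _ = 2 ^ c / (n : ℝ) ^ 2 := by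
                rw [mul_pow, pow_add]; field_simp)
    filter_upwards [hbad] with ω hω
    refine ⟨((c : ℝ) + 2) / l, by positivity, ?_⟩
    filter_upwards [hω] with n hn J
    simp only [mem_iUnion, mem_ofPred_eq, not_exists, not_le] at hn
    have h1 := (hn J).le
    have h2 : S n J ω = l * (∑ i : Fin n,
        (A n J i).indicator (fun _ => (1 : ℝ)) (fun j : Fin n => X j ω) *
        condResidual κ φ (fun i => X i ω) (fun i => Y i ω) i -
      ε * ∑ i : Fin n, (A n J i).indicator (fun _ => (1 : ℝ)) (fun j : Fin n => X j ω)) := by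
      simp only [S]
      rw [Finset.mul_sum, ← Finset.sum_sub_distrib, Finset.mul_sum]
      refine Finset.sum_congr rfl fun i _ => ?_
      ring
    rw [h2, ← le_div_iff₀' hl0] at h1
    have h3 : ((c : ℝ) + 2) / l * Real.log n = ((c : ℝ) + 2) * Real.log n / l := by ring
    rw [h3]
    linarith
  filter_upwards [ae_all_iff.2 key] with ω hω ε hε
  obtain ⟨k, hk⟩ := exists_nat_one_div_lt hε
  obtain ⟨C, hC0, hC⟩ := hω k
  refine ⟨C, hC0, hC.mono fun n hn J => (hn J).trans ?_⟩
  have : 0 ≤ ∑ i : Fin n, (A n J i).indicator (fun _ => (1 : ℝ)) (fun j : Fin n => X j ω) :=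
    Finset.sum_nonneg fun i _ => indicator_nonneg (fun _ _ => zero_le_one) _
  gcongr

/-! ### Lower bounds for sample counts, and absence of ties -/

open Classical in
-- Chernoff bound with tilt $-1$: for an indicator $y$ one has $e^{-y}\le 1-y/2$, because $e\ge2$.
theorem measureReal_card_le_le_exp {Ω : Type*} [MeasurableSpace Ω] {μ : Measure Ω}
    [IsProbabilityMeasure μ] {α : Type*} [MeasurableSpace α] {ν : Measure α}
    {X : ℕ → Ω → α} (hX : ∀ i, Measurable (X i)) (hindep : iIndepFun X μ)
    (hlaw : ∀ i, μ.map (X i) = ν) {B : Set α} (hB : MeasurableSet B) (n : ℕ) (a : ℝ) :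
    μ.real {ω | (((Finset.range n).filter (fun i => X i ω ∈ B)).card : ℝ) ≤ a} ≤
      Real.exp (a - n * ν.real B / 2) := by
  let Y : ℕ → Ω → ℝ := fun i ω => B.indicator (fun _ => (1 : ℝ)) (X i ω)
  have hg : Measurable (B.indicator (fun _ => (1 : ℝ))) := measurable_const.indicator hB
  have hY : ∀ i, Measurable (Y i) := fun i => hg.comp (hX i)
  have hYi : iIndepFun Y μ := hindep.comp (fun _ => B.indicator (fun _ => (1 : ℝ))) fun _ => hg
  have hY01 : ∀ i ω, 0 ≤ Y i ω ∧ Y i ω ≤ 1 := by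
    intro i ω
    by_cases h : X i ω ∈ B <;> simp [Y, h]
  have hcard : ∀ ω, (((Finset.range n).filter (fun i => X i ω ∈ B)).card : ℝ) =
      (∑ i ∈ Finset.range n, Y i) ω := by
    intro ω
    rw [Finset.sum_apply, Finset.card_filter]
    push_cast
    refine Finset.sum_congr rfl fun i _ => ?_
    by_cases h : X i ω ∈ B <;> simp [Y, h]
  have hYint : ∀ i, ∫ ω, Y i ω ∂μ = ν.real B := by
    intro i
    rw [← hlaw i, show (∫ ω, Y i ω ∂μ) = ∫ x, B.indicator (fun _ => (1 : ℝ)) x ∂(μ.map (X i)) from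
      (integral_map (hX i).aemeasurable hg.aestronglyMeasurable).symm, integral_indicator hB]
    simp
  have hYi1 : ∀ i, Integrable (Y i) μ := fun i => Integrable.of_bound
    (hY i).aestronglyMeasurable 1 (Eventually.of_forall fun ω => by
      rw [Real.norm_eq_abs, abs_of_nonneg (hY01 i ω).1]; exact (hY01 i ω).2)
  have hmgf : ∀ i, mgf (Y i) μ (-1) ≤ Real.exp (-(ν.real B / 2)) := by
    intro i
    have hpt : ∀ ω, Real.exp (-1 * Y i ω) ≤ 1 - Y i ω / 2 := by
      intro ω
      have he : Real.exp (-1) ≤ 1 / 2 := by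
        rw [Real.exp_neg, ← one_div]
        exact one_div_le_one_div_of_le two_pos (by linarith [Real.add_one_le_exp 1])
      by_cases h : X i ω ∈ B
      · simp only [Y, indicator_of_mem h]; norm_num; norm_num at he; exact he
      · simp [Y, h]
    have h1 : mgf (Y i) μ (-1) ≤ ∫ ω, (1 - Y i ω / 2) ∂μ := by
      refine integral_mono_of_nonneg (Eventually.of_forall fun ω => (Real.exp_pos _).le)
        ((integrable_const _).sub ((hYi1 i).div_const 2)) (Eventually.of_forall hpt)
    rw [integral_sub (integrable_const _) ((hYi1 i).div_const 2), integral_div, hYint] at h1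
    simp only [integral_const, probReal_univ, smul_eq_mul, mul_one] at h1
    linarith [Real.add_one_le_exp (-(ν.real B / 2))]
  have hint : Integrable (fun ω => Real.exp (-1 * (∑ i ∈ Finset.range n, Y i) ω)) μ := by
    refine Integrable.of_bound ?_ 1 (Eventually.of_forall fun ω => ?_)
    · simp only [Finset.sum_apply]
      exact (Real.measurable_exp.comp
        ((Finset.measurable_sum _ fun i _ => hY i).const_mul (-1))).aestronglyMeasurable
    · rw [Real.norm_eq_abs, abs_of_pos (Real.exp_pos _), Real.exp_le_one_iff, ← hcard]
      have : (0 : ℝ) ≤ (((Finset.range n).filter (fun i => X i ω ∈ B)).card : ℝ) := by positivity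
      linarith
  have h := measure_le_le_exp_mul_mgf (μ := μ) (X := ∑ i ∈ Finset.range n, Y i) a
    (by norm_num : (-1 : ℝ) ≤ 0) hint
  simp_rw [hcard]
  refine h.trans ?_
  rw [hYi.mgf_sum hY, show a - n * ν.real B / 2 = -(-1) * a + ∑ i ∈ Finset.range n,
    (-(ν.real B / 2)) by rw [Finset.sum_const, Finset.card_range, nsmul_eq_mul]; ring,
    Real.exp_add, Real.exp_sum]
  gcongr with i hi
  · exact fun i _ => mgf_nonneg
  · exact hmgf i

open Classical in
theorem ae_eventually_card_ge {Ω : Type*} [MeasurableSpace Ω] {μ : Measure Ω}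
    [IsProbabilityMeasure μ] {α : Type*} [MeasurableSpace α] {ν : Measure α}
    {X : ℕ → Ω → α} (hX : ∀ i, Measurable (X i)) (hindep : iIndepFun X μ)
    (hlaw : ∀ i, μ.map (X i) = ν) (M : ℕ → ℕ) (B : ℕ → ℕ → Set α)
    (hB : ∀ n j, MeasurableSet (B n j)) (π : ℕ → ℝ)
    (hπ : ∀ᶠ n in atTop, ∀ j < M n, π n ≤ ν.real (B n j))
    (hM : ∃ C : ℝ, ∀ᶠ n : ℕ in atTop, (M n : ℝ) ≤ C * n)
    (hlim : Tendsto (fun n : ℕ => n * π n / Real.log n) atTop atTop) :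
    ∀ᵐ ω ∂μ, ∀ᶠ n : ℕ in atTop, ∀ j < M n,
      n * π n / 4 ≤ (((Finset.range n).filter (fun i => X i ω ∈ B n j)).card : ℝ) := by
  obtain ⟨C, hC⟩ := hM
  have hbad := ae_eventually_notMem_of_le_inv_sq (μ := μ) (fun n => ⋃ j ∈ Finset.range (M n),
    {ω | (((Finset.range n).filter (fun i => X i ω ∈ B n j)).card : ℝ) ≤ n * π n / 4}) C (by
    -- At half the guaranteed mean's half, the Chernoff exponent is at most $-n\pi_n/4\le-3\log n$,
    -- whence the 12; the $O(n)$ sets then leave a summable $n^{-2}$.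
    filter_upwards [hπ, hC, hlim.eventually_ge_atTop 12, eventually_ge_atTop 2] with n h1 h2 h3 h4
    have hn : (0 : ℝ) < n := by positivity
    have hlog : 0 < Real.log n := Real.log_pos (by exact_mod_cast h4)
    rw [le_div_iff₀ hlog] at h3
    have hone : ∀ j ∈ Finset.range (M n),
        μ {ω | (((Finset.range n).filter (fun i => X i ω ∈ B n j)).card : ℝ) ≤ n * π n / 4} ≤
        ENNReal.ofReal (((n : ℝ) ^ 3)⁻¹) := by
      intro j hj
      rw [← ofReal_measureReal]
      refine ENNReal.ofReal_le_ofReal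
        ((measureReal_card_le_le_exp hX hindep hlaw (hB n j) n _).trans ?_)
      rw [← Real.log_le_log_iff (Real.exp_pos _) (by positivity), Real.log_exp, Real.log_inv,
        Real.log_pow]
      have := mul_le_mul_of_nonneg_left (h1 j (Finset.mem_range.1 hj)) hn.le
      push_cast
      linarith
    refine (measure_biUnion_finset_le _ _).trans ((Finset.sum_le_sum hone).trans ?_)
    rw [Finset.sum_const, Finset.card_range, nsmul_eq_mul, ← ENNReal.ofReal_natCast,
      ← ENNReal.ofReal_mul (by positivity)]
    refine ENNReal.ofReal_le_ofReal ?_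
    calc (M n : ℝ) * ((n : ℝ) ^ 3)⁻¹ ≤ (C * n) * ((n : ℝ) ^ 3)⁻¹ := by gcongr
      _ = C / (n : ℝ) ^ 2 := by field_simp)
  filter_upwards [hbad] with ω hω
  filter_upwards [hω] with n hn j hj
  simp only [mem_iUnion, not_exists, Finset.mem_range] at hn
  exact (not_le.1 (hn j hj)).le

/-- Almost surely, no three points of a sample in `ℝ × E` are equidistant from a point of a line
parallel to the first axis; `v` stands for the squared distance in `E` to that line. -/
theorem ae_not_three_equidistant {Ω : Type*} [MeasurableSpace Ω] {μ : Measure Ω}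
    [IsProbabilityMeasure μ] {E : Type*} [MeasurableSpace E] {ν : Measure (ℝ × E)}
    [IsProbabilityMeasure ν]
    {X : ℕ → Ω → ℝ × E} (hX : ∀ i, Measurable (X i)) (hindep : iIndepFun X μ)
    (hlaw : ∀ i, μ.map (X i) = ν) {v : E → ℝ} (hv : Measurable v)
    (hnull : ∀ t, ν {x | x.1 = t} = 0) (hnull' : ∀ p r, ν {x | (x.1 - p) ^ 2 + v x.2 = r} = 0) :
    ∀ᵐ ω ∂μ, ∀ i j l, i ≠ j → i ≠ l → j ≠ l → ∀ p,
      ((X i ω).1 - p) ^ 2 + v (X i ω).2 = ((X j ω).1 - p) ^ 2 + v (X j ω).2 →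
      ((X l ω).1 - p) ^ 2 + v (X l ω).2 ≠ ((X i ω).1 - p) ^ 2 + v (X i ω).2 := by
  have hpair : ∀ i j, i ≠ j → ∀ᵐ ω ∂μ, (X i ω).1 ≠ (X j ω).1 := by
    intro i j hij
    have hm : MeasurableSet {y : (ℝ × E) × (ℝ × E) | y.1.1 = y.2.1} :=
      measurableSet_eq_fun (by fun_prop) (by fun_prop)
    have hmap := (indepFun_iff_map_prod_eq_prod_map_map (hX i).aemeasurable
      (hX j).aemeasurable).1 (hindep.indepFun hij)
    have h0 : μ.map (fun ω => (X i ω, X j ω)) {y | y.1.1 = y.2.1} = 0 := by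
      rw [hmap, hlaw, hlaw, Measure.measure_prod_null hm]
      refine Eventually.of_forall fun x => ?_
      have : Prod.mk x ⁻¹' {y : (ℝ × E) × (ℝ × E) | y.1.1 = y.2.1} = {y | y.1 = x.1} := by
        ext y; simp [eq_comm]
      exact (congrArg ν this).trans (hnull _)
    rw [Measure.map_apply ((hX i).prodMk (hX j)) hm] at h0
    exact measure_eq_zero_iff_ae_notMem.1 h0
  -- The unique point of the line equidistant from two sample points with distinct first
  -- coordinates. A third sample point is independent of it, so it lies on the corresponding sphere
  -- with probability zero. The junk value for equal first coordinates is harmless, since these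
  -- occur with probability zero.
  let ctr : (ℝ × E) × (ℝ × E) → ℝ := fun y =>
    (y.1.1 ^ 2 + v y.1.2 - (y.2.1 ^ 2 + v y.2.2)) / (2 * (y.1.1 - y.2.1))
  have hctr : Measurable ctr := by fun_prop
  have htriple : ∀ i j l, i ≠ j → i ≠ l → j ≠ l → ∀ᵐ ω ∂μ,
      ((X l ω).1 - ctr (X i ω, X j ω)) ^ 2 + v (X l ω).2 ≠
        ((X i ω).1 - ctr (X i ω, X j ω)) ^ 2 + v (X i ω).2 := by
    intro i j l hij hil hjl
    have hm : MeasurableSet {y : ((ℝ × E) × (ℝ × E)) × (ℝ × E) |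
        (y.2.1 - ctr y.1) ^ 2 + v y.2.2 = (y.1.1.1 - ctr y.1) ^ 2 + v y.1.1.2} :=
      measurableSet_eq_fun (by fun_prop) (by fun_prop)
    have hmap := (indepFun_iff_map_prod_eq_prod_map_map ((hX i).prodMk (hX j)).aemeasurable
      (hX l).aemeasurable).1 (hindep.indepFun_prodMk hX i j l hil hjl)
    have h0 : μ.map (fun ω => ((X i ω, X j ω), X l ω)) {y |
        (y.2.1 - ctr y.1) ^ 2 + v y.2.2 = (y.1.1.1 - ctr y.1) ^ 2 + v y.1.1.2} = 0 := by
      rw [hmap, hlaw l, Measure.measure_prod_null hm]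
      refine Eventually.of_forall fun x => ?_
      exact hnull' (ctr x) ((x.1.1 - ctr x) ^ 2 + v x.1.2)
    rw [Measure.map_apply (((hX i).prodMk (hX j)).prodMk (hX l)) hm] at h0
    exact measure_eq_zero_iff_ae_notMem.1 h0
  have h1 : ∀ᵐ ω ∂μ, ∀ i j, i ≠ j → (X i ω).1 ≠ (X j ω).1 := by
    simp only [ae_all_iff]; exact hpair
  have h2 : ∀ᵐ ω ∂μ, ∀ i j l, i ≠ j → i ≠ l → j ≠ l →
      ((X l ω).1 - ctr (X i ω, X j ω)) ^ 2 + v (X l ω).2 ≠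
        ((X i ω).1 - ctr (X i ω, X j ω)) ^ 2 + v (X i ω).2 := by
    simp only [ae_all_iff]; exact htriple
  filter_upwards [h1, h2] with ω h1 h2 i j l hij hil hjl p hp
  have hne := sub_ne_zero.2 (h1 i j hij)
  have hpc : p = ctr (X i ω, X j ω) := by
    simp only [ctr]
    field_simp
    linarith
  rw [hpc]
  exact h2 i j l hij hil hjl

/-- As `ae_sum_residual_le`, two-sided and for index sets whose membership is described by `A`. -/
theorem ae_abs_sum_residual_le {Ω : Type*} [MeasurableSpace Ω] {μ : Measure Ω}
    [IsProbabilityMeasure μ] {α β : Type*} [MeasurableSpace α] [MeasurableSpace β]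
    {ν : Measure α} [IsProbabilityMeasure ν] {κ : Kernel α β} [IsMarkovKernel κ]
    {X : ℕ → Ω → α} {Y : ℕ → Ω → β} (hX : ∀ i, Measurable (X i)) (hY : ∀ i, Measurable (Y i))
    (hindep : iIndepFun (fun i ω => (X i ω, Y i ω)) μ)
    (hlaw : ∀ i, μ.map (fun ω => (X i ω, Y i ω)) = ν ⊗ₘ κ)
    {φ : β → ℝ} (hφ : Measurable φ) {B : ℝ} (hB : ∀ b, |φ b| ≤ B)
    {ι : ℕ → Type*} [∀ n, Fintype (ι n)] {c : ℕ} (hcard : ∀ n, Fintype.card (ι n) ≤ (n + 1) ^ c)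
    (A : ∀ n, ι n → Fin n → Set (Fin n → α)) (hA : ∀ n J i, MeasurableSet (A n J i)) :
    ∀ᵐ ω ∂μ, ∀ ε > 0, ∃ C, 0 ≤ C ∧ ∀ᶠ n : ℕ in atTop, ∀ J : ι n, ∀ s ⊆ Finset.range n,
      (∀ i : Fin n, (fun j : Fin n => X j ω) ∈ A n J i ↔ (i : ℕ) ∈ s) →
      |∑ i ∈ s, condResidual κ φ (fun i => X i ω) (fun i => Y i ω) i| ≤
        ε * s.card + C * Real.log n := by
  have hneg : ∀ x y i, condResidual κ (-φ) x y i = -condResidual κ φ x y i := by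
    intro x y i
    simp only [condResidual, Pi.neg_apply, integral_neg]
    ring
  filter_upwards [ae_sum_residual_le hX hY hindep hlaw hφ hB hcard A hA,
    ae_sum_residual_le hX hY hindep hlaw hφ.neg (B := B) (fun b => by simpa using hB b)
      hcard A hA] with ω h1 h2 ε hε
  obtain ⟨C₁, hC₁, h1⟩ := h1 ε hε
  obtain ⟨C₂, hC₂, h2⟩ := h2 ε hε
  refine ⟨max C₁ C₂, hC₁.trans (le_max_left _ _), ?_⟩
  filter_upwards [h1, h2, eventually_ge_atTop 1] with n h1 h2 hn J s hs hsA
  have hlog : 0 ≤ Real.log n := Real.log_nonneg (by exact_mod_cast hn)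
  have hsum : ∀ f : ℕ → ℝ, ∑ i : Fin n, (A n J i).indicator (fun _ => (1 : ℝ))
      (fun j : Fin n => X j ω) * f i = ∑ i ∈ s, f i := by
    intro f
    rw [← Finset.inter_eq_right.2 hs, ← Finset.sum_ite_mem, Finset.sum_range]
    refine Finset.sum_congr rfl fun i _ => ?_
    by_cases h : (i : ℕ) ∈ s
    · simp [h, (hsA i).2 h]
    · simp [h, mt (hsA i).1 h]
  have hone := hsum fun _ => 1
  simp only [mul_one, Finset.sum_const, nsmul_eq_mul] at hone
  have h1 := h1 J
  have h2 := h2 J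
  rw [hsum, hone] at h1
  simp only [hneg] at h2
  rw [hsum (fun i => -condResidual κ φ (fun i => X i ω) (fun i => Y i ω) i), hone,
    Finset.sum_neg_distrib] at h2
  have h3 := mul_le_mul_of_nonneg_right (le_max_left C₁ C₂) hlog
  have h4 := mul_le_mul_of_nonneg_right (le_max_right C₁ C₂) hlog
  exact abs_le.2 ⟨by linarith, by linarith⟩

/-! ### Traces of boxes and balls on a sample -/

/-- On finitely many values a threshold acts only through the largest value below it; `none` stands
for there being no such value. This replaces a continuum of thresholds by `n + 1` choices. -/
theorem exists_option_le_iff {n : ℕ} (c : Fin n → ℝ) (p : ℝ) :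
    ∃ o : Option (Fin n), ∀ i, c i ≤ p ↔ ∃ l ∈ o, c i ≤ c l := by
  classical
  by_cases h : ∃ i, c i ≤ p
  · obtain ⟨i₀, hi₀⟩ := h
    obtain ⟨l, hl, hmax⟩ := (Finset.univ.filter fun i => c i ≤ p).exists_max_image c
      ⟨i₀, by simpa using hi₀⟩
    simp only [Finset.mem_filter, Finset.mem_univ, true_and] at hl hmax
    exact ⟨some l, fun i => ⟨fun hi => ⟨l, rfl, hmax i hi⟩, fun ⟨l', hl', h⟩ => by
      cases hl'; exact h.trans hl⟩⟩
  · push Not at h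
    exact ⟨none, fun i => by simp [h i]⟩

theorem exists_option_ge_iff {n : ℕ} (c : Fin n → ℝ) (p : ℝ) :
    ∃ o : Option (Fin n), ∀ i, p ≤ c i ↔ ∃ l ∈ o, c l ≤ c i := by
  obtain ⟨o, ho⟩ := exists_option_le_iff (fun i => -c i) (-p)
  exact ⟨o, fun i => by simpa using ho i⟩

theorem exists_option_mem_iff {n : ℕ} (c : Fin n → ℝ) {I : Set ℝ} (hI : I.OrdConnected) :
    ∃ o o' : Option (Fin n), ∀ i, c i ∈ I ↔ (∃ l ∈ o, c l ≤ c i) ∧ ∃ l ∈ o', c i ≤ c l := by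
  classical
  by_cases h : ∃ i, c i ∈ I
  · obtain ⟨i₀, hi₀⟩ := h
    have hne : (Finset.univ.filter fun i => c i ∈ I).Nonempty := ⟨i₀, by simpa using hi₀⟩
    obtain ⟨l, hl, hmax⟩ := Finset.exists_max_image _ c hne
    obtain ⟨l', hl', hmin⟩ := Finset.exists_min_image _ c hne
    simp only [Finset.mem_filter, Finset.mem_univ, true_and] at hl hmax hl' hmin
    refine ⟨some l', some l, fun i => ⟨fun hi => ⟨⟨l', rfl, hmin i hi⟩, l, rfl, hmax i hi⟩, ?_⟩⟩
    rintro ⟨⟨a, ha, h1⟩, b, hb, h2⟩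
    cases ha; cases hb
    exact hI.out hl' hl ⟨h1, h2⟩
  · push Not at h
    exact ⟨none, none, fun i => by simp [h i]⟩

/-- Residuals over sample points in a box, given by intervals for the coordinates `f`. -/
theorem ae_abs_sum_residual_box_le {Ω : Type*} [MeasurableSpace Ω] {μ : Measure Ω}
    [IsProbabilityMeasure μ] {α β : Type*} [MeasurableSpace α] [MeasurableSpace β]
    {ν : Measure α} [IsProbabilityMeasure ν] {κ : Kernel α β} [IsMarkovKernel κ]
    {X : ℕ → Ω → α} {Y : ℕ → Ω → β} (hX : ∀ i, Measurable (X i)) (hY : ∀ i, Measurable (Y i))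
    (hindep : iIndepFun (fun i ω => (X i ω, Y i ω)) μ)
    (hlaw : ∀ i, μ.map (fun ω => (X i ω, Y i ω)) = ν ⊗ₘ κ)
    {φ : β → ℝ} (hφ : Measurable φ) {B : ℝ} (hB : ∀ b, |φ b| ≤ B)
    {d : ℕ} (f : Fin d → α → ℝ) (hf : ∀ c, Measurable (f c)) :
    ∀ᵐ ω ∂μ, ∀ ε > 0, ∃ C, 0 ≤ C ∧ ∀ᶠ n : ℕ in atTop, ∀ I : Fin d → Set ℝ,
      (∀ c, (I c).OrdConnected) → ∀ s ⊆ Finset.range n,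
      (∀ i < n, i ∈ s ↔ ∀ c, f c (X i ω) ∈ I c) →
      |∑ i ∈ s, condResidual κ φ (fun i => X i ω) (fun i => Y i ω) i| ≤
        ε * s.card + C * Real.log n := by
  -- In each coordinate an interval is replaced by the sample points with the smallest and the
  -- largest entry in it, which leaves $(n+1)^{2d}$ index sets.
  have h := ae_abs_sum_residual_le hX hY hindep hlaw hφ hB
    (ι := fun n => Fin d → Option (Fin n) × Option (Fin n)) (c := 2 * d)
    (fun n => by simp [← pow_two, ← pow_mul])
    (fun n J i => ⋂ c, (⋃ l ∈ (J c).1, {x | f c (x l) ≤ f c (x i)}) ∩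
      ⋃ l ∈ (J c).2, {x | f c (x i) ≤ f c (x l)})
    (fun n J i => MeasurableSet.iInter fun c =>
      (MeasurableSet.iUnion fun l => MeasurableSet.iUnion fun _ =>
        measurableSet_le ((hf c).comp (measurable_pi_apply l))
          ((hf c).comp (measurable_pi_apply i))).inter
      (MeasurableSet.iUnion fun l => MeasurableSet.iUnion fun _ =>
        measurableSet_le ((hf c).comp (measurable_pi_apply i))
          ((hf c).comp (measurable_pi_apply l))))
  filter_upwards [h] with ω h ε hε
  obtain ⟨C, hC, h⟩ := h ε hε
  refine ⟨C, hC, h.mono fun n h I hI s hs hsI => ?_⟩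
  choose o o' ho using fun c => exists_option_mem_iff (fun i : Fin n => f c (X i ω)) (hI c)
  refine h (fun c => (o c, o' c)) s hs fun i => ?_
  rw [hsI i i.2]
  simp only [mem_iInter, mem_inter_iff, mem_iUnion, mem_ofPred_eq, exists_prop, ho]

/-- Residuals over the sample points in a ball whose centre lies on a line parallel to the first
axis; `v` stands for the squared distance to that line. -/
theorem ae_abs_sum_residual_ball_le {Ω : Type*} [MeasurableSpace Ω] {μ : Measure Ω}
    [IsProbabilityMeasure μ] {E β : Type*} [MeasurableSpace E] [MeasurableSpace β]
    {ν : Measure (ℝ × E)} [IsProbabilityMeasure ν] {κ : Kernel (ℝ × E) β} [IsMarkovKernel κ]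
    {X : ℕ → Ω → ℝ × E} {Y : ℕ → Ω → β} (hX : ∀ i, Measurable (X i))
    (hY : ∀ i, Measurable (Y i))
    (hindep : iIndepFun (fun i ω => (X i ω, Y i ω)) μ)
    (hlaw : ∀ i, μ.map (fun ω => (X i ω, Y i ω)) = ν ⊗ₘ κ)
    {φ : β → ℝ} (hφ : Measurable φ) {B : ℝ} (hB : ∀ b, |φ b| ≤ B)
    {v : E → ℝ} (hv : Measurable v) :
    ∀ᵐ ω ∂μ, ∀ ε > 0, ∃ C, 0 ≤ C ∧ ∀ᶠ n : ℕ in atTop, ∀ p : ℝ, ∀ s ⊆ Finset.range n,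
      (∀ i ∈ s, ∀ j < n, ((X j ω).1 - p) ^ 2 + v (X j ω).2 ≤
        ((X i ω).1 - p) ^ 2 + v (X i ω).2 → j ∈ s) →
      |∑ i ∈ s, condResidual κ φ (fun i => X i ω) (fun i => Y i ω) i| ≤
        ε * s.card + C * Real.log n := by
  -- For a farthest point `j` of the ball, $p^2$ cancels in the comparison of `i` with `j`, leaving
  -- $u_i-u_j\le 2p(x_i-x_j)$ with $x_i,x_j$ the first coordinates. By the sign of $x_i-x_j$ this is
  -- $b_{ij}\le p$, or $p\le b_{ij}$, or free of $p$. Each threshold is encoded by at most one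
  -- sample point, so $n(n+1)^2$ index sets suffice.
  let u : ℝ × E → ℝ := fun x => x.1 ^ 2 + v x.2
  let b : ℝ × E → ℝ × E → ℝ := fun x y => (u x - u y) / (2 * (x.1 - y.1))
  have hu : Measurable u := by fun_prop
  have hb : ∀ n (i j : Fin n), Measurable (fun x : Fin n → ℝ × E => b (x i) (x j)) := by
    intro n i j; fun_prop
  have h := ae_abs_sum_residual_le hX hY hindep hlaw hφ hB
    (ι := fun n => Fin n × Option (Fin n) × Option (Fin n)) (c := 3)
    (fun n => by
      simp only [Fintype.card_prod, Fintype.card_fin, Fintype.card_option]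
      calc n * ((n + 1) * (n + 1)) ≤ (n + 1) * ((n + 1) * (n + 1)) := by gcongr; omega
        _ = (n + 1) ^ 3 := by ring)
    (fun n J i => ({x | (x i).1 = (x J.1).1} ∩ {x | u (x i) ≤ u (x J.1)}) ∪
      (({x | (x J.1).1 < (x i).1} ∩ ⋃ l ∈ J.2.1, {x | b (x i) (x J.1) ≤ b (x l) (x J.1)}) ∪
      ({x | (x i).1 < (x J.1).1} ∩ ⋃ l ∈ J.2.2, {x | b (x l) (x J.1) ≤ b (x i) (x J.1)})))
    (fun n J i => by
      refine ((measurableSet_eq_fun (by fun_prop) (by fun_prop)).inter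
        (measurableSet_le (by fun_prop) (by fun_prop))).union
        (((measurableSet_lt (by fun_prop) (by fun_prop)).inter ?_).union
          ((measurableSet_lt (by fun_prop) (by fun_prop)).inter ?_)) <;>
      exact MeasurableSet.iUnion fun l => MeasurableSet.iUnion fun _ =>
        measurableSet_le (hb _ _ _) (hb _ _ _))
  filter_upwards [h] with ω h ε hε
  obtain ⟨C, hC, h⟩ := h ε hε
  refine ⟨C, hC, ?_⟩
  filter_upwards [h, eventually_ge_atTop 1] with n h hn p s hs hdown
  rcases s.eq_empty_or_nonempty with rfl | hne
  · have : 0 ≤ Real.log n := Real.log_nonneg (by exact_mod_cast hn)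
    simpa using mul_nonneg hC this
  obtain ⟨j, hj, hmax⟩ := s.exists_max_image
    (fun i => ((X i ω).1 - p) ^ 2 + v (X i ω).2) hne
  have hjn : j < n := Finset.mem_range.1 (hs hj)
  obtain ⟨o, ho⟩ := exists_option_le_iff (fun i : Fin n => b (X i ω) (X j ω)) p
  obtain ⟨o', ho'⟩ := exists_option_ge_iff (fun i : Fin n => b (X i ω) (X j ω)) p
  refine h (⟨j, hjn⟩, o, o') s hs fun i => ?_
  have hmem : (i : ℕ) ∈ s ↔ ((X i ω).1 - p) ^ 2 + v (X i ω).2 ≤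
      ((X j ω).1 - p) ^ 2 + v (X j ω).2 := ⟨hmax i, hdown j hj i i.2⟩
  have hmem' : (i : ℕ) ∈ s ↔
      u (X i ω) - u (X j ω) ≤ p * (2 * ((X i ω).1 - (X j ω).1)) := by
    rw [hmem]
    simp only [u]
    constructor <;> intro h <;> linarith
  rw [hmem']
  simp only [mem_union, mem_inter_iff, mem_iUnion, mem_ofPred_eq, exists_prop]
  rcases lt_trichotomy (X i ω).1 (X j ω).1 with hlt | heq | hlt
  · have h1 := ho' i
    simp only [b] at h1
    rw [le_div_iff_of_neg (by linarith)] at h1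
    simp only [hlt, hlt.ne, hlt.not_gt, false_and, true_and, false_or]
    rw [h1]
  · simp [heq]
  · have h1 := ho i
    simp only [b] at h1
    rw [div_le_iff₀ (by linarith)] at h1
    simp only [hlt, hlt.ne', hlt.not_gt, false_and, true_and, false_or, or_false]
    rw [h1]

/-! ### Consistency of weights on a fixed sample path -/

/-- Residuals sum up to `o(#s) + O(log N)`, uniformly over all sets `s` of sample points that are
initial segments in the order of the distances to a query point `x p`. -/
def BallDeviation {d : ℕ} (X : ℕ → EuclideanSpace ℝ (Fin d)) (x : ℝ → EuclideanSpace ℝ (Fin d))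
    (ξ : ℕ → ℝ) : Prop :=
  ∀ ε > 0, ∃ C, 0 ≤ C ∧ ∀ᶠ N : ℕ in atTop, ∀ p : ℝ, ∀ s ⊆ Finset.range N,
    (∀ i ∈ s, ∀ j < N, dist (X j) (x p) ≤ dist (X i) (x p) → j ∈ s) →
    |∑ i ∈ s, ξ i| ≤ ε * s.card + C * Real.log N

/-- Residuals sum up to `o(#s) + O(log N)`, uniformly over all sets `s` of sample points in a box. -/
def BoxDeviation {d : ℕ} (X : ℕ → EuclideanSpace ℝ (Fin d)) (ξ : ℕ → ℝ) : Prop :=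
  ∀ ε > 0, ∃ C, 0 ≤ C ∧ ∀ᶠ N : ℕ in atTop, ∀ I : Fin d → Set ℝ, (∀ c, (I c).OrdConnected) →
    ∀ s ⊆ Finset.range N, (∀ i < N, i ∈ s ↔ ∀ c, X i c ∈ I c) →
    |∑ i ∈ s, ξ i| ≤ ε * s.card + C * Real.log N

open Classical in
/-- Weights that are asymptotically probability weights concentrated at the query points `x p`,
`p ∈ T`, and that average out the residuals `ξ`, uniformly in `p`. -/
structure ConsistentWeights {d : ℕ} (X : ℕ → EuclideanSpace ℝ (Fin d))
    (x : ℝ → EuclideanSpace ℝ (Fin d)) (T : Set ℝ) (ξ : ℕ → ℝ)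
    (W : ℕ → ℕ → EuclideanSpace ℝ (Fin d) → ℝ) : Prop where
  nonneg : ∀ N i y, 0 ≤ W N i y
  sum : ∀ ε > 0, ∀ᶠ N : ℕ in atTop, ∀ p ∈ T, |∑ i ∈ Finset.range N, W N i (x p) - 1| ≤ ε
  far : ∀ δ > 0, ∀ ε > 0, ∀ᶠ N : ℕ in atTop, ∀ p ∈ T,
    ∑ i ∈ (Finset.range N).filter (fun i => δ < dist (X i) (x p)), W N i (x p) ≤ ε
  residual : ∀ ε > 0, ∀ᶠ N : ℕ in atTop, ∀ p ∈ T,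
    |∑ i ∈ Finset.range N, W N i (x p) * ξ i| ≤ ε

/-- Noise, bias and total weight are separated: $\sum w_ia_i-\psi=\sum w_i(a_i-b_i)+\sum
w_i(b_i-\psi)+(\sum w_i-1)\psi$. The bias is small at near points by continuity, and at far points
because these carry little weight. -/
theorem ConsistentWeights.eventually_abs_sub_le {d : ℕ} {X : ℕ → EuclideanSpace ℝ (Fin d)}
    {x : ℝ → EuclideanSpace ℝ (Fin d)} {T : Set ℝ} {a b : ℕ → ℝ}
    {W : ℕ → ℕ → EuclideanSpace ℝ (Fin d) → ℝ}
    (hW : ConsistentWeights X x T (fun i => a i - b i) W) {ψ : ℝ → ℝ} {B : ℝ}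
    (hb : ∀ i, |b i| ≤ B) (hψ : ∀ p, |ψ p| ≤ B)
    (hcont : ∀ ε > 0, ∃ δ > 0, ∀ p ∈ T, ∀ i, dist (X i) (x p) ≤ δ → |b i - ψ p| ≤ ε) :
    ∀ ε > 0, ∀ᶠ N : ℕ in atTop, ∀ p ∈ T,
      |∑ i ∈ Finset.range N, W N i (x p) * a i - ψ p| ≤ ε := by
  classical
  intro ε hε
  have hB : 0 ≤ B := (abs_nonneg _).trans (hb 0)
  -- The three terms cost `η`, `2η + 2Bη` and `Bη`; the cap at 1 bounds the total weight by 2.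
  set η : ℝ := min 1 (ε / (3 + 3 * B)) with hη
  have hη0 : 0 < η := by positivity
  have hη1 : η ≤ 1 := min_le_left _ _
  have hηε : η * (3 + 3 * B) ≤ ε := by
    rw [← le_div_iff₀ (by positivity)]; exact min_le_right _ _
  obtain ⟨δ, hδ, hcont⟩ := hcont η hη0
  filter_upwards [hW.sum η hη0, hW.far δ hδ η hη0, hW.residual η hη0] with N h1 h2 h3 p hp
  have h1 := h1 p hp
  have h2 := h2 p hp
  have h3 := h3 p hp
  have hw := fun i => hW.nonneg N i (x p)
  set w : ℕ → ℝ := fun i => W N i (x p) with hwdef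
  change ∀ i, 0 ≤ w i at hw
  change |∑ i ∈ Finset.range N, w i - 1| ≤ η at h1
  change ∑ i ∈ (Finset.range N).filter (fun i => δ < dist (X i) (x p)), w i ≤ η at h2
  change |∑ i ∈ Finset.range N, w i * (a i - b i)| ≤ η at h3
  change |∑ i ∈ Finset.range N, w i * a i - ψ p| ≤ ε
  have hdec : ∑ i ∈ Finset.range N, w i * a i - ψ p =
      ∑ i ∈ Finset.range N, w i * (a i - b i) + ∑ i ∈ Finset.range N, w i * (b i - ψ p) +
        (∑ i ∈ Finset.range N, w i - 1) * ψ p := by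
    simp only [mul_sub, Finset.sum_sub_distrib, ← Finset.sum_mul]
    ring
  have hbias : |∑ i ∈ Finset.range N, w i * (b i - ψ p)| ≤ η * 2 + 2 * B * η := by
    calc |∑ i ∈ Finset.range N, w i * (b i - ψ p)|
        ≤ ∑ i ∈ Finset.range N, (η * w i + 2 * B * if δ < dist (X i) (x p) then w i else 0) := by
          refine (Finset.abs_sum_le_sum_abs _ _).trans (Finset.sum_le_sum fun i _ => ?_)
          rw [abs_mul, abs_of_nonneg (hw i)]
          by_cases hi : δ < dist (X i) (x p)
          · rw [if_pos hi]
            have : |b i - ψ p| ≤ 2 * B := by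
              have h4 := abs_le.1 (hb i)
              have h5 := abs_le.1 (hψ p)
              exact abs_le.2 ⟨by linarith, by linarith⟩
            nlinarith [hw i, mul_le_mul_of_nonneg_left this (hw i), mul_nonneg hη0.le (hw i)]
          · rw [if_neg hi]
            have := mul_le_mul_of_nonneg_left (hcont p hp i (not_lt.1 hi)) (hw i)
            linarith
      _ = η * ∑ i ∈ Finset.range N, w i +
          2 * B * ∑ i ∈ (Finset.range N).filter (fun i => δ < dist (X i) (x p)), w i := by
          rw [Finset.sum_add_distrib, ← Finset.mul_sum, ← Finset.mul_sum, Finset.sum_filter]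
      _ ≤ η * 2 + 2 * B * η := by
          have := (abs_le.1 h1).2
          gcongr
          linarith
  have hlast : |(∑ i ∈ Finset.range N, w i - 1) * ψ p| ≤ η * B := by
    rw [abs_mul]
    exact mul_le_mul h1 (hψ p) (abs_nonneg _) hη0.le
  rw [hdec]
  refine (abs_add_three _ _ _).trans ?_
  linarith

/-! ### Nearest neighbours -/

open Classical in
-- The selected points form an initial segment in the order of distance, so the ball deviation bound
-- applies to them. Without triple ties there are `k` or `k + 1` of them, hence total weight tends
-- to one, and they lie within `δ` as soon as `k` sample points do.
theorem consistentWeights_knnWeight {d : ℕ} {X : ℕ → EuclideanSpace ℝ (Fin d)}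
    {x : ℝ → EuclideanSpace ℝ (Fin d)} {T : Set ℝ} {ξ : ℕ → ℝ} (hdev : BallDeviation X x ξ)
    {k : ℕ → ℕ} (hk : Tendsto (fun N => (k N : ℝ) / Real.log N) atTop atTop)
    (hcount : ∀ δ > 0, ∀ᶠ N : ℕ in atTop, ∀ p ∈ T,
      k N ≤ ((Finset.range N).filter (fun i => dist (X i) (x p) ≤ δ)).card)
    (hties : ∀ i j l, i ≠ j → i ≠ l → j ≠ l → ∀ p, dist (X i) (x p) = dist (X j) (x p) →
      dist (X l) (x p) ≠ dist (X i) (x p)) :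
    ConsistentWeights X x T ξ (fun N => knnWeight (k N) N X) := by
  let A : ℕ → ℝ → Finset ℕ := fun N p => (Finset.range N).filter fun i =>
    ((Finset.range N).filter
      (fun j => j ≠ i ∧ dist (X j) (x p) < dist (X i) (x p))).card < k N
  have hsum : ∀ N p (f : ℕ → ℝ), ∑ i ∈ Finset.range N, knnWeight (k N) N X i (x p) * f i =
      (∑ i ∈ A N p, f i) / k N := by
    intro N p f
    simp only [A, Finset.sum_filter, Finset.sum_div]
    refine Finset.sum_congr rfl fun i _ => ?_
    unfold knnWeight
    split_ifs <;> ring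
  have hdown : ∀ N p, ∀ i ∈ A N p, ∀ j < N, dist (X j) (x p) ≤ dist (X i) (x p) →
      j ∈ A N p := by
    intro N p i hi j hj hji
    simp only [A, Finset.mem_filter, Finset.mem_range] at hi ⊢
    refine ⟨hj, lt_of_le_of_lt (Finset.card_le_card fun l hl => ?_) hi.2⟩
    simp only [Finset.mem_filter, Finset.mem_range] at hl ⊢
    refine ⟨hl.1, ?_, hl.2.2.trans_le hji⟩
    rintro rfl
    exact absurd hl.2.2 (not_lt.2 hji)
  have hstrict : ∀ N p, ∀ i ∈ A N p,
      ((Finset.range N).filter (fun j => dist (X j) (x p) < dist (X i) (x p))).card < k N := by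
    intro N p i hi
    simp only [A, Finset.mem_filter] at hi
    refine lt_of_le_of_lt (Finset.card_le_card fun l hl => ?_) hi.2
    simp only [Finset.mem_filter] at hl ⊢
    exact ⟨hl.1, by rintro rfl; exact lt_irrefl _ hl.2, hl.2⟩
  -- At most `k - 1` points are strictly closer than the farthest selected one, and at most two are
  -- at its distance.
  have hupper : ∀ N p, (A N p).card ≤ k N + 1 := by
    intro N p
    rcases (A N p).eq_empty_or_nonempty with h | hne
    · simp [h]
    obtain ⟨i, hi, hmax⟩ := (A N p).exists_max_image (fun i => dist (X i) (x p)) hne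
    have h1 := hstrict N p i hi
    have h2 : A N p ⊆ ((Finset.range N).filter
        (fun j => dist (X j) (x p) < dist (X i) (x p))) ∪
        (A N p).filter (fun j => dist (X j) (x p) = dist (X i) (x p)) := by
      intro j hj
      have hjN : j ∈ Finset.range N := (Finset.mem_filter.1 hj).1
      rcases (hmax j hj).lt_or_eq with h | h
      · exact Finset.mem_union_left _ (Finset.mem_filter.2 ⟨hjN, h⟩)
      · exact Finset.mem_union_right _ (Finset.mem_filter.2 ⟨hj, h⟩)
    have h3 : ((A N p).filter (fun j => dist (X j) (x p) = dist (X i) (x p))).card ≤ 2 := by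
      by_contra hcon
      obtain ⟨a, b, c, ha, hb, hc, hab, hac, hbc⟩ := Finset.two_lt_card_iff.1 (not_le.1 hcon)
      simp only [Finset.mem_filter] at ha hb hc
      exact hties a b c hab hac hbc p (ha.2.trans hb.2.symm) (hc.2.trans ha.2.symm)
    have := (Finset.card_le_card h2).trans (Finset.card_union_le _ _)
    omega
  -- Every point strictly closer than a nearest unselected point is selected; were there fewer than
  -- `k` of these, that point would be selected too.
  have hlower : ∀ N p, k N ≤ N → k N ≤ (A N p).card := by
    intro N p hkN
    by_contra hcon
    have hne : (Finset.range N \ A N p).Nonempty := by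
      rw [← Finset.card_pos]
      have := Finset.le_card_sdiff (A N p) (Finset.range N)
      rw [Finset.card_range] at this
      omega
    obtain ⟨i, hi, hmin⟩ := Finset.exists_min_image _ (fun i => dist (X i) (x p)) hne
    rw [Finset.mem_sdiff] at hi
    refine hi.2 (Finset.mem_filter.2 ⟨hi.1, lt_of_le_of_lt (Finset.card_le_card fun l hl => ?_)
      (not_le.1 hcon)⟩)
    simp only [Finset.mem_filter] at hl
    by_contra hlA
    exact absurd hl.2.2 (not_lt.2 (hmin l (Finset.mem_sdiff.2 ⟨hl.1, hlA⟩)))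
  have hnear : ∀ N p δ, k N ≤ ((Finset.range N).filter (fun i => dist (X i) (x p) ≤ δ)).card →
      ∀ i ∈ A N p, dist (X i) (x p) ≤ δ := by
    intro N p δ hc i hi
    by_contra hcon
    have h1 := hstrict N p i hi
    have h2 : (Finset.range N).filter (fun i => dist (X i) (x p) ≤ δ) ⊆
        (Finset.range N).filter (fun j => dist (X j) (x p) < dist (X i) (x p)) := by
      intro j hj
      simp only [Finset.mem_filter] at hj ⊢
      exact ⟨hj.1, hj.2.trans_lt (not_le.1 hcon)⟩
    have := Finset.card_le_card h2
    omega
  have hkN : ∀ᶠ N : ℕ in atTop, ∀ p ∈ T, k N ≤ N := by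
    filter_upwards [hcount 1 one_pos] with N h p hp
    exact (h p hp).trans ((Finset.card_filter_le _ _).trans (Finset.card_range N).le)
  have hkbig : ∀ M : ℝ, ∀ᶠ N : ℕ in atTop, M * Real.log N ≤ k N ∧ M ≤ k N := by
    intro M
    have hlog : ∀ᶠ N : ℕ in atTop, 1 ≤ Real.log N :=
      (Real.tendsto_log_atTop.comp tendsto_natCast_atTop_atTop).eventually_ge_atTop 1
    filter_upwards [hk.eventually_ge_atTop (max M 0), hlog] with N h1 h2
    rw [le_div_iff₀ (by linarith)] at h1
    have h3 := mul_le_mul_of_nonneg_right (le_max_left M 0) (by linarith : 0 ≤ Real.log N)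
    have h4 := mul_le_mul_of_nonneg_left h2 (le_max_right M 0)
    exact ⟨h3.trans h1, by linarith [le_max_left M 0]⟩
  refine ⟨fun N i y => ?_, fun ε hε => ?_, fun δ hδ ε hε => ?_, fun ε hε => ?_⟩
  · unfold knnWeight
    split_ifs <;> positivity
  · filter_upwards [hkN, hkbig (1 / ε), hkbig 1] with N h1 h2 h3 p hp
    have hs := hsum N p fun _ => 1
    simp only [mul_one, Finset.sum_const, nsmul_eq_mul] at hs
    have hk0 : (0 : ℝ) < k N := by linarith [h3.2]
    have h4 : (k N : ℝ) ≤ (A N p).card := by exact_mod_cast hlower N p (h1 p hp)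
    have h5 : ((A N p).card : ℝ) ≤ k N + 1 := by exact_mod_cast hupper N p
    have h6 : 1 ≤ ε * k N := by
      have := h2.2
      rwa [div_le_iff₀' hε] at this
    rw [hs, div_sub_one hk0.ne', abs_of_nonneg (by apply div_nonneg <;> linarith),
      div_le_iff₀ hk0]
    linarith
  · filter_upwards [hcount δ hδ] with N h p hp
    rw [Finset.sum_eq_zero]
    · exact hε.le
    intro i hi
    rw [Finset.mem_filter] at hi
    have hiA : i ∉ A N p := fun hiA => absurd hi.2 (not_lt.2 (hnear N p δ (h p hp) i hiA))
    have : ¬ ((Finset.range N).filter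
      (fun j => j ≠ i ∧ dist (X j) (x p) < dist (X i) (x p))).card < k N := fun h =>
        hiA (Finset.mem_filter.2 ⟨hi.1, h⟩)
    exact if_neg this
  · obtain ⟨C, hC, hdev⟩ := hdev (ε / 4) (by positivity)
    filter_upwards [hdev, hkbig (2 * C / ε), hkbig 1] with N h1 h2 h3 p hp
    have hk0 : (1 : ℝ) ≤ k N := h3.2
    have h4 := h1 p (A N p) (Finset.filter_subset _ _) (hdown N p)
    have h5 : ((A N p).card : ℝ) ≤ k N + 1 := by exact_mod_cast hupper N p
    have h6 : C * Real.log N ≤ ε / 2 * k N := by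
      have := mul_le_mul_of_nonneg_left h2.1 (by positivity : 0 ≤ ε / 2)
      calc C * Real.log N = ε / 2 * (2 * C / ε * Real.log N) := by field_simp
        _ ≤ _ := this
    rw [hsum, abs_div, Nat.abs_cast, div_le_iff₀ (by linarith)]
    have h7 : ε / 4 * (A N p).card ≤ ε / 4 * (2 * k N) := by gcongr; linarith
    linarith

/-! ### Kernel regression -/

open Classical in
-- Layer-cake formula: $w_i=\int_0^1 1\{t\le w_i\}\,dt$, so the weighted sum is an average of sums
-- over superlevel sets, and the bound integrates.
theorem abs_sum_mul_le_of_superlevel {s : Finset ℕ} {w ξ : ℕ → ℝ} {ε b : ℝ}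
    (hw0 : ∀ i ∈ s, 0 ≤ w i) (hw1 : ∀ i ∈ s, w i ≤ 1)
    (h : ∀ t > 0, |∑ i ∈ s.filter (fun i => t ≤ w i), ξ i| ≤
      ε * (s.filter (fun i => t ≤ w i)).card + b) :
    |∑ i ∈ s, w i * ξ i| ≤ ε * ∑ i ∈ s, w i + b := by
  let I : ℕ → ℝ → ℝ := fun i => (Iic (w i)).indicator fun _ => 1
  have hI : ∀ i, IntegrableOn (I i) (Ioc 0 1) := fun i =>
    (integrableOn_const (by simp)).indicator measurableSet_Iic
  have hIw : ∀ i ∈ s, ∫ t in Ioc (0 : ℝ) 1, I i t = w i := by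
    intro i hi
    simp only [I]
    rw [setIntegral_indicator measurableSet_Iic, setIntegral_const]
    have : Ioc (0 : ℝ) 1 ∩ Iic (w i) = Ioc 0 (w i) := by
      ext t
      simp only [mem_inter_iff, mem_Ioc, mem_Iic]
      exact ⟨fun h => ⟨h.1.1, h.2⟩, fun h => ⟨⟨h.1, h.2.trans (hw1 i hi)⟩, h.2⟩⟩
    simp [this, Measure.real, Real.volume_Ioc, hw0 i hi]
  have hsum : ∀ (f : ℕ → ℝ) t, ∑ i ∈ s, I i t * f i =
      ∑ i ∈ s.filter (fun i => t ≤ w i), f i := by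
    intro f t
    rw [Finset.sum_filter]
    refine Finset.sum_congr rfl fun i _ => ?_
    by_cases ht : t ≤ w i <;> simp [I, ht]
  have hint : ∀ f : ℕ → ℝ, IntegrableOn (fun t => ∑ i ∈ s, I i t * f i) (Ioc 0 1) := fun f =>
    integrable_finsetSum _ fun i _ => (hI i).mul_const _
  have hval : ∀ f : ℕ → ℝ, ∫ t in Ioc (0 : ℝ) 1, ∑ i ∈ s, I i t * f i = ∑ i ∈ s, w i * f i := by
    intro f
    rw [integral_finsetSum _ fun i _ => (hI i).mul_const _]
    refine Finset.sum_congr rfl fun i hi => ?_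
    rw [integral_mul_const, hIw i hi]
  calc |∑ i ∈ s, w i * ξ i| = |∫ t in Ioc (0 : ℝ) 1, ∑ i ∈ s, I i t * ξ i| := by rw [hval]
    _ ≤ ∫ t in Ioc (0 : ℝ) 1, |∑ i ∈ s, I i t * ξ i| := abs_integral_le_integral_abs
    _ ≤ ∫ t in Ioc (0 : ℝ) 1, (ε * (∑ i ∈ s, I i t * 1) + b) := by
        refine setIntegral_mono_on (hint ξ).abs
          (((hint fun _ => 1).const_mul ε).add (integrableOn_const (by simp)))
          measurableSet_Ioc fun t ht => ?_
        rw [hsum, hsum]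
        simpa using h t ht.1
    _ = ε * ∑ i ∈ s, w i + b := by
        rw [integral_add ((hint fun _ => 1).const_mul ε) (integrableOn_const (by simp)),
          integral_const_mul, hval]
        simp

open Classical in
-- Superlevel sets of a radially decreasing kernel are initial segments in the order of distance.
-- Points within `h / 2` keep the normalising sum above a multiple of $Nh^d$, which dominates both
-- the far mass and the $\log N$ term of the noise.
theorem consistentWeights_kernelWeight {d : ℕ} {X : ℕ → EuclideanSpace ℝ (Fin d)}
    {x : ℝ → EuclideanSpace ℝ (Fin d)} {T : Set ℝ} {ξ : ℕ → ℝ} (hdev : BallDeviation X x ξ)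
    {K : EuclideanSpace ℝ (Fin d) → ℝ} {k : ℝ → ℝ} (hK : ∀ u, K u = k ‖u‖)
    (hk : AntitoneOn k (Ici 0)) (hk0 : ∀ r, 0 ≤ k r) (hk1 : ∀ r, k r ≤ 1) (hkpos : 0 < k (1 / 2))
    (hktail : Tendsto (fun r => r ^ d * k r) atTop (𝓝 0))
    {h : ℕ → ℝ} (hh : ∀ N, 0 < h N) (hh0 : Tendsto h atTop (𝓝 0))
    (hhN : Tendsto (fun N : ℕ => (N : ℝ) * h N ^ d / Real.log N) atTop atTop)
    {c : ℝ} (hc : 0 < c)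
    (hcount : ∀ᶠ N : ℕ in atTop, ∀ p ∈ T, c * (N * h N ^ d) ≤
      ((Finset.range N).filter (fun i => dist (X i) (x p) ≤ h N / 2)).card) :
    ConsistentWeights X x T ξ (fun N => kernelWeight K (h N) N X) := by
  have hKd : ∀ N p i, K ((h N)⁻¹ • (x p - X i)) = k (dist (X i) (x p) / h N) := by
    intro N p i
    rw [hK, norm_smul, norm_inv, Real.norm_of_nonneg (hh N).le, ← dist_eq_norm, dist_comm,
      inv_mul_eq_div]
  have hKnn : ∀ u, 0 ≤ K u := fun u => by rw [hK]; exact hk0 _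
  let τ : ℕ → ℝ → ℝ := fun N p => ∑ j ∈ Finset.range N, k (dist (X j) (x p) / h N)
  have hweight : ∀ N p i, kernelWeight K (h N) N X i (x p) =
      k (dist (X i) (x p) / h N) / τ N p := by
    intro N p i
    simp only [kernelWeight, hKd, τ]
  have hτ : ∀ᶠ N : ℕ in atTop, ∀ p ∈ T, k (1 / 2) * c * (N * h N ^ d) ≤ τ N p := by
    filter_upwards [hcount] with N h1 p hp
    calc k (1 / 2) * c * (N * h N ^ d) = k (1 / 2) * (c * (N * h N ^ d)) := by ring
      _ ≤ k (1 / 2) * ((Finset.range N).filter (fun i => dist (X i) (x p) ≤ h N / 2)).card := by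
          gcongr; exact h1 p hp
      _ = ∑ i ∈ (Finset.range N).filter (fun i => dist (X i) (x p) ≤ h N / 2), k (1 / 2) := by
          rw [Finset.sum_const, nsmul_eq_mul, mul_comm]
      _ ≤ ∑ i ∈ (Finset.range N).filter (fun i => dist (X i) (x p) ≤ h N / 2),
          k (dist (X i) (x p) / h N) := by
          refine Finset.sum_le_sum fun i hi => ?_
          have := (Finset.mem_filter.1 hi).2
          refine hk (div_nonneg dist_nonneg (hh N).le) (by norm_num : (0 : ℝ) ≤ 1 / 2) ?_
          rw [div_le_iff₀ (hh N)]
          linarith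
      _ ≤ τ N p := Finset.sum_le_sum_of_subset_of_nonneg (Finset.filter_subset _ _)
          fun i _ _ => hk0 _
  have hNh : ∀ᶠ N : ℕ in atTop, 0 < k (1 / 2) * c * ((N : ℝ) * h N ^ d) := by
    filter_upwards [eventually_ge_atTop 1] with N hN
    have := hh N
    have : (0 : ℝ) < N := by exact_mod_cast hN
    positivity
  refine ⟨fun N i y => ?_, fun ε hε => ?_, fun δ hδ ε hε => ?_, fun ε hε => ?_⟩
  · exact div_nonneg (hKnn _) (Finset.sum_nonneg fun _ _ => hKnn _)
  · filter_upwards [hτ, hNh] with N h1 h2 p hp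
    have h3 := h2.trans_le (h1 p hp)
    simp only [hweight, ← Finset.sum_div]
    rw [show (∑ i ∈ Finset.range N, k (dist (X i) (x p) / h N)) = τ N p from rfl,
      div_self h3.ne', sub_self, abs_zero]
    exact hε.le
  -- The tail condition at radius `δ / h` says $k(\delta/h)=o(h^d)$, so even $N$ far points
  -- contribute only $o(Nh^d)$.
  · have hlim : Tendsto (fun N => (δ / h N) ^ d * k (δ / h N)) atTop (𝓝 0) := by
      refine hktail.comp (Tendsto.const_mul_atTop hδ ?_)
      exact (tendsto_inv_nhdsGT_zero.comp
        (tendsto_nhdsWithin_iff.2 ⟨hh0, Eventually.of_forall hh⟩))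
    have hε' : 0 < ε * (k (1 / 2) * c * δ ^ d) := by positivity
    filter_upwards [hτ, hNh, hlim.eventually_le_const hε', eventually_ge_atTop 1]
      with N h1 h2 h3 hN p hp
    have hhN' := hh N
    have hN0 : (0 : ℝ) < N := by exact_mod_cast hN
    have h4 := h2.trans_le (h1 p hp)
    simp only [hweight, ← Finset.sum_div]
    rw [div_le_iff₀ h4]
    have h5 : k (δ / h N) ≤ ε * (k (1 / 2) * c) * h N ^ d := by
      rw [div_pow] at h3
      have h6 : δ ^ d / h N ^ d * k (δ / h N) = δ ^ d * (k (δ / h N) / h N ^ d) := by ring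
      have h7 : ε * (k (1 / 2) * c * δ ^ d) = δ ^ d * (ε * (k (1 / 2) * c)) := by ring
      rw [h6, h7] at h3
      rw [← div_le_iff₀ (by positivity)]
      exact le_of_mul_le_mul_left h3 (by positivity)
    calc ∑ i ∈ (Finset.range N).filter (fun i => δ < dist (X i) (x p)),
          k (dist (X i) (x p) / h N)
        ≤ ∑ i ∈ (Finset.range N).filter (fun i => δ < dist (X i) (x p)), k (δ / h N) := by
          refine Finset.sum_le_sum fun i hi => ?_
          have := (Finset.mem_filter.1 hi).2.le
          exact hk (by simp only [mem_Ici]; positivity) (by simp only [mem_Ici]; positivity)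
            (by gcongr)
      _ ≤ N * k (δ / h N) := by
          rw [Finset.sum_const, nsmul_eq_mul]
          have : ((Finset.range N).filter (fun i => δ < dist (X i) (x p))).card ≤ N :=
            (Finset.card_filter_le _ _).trans (Finset.card_range N).le
          have := hk0 (δ / h N)
          gcongr
      _ ≤ N * (ε * (k (1 / 2) * c) * h N ^ d) := by gcongr
      _ = ε * (k (1 / 2) * c * (N * h N ^ d)) := by ring
      _ ≤ ε * τ N p := by gcongr; exact h1 p hp
  · obtain ⟨C, hC, hdev⟩ := hdev (ε / 2) (by positivity)
    filter_upwards [hτ, hNh, hdev, hhN.eventually_ge_atTop (2 * C / (ε * (k (1 / 2) * c))),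
      eventually_ge_atTop 2] with N h1 h2 h3 h5 hN p hp
    have hlog : 0 < Real.log N := Real.log_pos (by exact_mod_cast hN)
    have h4 := h2.trans_le (h1 p hp)
    -- Applied before normalisation, where the weights are in `[0, 1]`.
    have hlc := abs_sum_mul_le_of_superlevel (s := Finset.range N) (ξ := ξ)
      (w := fun i => k (dist (X i) (x p) / h N)) (ε := ε / 2) (b := C * Real.log N)
      (fun i _ => hk0 _) (fun i _ => hk1 _) (fun t _ => by
        refine h3 p _ (Finset.filter_subset _ _) fun i hi j hj hji => ?_
        rw [Finset.mem_filter] at hi ⊢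
        refine ⟨Finset.mem_range.2 hj, hi.2.trans (hk ?_ ?_ ?_)⟩
        · exact div_nonneg dist_nonneg (hh N).le
        · exact div_nonneg dist_nonneg (hh N).le
        · have := hh N
          gcongr)
    simp only [hweight, div_mul_eq_mul_div, ← Finset.sum_div]
    rw [abs_div, abs_of_pos h4, div_le_iff₀ h4]
    refine hlc.trans ?_
    change ε / 2 * τ N p + C * Real.log N ≤ ε * τ N p
    rw [le_div_iff₀ hlog, div_mul_eq_mul_div, div_le_iff₀ (by positivity)] at h5
    have h6 := mul_le_mul_of_nonneg_left (h1 p hp) hε.le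
    linarith

/-! ### Trees and forests -/

open Classical in
theorem sum_cartWeight_mul {d : ℕ} (T : RegTree d) (N : ℕ) (X : ℕ → EuclideanSpace ℝ (Fin d))
    (y : EuclideanSpace ℝ (Fin d)) (s : Finset ℕ) (f : ℕ → ℝ) :
    ∑ i ∈ s, cartWeight T N X i y * f i =
      (∑ i ∈ s.filter (fun j => T.leaf (X j) = T.leaf y), f i) / T.count N X y := by
  rw [Finset.sum_filter, Finset.sum_div]
  refine Finset.sum_congr rfl fun i _ => ?_
  unfold cartWeight
  by_cases h : T.leaf (X i) = T.leaf y
  · simp [h, div_eq_inv_mul]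
  · simp [h, Ne.symm h]

theorem sum_forestWeight_mul {d : ℕ} (n : ℕ) (T : ℕ → RegTree d) (N : ℕ)
    (X : ℕ → EuclideanSpace ℝ (Fin d)) (y : EuclideanSpace ℝ (Fin d)) (s : Finset ℕ)
    (f : ℕ → ℝ) :
    ∑ i ∈ s, forestWeight n T N X i y * f i =
      1 / (n : ℝ) * ∑ e ∈ Finset.range n, ∑ i ∈ s, cartWeight (T e) N X i y * f i := by
  simp only [forestWeight, mul_assoc, Finset.sum_mul, ← Finset.mul_sum]
  rw [Finset.sum_comm]

theorem abs_mean_sub_le {n : ℕ} (hn : 0 < n) {a : ℕ → ℝ} {v ε : ℝ} (h : ∀ e < n, |a e - v| ≤ ε) :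
    |1 / (n : ℝ) * ∑ e ∈ Finset.range n, a e - v| ≤ ε := by
  have hn0 : (0 : ℝ) < n := by exact_mod_cast hn
  have h1 : 1 / (n : ℝ) * ∑ e ∈ Finset.range n, a e - v =
      (∑ e ∈ Finset.range n, (a e - v)) / n := by
    rw [Finset.sum_sub_distrib, Finset.sum_const, Finset.card_range, nsmul_eq_mul]
    field_simp
  rw [h1, abs_div, Nat.abs_cast, div_le_iff₀ hn0]
  calc |∑ e ∈ Finset.range n, (a e - v)| ≤ ∑ e ∈ Finset.range n, |a e - v| :=
        Finset.abs_sum_le_sum_abs _ _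
    _ ≤ ∑ e ∈ Finset.range n, ε := Finset.sum_le_sum fun e he => h e (Finset.mem_range.1 he)
    _ = ε * n := by rw [Finset.sum_const, Finset.card_range, nsmul_eq_mul, mul_comm]

open Classical in
-- A leaf is a box, and the deviation bound holds for all boxes simultaneously, so it does not
-- matter how the trees were grown. All estimates are uniform over the trees, and hence pass to
-- their average.
theorem consistentWeights_forestWeight {d : ℕ} {X : ℕ → EuclideanSpace ℝ (Fin d)}
    {x : ℝ → EuclideanSpace ℝ (Fin d)} {A : Set ℝ} {ξ : ℕ → ℝ} (hdev : BoxDeviation X ξ)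
    {S : Set (EuclideanSpace ℝ (Fin d))} (hXS : ∀ i, X i ∈ S)
    {n : ℕ → ℕ} (hn : ∀ N, 0 < n N) {T : ℕ → ℕ → RegTree d}
    (hT : ForestTuned n T X S (x '' A)) :
    ConsistentWeights X x A ξ (fun N => forestWeight (n N) (T N) N X) := by
  obtain ⟨δ, a, hδ, ha, hT⟩ := hT
  have hbig : ∀ M : ℝ, ∀ᶠ N : ℕ in atTop, M * Real.log N ≤ a N ∧ 0 < a N := by
    intro M
    filter_upwards [ha.eventually_ge_atTop (max M 1), eventually_ge_atTop 2] with N h1 h2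
    have hlog : 0 < Real.log N := Real.log_pos (by exact_mod_cast h2)
    rw [le_div_iff₀ hlog] at h1
    have h3 := mul_le_mul_of_nonneg_right (le_max_left M 1) hlog.le
    have h4 := mul_le_mul_of_nonneg_right (le_max_right M 1) hlog.le
    exact ⟨h3.trans h1, by linarith⟩
  have hcount : ∀ N e p, ((T N e).count N X (x p)) = ((Finset.range N).filter
      (fun j => (T N e).leaf (X j) = (T N e).leaf (x p))).card := by
    intro N e p
    unfold RegTree.count
    congr
  refine ⟨fun N i y => ?_, fun ε hε => ?_, fun δ' hδ' ε hε => ?_, fun ε hε => ?_⟩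
  · refine mul_nonneg (by positivity) (Finset.sum_nonneg fun e _ => div_nonneg ?_ (by positivity))
    split_ifs <;> norm_num
  · filter_upwards [hT, hbig 0] with N h1 h2 p hp
    have h3 := sum_forestWeight_mul (n N) (T N) N X (x p) (Finset.range N) fun _ => 1
    simp only [mul_one] at h3
    rw [h3]
    refine abs_mean_sub_le (hn N) fun e he => ?_
    have h4 := sum_cartWeight_mul (T N e) N X (x p) (Finset.range N) fun _ => 1
    simp only [mul_one, Finset.sum_const, nsmul_eq_mul] at h4
    have h5 := h2.2.trans_le (h1 e he (x p) (mem_image_of_mem x hp)).1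
    rw [h4, ← hcount, div_self h5.ne', sub_self, abs_zero]
    exact hε.le
  · filter_upwards [hT, hδ.eventually_le_const hδ'] with N h1 h2 p hp
    have h3 := sum_forestWeight_mul (n N) (T N) N X (x p)
      ((Finset.range N).filter (fun i => δ' < dist (X i) (x p))) fun _ => 1
    simp only [mul_one] at h3
    rw [h3, Finset.sum_eq_zero, mul_zero]
    · exact hε.le
    intro e he
    refine Finset.sum_eq_zero fun i hi => ?_
    rw [Finset.mem_filter] at hi
    have h4 : (T N e).leaf (x p) ≠ (T N e).leaf (X i) := fun heq =>
      absurd (((h1 e (Finset.mem_range.1 he) (x p) (mem_image_of_mem x hp)).2 (X i) (hXS i)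
        heq.symm).trans h2) (not_le.2 hi.2)
    simp [cartWeight, h4]
  · obtain ⟨C, hC, hdev⟩ := hdev (ε / 2) (by positivity)
    filter_upwards [hT, hdev, hbig (2 * C / ε)] with N h1 h2 h3 p hp
    rw [sum_forestWeight_mul, ← sub_zero (_ * _)]
    refine abs_mean_sub_le (hn N) fun e he => ?_
    rw [sum_cartWeight_mul, sub_zero]
    have h4 := (h1 e he (x p) (mem_image_of_mem x hp)).1
    have h5 := h3.2.trans_le h4
    obtain ⟨I, hI, hbox⟩ := (T N e).isBox ((T N e).leaf (x p))
    have h6 := h2 I hI _ (Finset.filter_subset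
      (fun j => (T N e).leaf (X j) = (T N e).leaf (x p)) (Finset.range N)) fun i hi => by
        rw [Finset.mem_filter, Finset.mem_range, ← hbox]
        exact and_iff_right hi
    rw [abs_div, Nat.abs_cast, div_le_iff₀ h5]
    rw [← hcount] at h6
    refine h6.trans ?_
    have h7 : C * Real.log N ≤ ε / 2 * a N := by
      have := mul_le_mul_of_nonneg_left h3.1 (by positivity : 0 ≤ ε / 2)
      calc C * Real.log N = ε / 2 * (2 * C / ε * Real.log N) := by field_simp
        _ ≤ _ := this
    have h8 := mul_le_mul_of_nonneg_left h4 (by positivity : 0 ≤ ε / 2)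
    linarith

/-! ### Test functions and uniform atomlessness -/

/-- Truncation of a real number to `[a, b]`, as a bounded continuous function. -/
noncomputable def clampBCF (a b : ℝ) : ℝ →ᵇ ℝ :=
  BoundedContinuousFunction.ofNormedAddCommGroup (fun t => max a (min t b)) (by fun_prop)
    (|a| + |b|) fun t => by
      rw [Real.norm_eq_abs, abs_le]
      have h1 := neg_abs_le a
      have h2 := le_abs_self a
      have h3 := le_abs_self b
      have h4 := abs_nonneg a
      have h5 := abs_nonneg b
      exact ⟨by linarith [le_max_left a (min t b)],
        max_le (by linarith) (by linarith [min_le_right t b])⟩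

theorem clampBCF_apply (a b t : ℝ) : clampBCF a b t = max a (min t b) := rfl

theorem exists_measure_Icc_lt {P : Measure ℝ} [IsFiniteMeasure P] {q : ℝ} (h : P {q} = 0)
    {ε : ℝ≥0∞} (hε : 0 < ε) : ∃ η > 0, P (Icc (q - η) (q + η)) < ε := by
  have hanti : Antitone (fun n : ℕ => Icc (q - 1 / ((n : ℝ) + 1)) (q + 1 / ((n : ℝ) + 1))) := by
    intro n m hnm
    have : 1 / ((m : ℝ) + 1) ≤ 1 / ((n : ℝ) + 1) := by gcongr
    exact Icc_subset_Icc (by linarith) (by linarith)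
  have hlim := tendsto_measure_iInter_atTop (μ := P)
    (s := fun n : ℕ => Icc (q - 1 / ((n : ℝ) + 1)) (q + 1 / ((n : ℝ) + 1)))
    (fun n => measurableSet_Icc.nullMeasurableSet) hanti
    ⟨0, measure_ne_top _ _⟩
  have hint : ⋂ n : ℕ, Icc (q - 1 / ((n : ℝ) + 1)) (q + 1 / ((n : ℝ) + 1)) = {q} := by
    ext t
    simp only [mem_iInter, mem_Icc, mem_singleton_iff]
    constructor
    · intro ht
      refine eq_of_abs_sub_le_all fun η hη => ?_
      obtain ⟨n, hn⟩ := exists_nat_one_div_lt hη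
      exact abs_le.2 ⟨by linarith [(ht n).1], by linarith [(ht n).2]⟩
    · rintro rfl n
      have : 0 < 1 / ((n : ℝ) + 1) := by positivity
      exact ⟨by linarith, by linarith⟩
  rw [hint, h] at hlim
  obtain ⟨n, hn⟩ := (hlim.eventually_lt_const hε).exists
  exact ⟨1 / ((n : ℝ) + 1), by positivity, hn⟩

/-- A weakly continuous family of atomless laws over a compact set is uniformly atomless. -/
theorem exists_forall_measureReal_Icc_le {X : Type*} [TopologicalSpace X] {F : X → Measure ℝ}
    [∀ x, IsProbabilityMeasure (F x)] {K : Set X} (hK : IsCompact K) {a b : ℝ}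
    (hatom : ∀ x ∈ K, ∀ d, F x {d} = 0)
    (hcont : ∀ φ : ℝ →ᵇ ℝ, ContinuousOn (fun x => ∫ d, φ d ∂(F x)) K) {ε : ℝ} (hε : 0 < ε) :
    ∃ η > 0, ∀ x ∈ K, ∀ q ∈ Icc a b, (F x).real (Icc (q - η) (q + η)) ≤ ε := by
  suffices h : ∃ η > 0, ∀ y ∈ K ×ˢ Icc a b,
      (F y.1).real (Icc (y.2 - η) (y.2 + η)) ≤ ε by
    obtain ⟨η, hη, h⟩ := h
    exact ⟨η, hη, fun x hx q hq => h (x, q) ⟨hx, hq⟩⟩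
  -- By compactness a suitable `η` is needed only locally, near each pair of a point and a level.
  refine (hK.prod isCompact_Icc).induction_on
    (p := fun s => ∃ η > 0, ∀ y ∈ s, (F y.1).real (Icc (y.2 - η) (y.2 + η)) ≤ ε)
    ⟨1, one_pos, by simp⟩ ?_ ?_ ?_
  · rintro s t hst ⟨η, hη, h⟩
    exact ⟨η, hη, fun y hy => h y (hst hy)⟩
  · rintro s t ⟨η, hη, h⟩ ⟨η', hη', h'⟩
    refine ⟨min η η', lt_min hη hη', ?_⟩
    have hmin := min_le_left η η'
    have hmin' := min_le_right η η'
    rintro y (hy | hy)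
    · exact (measureReal_mono (Icc_subset_Icc (by linarith) (by linarith))).trans (h y hy)
    · exact (measureReal_mono (Icc_subset_Icc (by linarith) (by linarith))).trans (h' y hy)
  · rintro ⟨x₀, q₀⟩ ⟨hx₀, hq₀⟩
    obtain ⟨η, hη, hlt⟩ := exists_measure_Icc_lt (hatom x₀ hx₀ q₀)
      (ENNReal.ofReal_pos.2 hε)
    have hb01 : ∀ t, 0 ≤ max 0 (min 1 (2 - 2 * |t - q₀| / η)) ∧
        max 0 (min 1 (2 - 2 * |t - q₀| / η)) ≤ 1 := fun t =>
      ⟨le_max_left _ _, max_le zero_le_one (min_le_left _ _)⟩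
    -- A tent equal to 1 within `η / 2` of `q₀` and 0 beyond `η`. A window of radius `η / 4` around
    -- a level within `η / 4` of `q₀` stays on its plateau, so weak continuity transfers the bound
    -- to nearby laws.
    let φ : ℝ →ᵇ ℝ := BoundedContinuousFunction.ofNormedAddCommGroup
      (fun t => max 0 (min 1 (2 - 2 * |t - q₀| / η))) (by fun_prop) 1 fun t => by
        rw [Real.norm_of_nonneg (hb01 t).1]; exact (hb01 t).2
    have hφ : ∀ t, φ t = max 0 (min 1 (2 - 2 * |t - q₀| / η)) := fun _ => rfl
    have hup : ∫ d, φ d ∂(F x₀) < ε := by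
      calc ∫ d, φ d ∂(F x₀) ≤ ∫ d, (Icc (q₀ - η) (q₀ + η)).indicator (fun _ => (1 : ℝ)) d
            ∂(F x₀) := by
            refine integral_mono (φ.integrable _)
              ((integrable_const _).indicator measurableSet_Icc) fun t => ?_
            by_cases ht : t ∈ Icc (q₀ - η) (q₀ + η)
            · simp only [indicator_of_mem ht, hφ]; exact (hb01 t).2
            · simp only [indicator_of_notMem ht, hφ]
              refine max_le le_rfl ((min_le_right _ _).trans ?_)
              have : η ≤ |t - q₀| := by
                by_contra hc
                have := abs_lt.1 (not_le.1 hc)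
                exact ht ⟨by linarith, by linarith⟩
              rw [sub_nonpos, le_div_iff₀ hη]
              linarith
        _ = (F x₀).real (Icc (q₀ - η) (q₀ + η)) := by
            rw [integral_indicator measurableSet_Icc]; simp
        _ < ε := by
            rw [Measure.real]
            exact (ENNReal.lt_ofReal_iff_toReal_lt (measure_ne_top _ _)).1 hlt
    have hnear : ∀ᶠ x in 𝓝[K] x₀, ∫ d, φ d ∂(F x) < ε :=
      (hcont φ x₀ hx₀).eventually_lt_const hup
    have hnear' : ∀ᶠ q in 𝓝[Icc a b] q₀, |q - q₀| < η / 4 := by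
      have := Metric.ball_mem_nhds q₀ (by positivity : 0 < η / 4)
      filter_upwards [mem_nhdsWithin_of_mem_nhds this] with q hq
      rwa [Metric.mem_ball, Real.dist_eq] at hq
    refine ⟨_, ?_, η / 4, by positivity, fun y hy => hy⟩
    rw [nhdsWithin_prod_eq]
    filter_upwards [hnear.prod_mk hnear'] with y hy
    refine le_trans ?_ hy.1.le
    calc (F y.1).real (Icc (y.2 - η / 4) (y.2 + η / 4))
        = ∫ d, (Icc (y.2 - η / 4) (y.2 + η / 4)).indicator (fun _ => (1 : ℝ)) d ∂(F y.1) := by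
          rw [integral_indicator measurableSet_Icc]; simp
      _ ≤ ∫ d, φ d ∂(F y.1) := by
          refine integral_mono ((integrable_const _).indicator measurableSet_Icc)
            (φ.integrable _) fun t => ?_
          by_cases ht : t ∈ Icc (y.2 - η / 4) (y.2 + η / 4)
          · simp only [indicator_of_mem ht, hφ]
            refine le_max_of_le_right (le_min le_rfl ?_)
            have h1 := abs_lt.1 hy.2
            have h2 : |t - q₀| ≤ η / 2 := abs_le.2 ⟨by linarith [ht.1], by linarith [ht.2]⟩
            have h3 : 2 * |t - q₀| / η ≤ 1 := by rw [div_le_iff₀ hη]; linarith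
            linarith
          · simp only [indicator_of_notMem ht, hφ]; exact (hb01 t).1

theorem euclidean_norm_le_abs_add_abs (v : EuclideanSpace ℝ (Fin 2)) : ‖v‖ ≤ |v 0| + |v 1| := by
  rw [EuclideanSpace.norm_eq, Fin.sum_univ_two]
  refine Real.sqrt_le_iff.2 ⟨by positivity, ?_⟩
  simp only [Real.norm_eq_abs]
  nlinarith [abs_nonneg (v 0), abs_nonneg (v 1)]

/-! ### The gradient under an atomless demand law -/

section Gradient

variable {c s p q : ℝ} {G : ℝ → EuclideanSpace ℝ (Fin 2)} {P : Measure ℝ}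

/-- The choice of `e` is free only at `d = q`, a null event, so all selections have the same
expectation. -/
theorem profitSubgrad_ae_eq (hG : ∀ d, G d ∈ profitSubgrad c s p q d) (hatom : P {q} = 0) :
    G =ᵐ[P] fun d => !₂[min d q, (p - c) - (p - s) * (Iic q).indicator (fun _ => (1 : ℝ)) d] := by
  filter_upwards [measure_eq_zero_iff_ae_notMem.1 hatom] with d hd
  obtain ⟨e, ⟨he0, he1⟩, h⟩ := hG d
  rw [h]
  rcases lt_or_gt_of_ne (show d ≠ q from hd) with hlt | hlt
  · have : e = 1 := le_antisymm (by simpa [hlt.le] using he1) (by simpa [hlt] using he0)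
    simp [this, hlt.le]
  · have : e = 0 := le_antisymm (by simpa [hlt.not_ge] using he1) (by simpa [hlt.not_gt] using he0)
    simp [this, hlt.not_ge]

theorem integrable_min_const [IsFiniteMeasure P] (hq : 0 ≤ q) (hnn : ∀ᵐ d ∂P, 0 ≤ d) :
    Integrable (fun d => min d q) P := by
  refine Integrable.of_bound (by fun_prop) q (hnn.mono fun d hd => ?_)
  rw [Real.norm_of_nonneg (le_min hd hq)]
  exact min_le_right _ _

theorem integrable_profitSubgrad [IsFiniteMeasure P] (hG : ∀ d, G d ∈ profitSubgrad c s p q d)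
    (hq : 0 ≤ q) (hatom : P {q} = 0) (hnn : ∀ᵐ d ∂P, 0 ≤ d) : Integrable G P := by
  rw [integrable_congr (profitSubgrad_ae_eq hG hatom)]
  have hm : Measurable fun d : ℝ =>
      (p - c) - (p - s) * (Iic q).indicator (fun _ => (1 : ℝ)) d :=
    ((measurable_const.indicator measurableSet_Iic).const_mul _).const_sub _
  refine Integrable.of_bound (C := q + (|p - c| + |p - s|)) ?_ (hnn.mono fun d hd => ?_)
  · refine Measurable.aestronglyMeasurable ?_
    refine (WithLp.measurable_toLp 2 (Fin 2 → ℝ)).comp (measurable_pi_iff.2 fun i => ?_)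
    fin_cases i
    · exact measurable_id.min measurable_const
    · exact hm
  · refine (euclidean_norm_le_abs_add_abs _).trans (add_le_add ?_ ?_)
    · change |min d q| ≤ q
      rw [abs_of_nonneg (le_min hd hq)]
      exact min_le_right _ _
    · change |(p - c) - (p - s) * (Iic q).indicator (fun _ => (1 : ℝ)) d| ≤ _
      refine (abs_sub _ _).trans (add_le_add le_rfl ?_)
      by_cases h : d ∈ Iic q <;> simp [h]

theorem integral_profitSubgrad [IsProbabilityMeasure P]
    (hG : ∀ d, G d ∈ profitSubgrad c s p q d)
    (hq : 0 ≤ q) (hatom : P {q} = 0) (hnn : ∀ᵐ d ∂P, 0 ≤ d) :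
    (∫ d, G d ∂P) 0 = ∫ d, min d q ∂P ∧
      (∫ d, G d ∂P) 1 = (p - c) - (p - s) * P.real (Iic q) := by
  have hint := integrable_profitSubgrad hG hq hatom hnn
  have hcoord : ∀ i : Fin 2, (∫ d, G d ∂P) i = ∫ d, G d i ∂P := fun i =>
    ((EuclideanSpace.proj (𝕜 := ℝ) i).integral_comp_comm hint).symm
  have hae := profitSubgrad_ae_eq hG hatom
  constructor
  · rw [hcoord]
    exact integral_congr_ae (hae.mono fun d hd => by simp [hd])
  · rw [hcoord, integral_congr_ae (g := fun d =>
      (p - c) - (p - s) * (Iic q).indicator (fun _ => (1 : ℝ)) d)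
      (hae.mono fun d hd => by simp [hd]), integral_sub (integrable_const _)
        (((integrable_const _).indicator measurableSet_Iic).const_mul _), integral_const_mul,
      integral_indicator measurableSet_Iic]
    simp

end Gradient

/-! ### From truncations to the gradient, uniformly in the order quantity -/

/-- The weighted empirical laws of the points `d i` converge to the laws `F p`, uniformly in
`p ∈ T`, when tested against truncations at rational levels. -/
def ClampConvergence (T : Set ℝ) (F : ℝ → Measure ℝ) (w : ℕ → ℝ → ℕ → ℝ) (d : ℕ → ℝ) : Prop :=
  ∀ a b : ℚ, ∀ ε > 0, ∀ᶠ N : ℕ in atTop, ∀ p ∈ T,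
    |∑ i ∈ Finset.range N, w N p i * clampBCF a b (d i) - ∫ t, clampBCF a b t ∂(F p)| ≤ ε

section ClampConvergence

variable {T : Set ℝ} {F : ℝ → Measure ℝ} [∀ p, IsProbabilityMeasure (F p)]
  {w : ℕ → ℝ → ℕ → ℝ} {d : ℕ → ℝ}

theorem ClampConvergence.sum_weights (h : ClampConvergence T F w d) {ε : ℝ} (hε : 0 < ε) :
    ∀ᶠ N : ℕ in atTop, ∀ p ∈ T, |∑ i ∈ Finset.range N, w N p i - 1| ≤ ε := by
  -- Truncation to `[1, 1]` is the constant 1, so convergence of the total weight is a special case.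
  have h1 := h 1 1 ε hε
  have hc : ∀ t, clampBCF ((1 : ℚ) : ℝ) ((1 : ℚ) : ℝ) t = 1 := fun t => by
    rw [clampBCF_apply]; simp
  simpa only [hc, mul_one, integral_const, probReal_univ, smul_eq_mul] using h1

/-- Truncation at `q` is 1-Lipschitz in `q`, so a finite rational grid suffices; on nonnegative
demands it agrees with clamping to `[0, q]`. Rounding costs `2 · ε/4` in the sum, whose total weight
is at most 2, and `ε/4` in the integral; the grid values cost the last `ε/4`. -/
theorem ClampConvergence.min_const (h : ClampConvergence T F w d) (hw : ∀ N p i, 0 ≤ w N p i)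
    (hd : ∀ i, 0 ≤ d i) (hF : ∀ p ∈ T, ∀ᵐ t ∂(F p), 0 ≤ t) (qu : ℝ) {ε : ℝ} (hε : 0 < ε) :
    ∀ᶠ N : ℕ in atTop, ∀ p ∈ T, ∀ q ∈ Icc 0 qu,
      |∑ i ∈ Finset.range N, w N p i * min (d i) q - ∫ t, min t q ∂(F p)| ≤ ε := by
  obtain ⟨k, hk⟩ := exists_nat_one_div_lt (show 0 < ε / 4 by positivity)
  set M : ℕ := k + 1
  have hM0 : (0 : ℝ) < M := by positivity
  have hM : 1 / (M : ℝ) ≤ ε / 4 := by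
    simp only [M]; push_cast; exact hk.le
  have hgrid : ∀ᶠ N : ℕ in atTop, ∀ j ∈ Finset.range (⌊qu * M⌋₊ + 1), ∀ p ∈ T,
      |∑ i ∈ Finset.range N, w N p i * clampBCF ((0 : ℚ) : ℝ) ((j / M : ℚ) : ℝ) (d i) -
        ∫ t, clampBCF ((0 : ℚ) : ℝ) ((j / M : ℚ) : ℝ) t ∂(F p)| ≤ ε / 4 :=
    (Finset.eventually_all _).2 fun j _ => h 0 (j / M) (ε / 4) (by positivity)
  filter_upwards [hgrid, h.sum_weights one_pos] with N h1 h2 p hp q hq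
  set j := ⌊q * M⌋₊ with hj
  have hjmem : j ∈ Finset.range (⌊qu * M⌋₊ + 1) := by
    rw [Finset.mem_range, Nat.lt_succ_iff]
    exact Nat.floor_le_floor (by have := hq.2; gcongr)
  have hj1 : (j : ℝ) / M ≤ q := by
    rw [div_le_iff₀ hM0]; exact Nat.floor_le (mul_nonneg hq.1 hM0.le)
  have hj2 : q ≤ (j : ℝ) / M + 1 / M := by
    rw [← add_div, le_div_iff₀ hM0]; exact (Nat.lt_floor_add_one _).le
  have hclamp : ∀ t, 0 ≤ t → clampBCF ((0 : ℚ) : ℝ) ((j / M : ℚ) : ℝ) t = min t (j / M) := by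
    intro t ht
    rw [clampBCF_apply]
    push_cast
    exact max_eq_right (le_min ht (by positivity))
  have hdiff : ∀ t, |min t q - min t (j / M)| ≤ ε / 4 := by
    intro t
    have h3 : min t ((j : ℝ) / M) ≤ min t q := min_le_min le_rfl hj1
    have h4 : min t q ≤ min t ((j : ℝ) / M) + 1 / M := by
      have hM1 : 0 < 1 / (M : ℝ) := by positivity
      rw [← sub_le_iff_le_add]
      exact le_min (by linarith [min_le_left t q]) (by linarith [min_le_right t q])
    exact abs_le.2 ⟨by linarith, by linarith⟩
  have hsum : |∑ i ∈ Finset.range N, w N p i * min (d i) q -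
      ∑ i ∈ Finset.range N, w N p i * min (d i) (j / M)| ≤ 2 * (ε / 4) := by
    rw [← Finset.sum_sub_distrib]
    calc _ ≤ ∑ i ∈ Finset.range N, w N p i * (ε / 4) := by
          refine (Finset.abs_sum_le_sum_abs _ _).trans (Finset.sum_le_sum fun i _ => ?_)
          rw [← mul_sub, abs_mul, abs_of_nonneg (hw N p i)]
          exact mul_le_mul_of_nonneg_left (hdiff _) (hw N p i)
      _ ≤ 2 * (ε / 4) := by
          rw [← Finset.sum_mul]
          have := (abs_le.1 (h2 p hp)).2
          gcongr
          linarith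
  have hint : |∫ t, min t ((j : ℝ) / M) ∂(F p) - ∫ t, min t q ∂(F p)| ≤ ε / 4 := by
    rw [abs_sub_comm, ← integral_sub (integrable_min_const hq.1 (hF p hp))
      (integrable_min_const (by positivity) (hF p hp))]
    have := norm_integral_le_of_norm_le_const (μ := F p)
      (f := fun t => min t q - min t ((j : ℝ) / M)) (C := ε / 4)
      (Eventually.of_forall fun t => by rw [Real.norm_eq_abs]; exact hdiff t)
    simpa using this
  have h3 := h1 j hjmem p hp
  rw [integral_congr_ae ((hF p hp).mono hclamp),
    Finset.sum_congr rfl fun i _ => by rw [hclamp _ (hd i)]] at h3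
  have h4 := abs_le.1 hsum
  have h5 := abs_le.1 hint
  have h6 := abs_le.1 h3
  exact abs_le.2 ⟨by linarith, by linarith⟩

/-- The continuous function that is `1` up to `a`, `0` from `b` on, and linear in between. -/
noncomputable def downRamp (a b t : ℝ) : ℝ := (b - clampBCF a b t) / (b - a)

theorem indicator_Iic_le_downRamp {a b t : ℝ} (hab : a < b) :
    (Iic a).indicator (fun _ => (1 : ℝ)) t ≤ downRamp a b t := by
  have hba := sub_pos.2 hab
  rw [downRamp, clampBCF_apply, le_div_iff₀ hba]
  by_cases ht : t ≤ a
  · simp [ht, (min_le_left t b).trans ht]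
  · have : max a (min t b) ≤ b := max_le hab.le (min_le_right _ _)
    simp [ht, hab.le]

theorem downRamp_le_indicator_Iio {a b t : ℝ} (hab : a < b) :
    downRamp a b t ≤ (Iio b).indicator (fun _ => (1 : ℝ)) t := by
  have hba := sub_pos.2 hab
  rw [downRamp, clampBCF_apply, div_le_iff₀ hba]
  by_cases ht : t < b
  · have : a ≤ max a (min t b) := le_max_left _ _
    rw [indicator_of_mem (mem_Iio.2 ht)]
    linarith
  · simp [ht, not_lt.1 ht]

theorem ClampConvergence.sum_downRamp (h : ClampConvergence T F w d) {a b : ℚ} (hab : a < b) {ε : ℝ}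
    (hε : 0 < ε) : ∀ᶠ N : ℕ in atTop, ∀ p ∈ T,
      |∑ i ∈ Finset.range N, w N p i * downRamp a b (d i) - ∫ t, downRamp a b t ∂(F p)| ≤ ε := by
  have hba : (0 : ℝ) < b - a := sub_pos.2 (by exact_mod_cast hab)
  -- The ramp is affine in the truncation: the constant `b` costs `|b| η` through the total weight
  -- and the truncation costs `η`, all divided by `b - a`.
  set η : ℝ := ε * (b - a) / (|(b : ℝ)| + 1) with hη
  have hη0 : 0 < η := by positivity
  have hηε : |(b : ℝ)| * η + η = ε * (b - a) := by
    rw [hη]; field_simp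
  filter_upwards [h a b η hη0, h.sum_weights hη0] with N h1 h2 p hp
  have hI : ∫ t, downRamp a b t ∂(F p) =
      (b - ∫ t, clampBCF a b t ∂(F p)) / (b - a) := by
    simp only [downRamp]
    rw [integral_div, integral_sub (integrable_const _) ((clampBCF a b).integrable _)]
    simp
  have hL : ∑ i ∈ Finset.range N, w N p i * downRamp a b (d i) =
      (b * ∑ i ∈ Finset.range N, w N p i -
        ∑ i ∈ Finset.range N, w N p i * clampBCF a b (d i)) / (b - a) := by
    rw [Finset.mul_sum, ← Finset.sum_sub_distrib, Finset.sum_div]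
    refine Finset.sum_congr rfl fun i _ => ?_
    simp only [downRamp]
    ring
  rw [hI, hL, ← sub_div, abs_div, abs_of_pos hba, div_le_iff₀ hba, ← hηε]
  have h3 : (b : ℝ) * ∑ i ∈ Finset.range N, w N p i -
      ∑ i ∈ Finset.range N, w N p i * clampBCF a b (d i) - (b - ∫ t, clampBCF a b t ∂(F p)) =
      b * (∑ i ∈ Finset.range N, w N p i - 1) -
      (∑ i ∈ Finset.range N, w N p i * clampBCF a b (d i) - ∫ t, clampBCF a b t ∂(F p)) := by
    ring
  rw [h3]
  refine (abs_sub _ _).trans (add_le_add ?_ (h1 p hp))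
  rw [abs_mul]
  exact mul_le_mul_of_nonneg_left (h2 p hp) (abs_nonneg _)

theorem integrable_downRamp {P : Measure ℝ} [IsFiniteMeasure P] (a b : ℝ) :
    Integrable (downRamp a b) P :=
  ((integrable_const _).sub ((clampBCF a b).integrable _)).div_const _

/-- The jump is squeezed between ramps on a rational grid on either side of `q`, and the gap is the
mass of a short interval around `q`, uniformly small by atomlessness. Only the two bounds on `e`
enter, so all selections, even varying with `p` and `q`, are covered at once. -/
theorem ClampConvergence.indicator (h : ClampConvergence T F w d) (hw : ∀ N p i, 0 ≤ w N p i)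
    (hT : IsCompact T) (hatom : ∀ p ∈ T, ∀ t, F p {t} = 0)
    (hcont : ∀ φ : ℝ →ᵇ ℝ, ContinuousOn (fun p => ∫ t, φ t ∂(F p)) T) (qu : ℝ) {ε : ℝ}
    (hε : 0 < ε) :
    ∀ᶠ N : ℕ in atTop, ∀ p ∈ T, ∀ q ∈ Icc 0 qu, ∀ e : ℕ → ℝ,
      (∀ i, (if d i < q then (1 : ℝ) else 0) ≤ e i ∧ e i ≤ if d i ≤ q then (1 : ℝ) else 0) →
      |∑ i ∈ Finset.range N, w N p i * e i - (F p).real (Iic q)| ≤ ε := by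
  obtain ⟨η, hη, hunif⟩ := exists_forall_measureReal_Icc_le hT (a := 0) (b := qu) hatom hcont
    (show 0 < ε / 2 by positivity)
  obtain ⟨k, hk⟩ := exists_nat_one_div_lt (show 0 < η / 2 by positivity)
  set n : ℕ := k + 1
  have hn0 : (0 : ℝ) < n := by positivity
  have hn0' : (0 : ℚ) < n := by positivity
  have hn : 2 / (n : ℝ) ≤ η := by
    have : 1 / (n : ℝ) ≤ η / 2 := by simp only [n]; push_cast; exact hk.le
    calc 2 / (n : ℝ) = 2 * (1 / n) := by ring
      _ ≤ 2 * (η / 2) := by gcongr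
      _ = η := by ring
  -- With $j/n\le q<(j+1)/n$, the lower ramp falls on $[(j-1)/n,j/n]$ and the upper one on
  -- $[(j+1)/n,(j+2)/n]$. Both stay within $2/n\le\eta$ of $q$.
  have hlo : ∀ᶠ N : ℕ in atTop, ∀ j ∈ Finset.range (⌊qu * n⌋₊ + 1), ∀ p ∈ T,
      |∑ i ∈ Finset.range N, w N p i *
          downRamp ((((j : ℚ) - 1) / n : ℚ) : ℝ) (((j : ℚ) / n : ℚ) : ℝ) (d i) -
        ∫ t, downRamp ((((j : ℚ) - 1) / n : ℚ) : ℝ) (((j : ℚ) / n : ℚ) : ℝ) t ∂(F p)| ≤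
        ε / 2 :=
    (Finset.eventually_all _).2 fun j _ =>
      h.sum_downRamp (div_lt_div_of_pos_right (by linarith) hn0') (by positivity)
  have hup : ∀ᶠ N : ℕ in atTop, ∀ j ∈ Finset.range (⌊qu * n⌋₊ + 1), ∀ p ∈ T,
      |∑ i ∈ Finset.range N, w N p i *
          downRamp ((((j : ℚ) + 1) / n : ℚ) : ℝ) ((((j : ℚ) + 2) / n : ℚ) : ℝ) (d i) -
        ∫ t, downRamp ((((j : ℚ) + 1) / n : ℚ) : ℝ) ((((j : ℚ) + 2) / n : ℚ) : ℝ) t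
          ∂(F p)| ≤ ε / 2 :=
    (Finset.eventually_all _).2 fun j _ =>
      h.sum_downRamp (div_lt_div_of_pos_right (by linarith) hn0') (by positivity)
  filter_upwards [hlo, hup] with N hlo hup p hp q hq e he
  set j := ⌊q * n⌋₊ with hj
  have hjmem : j ∈ Finset.range (⌊qu * n⌋₊ + 1) := by
    rw [Finset.mem_range, Nat.lt_succ_iff]
    exact Nat.floor_le_floor (by have := hq.2; gcongr)
  have hj1 : (j : ℝ) / n ≤ q := by
    rw [div_le_iff₀ hn0]; exact Nat.floor_le (mul_nonneg hq.1 hn0.le)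
  have hj2 : q < ((j : ℝ) + 1) / n := by
    rw [lt_div_iff₀ hn0]; exact Nat.lt_floor_add_one _
  have hlo := (abs_le.1 (hlo j hjmem p hp)).1
  have hup := (abs_le.1 (hup j hjmem p hp)).2
  push_cast at hlo hup
  have hlt : ((j : ℝ) - 1) / n < (j : ℝ) / n := div_lt_div_of_pos_right (by linarith) hn0
  have hlt' : ((j : ℝ) + 1) / n < ((j : ℝ) + 2) / n := div_lt_div_of_pos_right (by linarith) hn0
  have hS1 : ∑ i ∈ Finset.range N, w N p i *
      downRamp (((j : ℝ) - 1) / n) ((j : ℝ) / n) (d i) ≤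
      ∑ i ∈ Finset.range N, w N p i * e i := by
    refine Finset.sum_le_sum fun i _ => mul_le_mul_of_nonneg_left
      ((downRamp_le_indicator_Iio hlt).trans (le_trans ?_ (he i).1)) (hw N p i)
    by_cases hi : d i < j / n
    · simp [hi, hi.trans_le hj1]
    · rw [indicator_of_notMem (by simpa using hi)]
      split_ifs <;> norm_num
  have hS2 : ∑ i ∈ Finset.range N, w N p i * e i ≤ ∑ i ∈ Finset.range N, w N p i *
      downRamp (((j : ℝ) + 1) / n) (((j : ℝ) + 2) / n) (d i) := by
    refine Finset.sum_le_sum fun i _ => mul_le_mul_of_nonneg_left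
      ((he i).2.trans (le_trans ?_ (indicator_Iic_le_downRamp hlt'))) (hw N p i)
    by_cases hi : d i ≤ q
    · simp [hi, hi.trans hj2.le]
    · rw [if_neg hi]
      exact indicator_nonneg (fun _ _ => zero_le_one) _
  have hI1 : (F p).real (Iic (((j : ℝ) - 1) / n)) ≤
      ∫ t, downRamp (((j : ℝ) - 1) / n) ((j : ℝ) / n) t ∂(F p) := by
    have := integral_mono (μ := F p) ((integrable_const (1 : ℝ)).indicator measurableSet_Iic)
      (integrable_downRamp (((j : ℝ) - 1) / n) ((j : ℝ) / n))
      fun t => indicator_Iic_le_downRamp hlt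
    rw [integral_indicator measurableSet_Iic] at this
    simpa using this
  have hI2 : ∫ t, downRamp (((j : ℝ) + 1) / n) (((j : ℝ) + 2) / n) t ∂(F p) ≤
      (F p).real (Iio (((j : ℝ) + 2) / n)) := by
    have := integral_mono (μ := F p) (integrable_downRamp (((j : ℝ) + 1) / n) (((j : ℝ) + 2) / n))
      ((integrable_const (1 : ℝ)).indicator measurableSet_Iio)
      fun t => downRamp_le_indicator_Iio hlt'
    rw [integral_indicator measurableSet_Iio] at this
    simpa using this
  have hu := hunif p hp q hq
  have hj2' : q < (j : ℝ) / n + 1 / n := by rw [← add_div]; exact hj2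
  have h2n : 2 / (n : ℝ) = 1 / n + 1 / n := by ring
  have hF1 : (F p).real (Iic q) ≤ (F p).real (Iic (((j : ℝ) - 1) / n)) + ε / 2 := by
    refine (measureReal_mono (s₂ := Iic (((j : ℝ) - 1) / n) ∪ Icc (q - η) (q + η))
      fun t ht => ?_).trans ((measureReal_union_le _ _).trans (by gcongr))
    by_cases h' : t ≤ ((j : ℝ) - 1) / n
    · exact Or.inl h'
    · rw [sub_div] at h'
      exact Or.inr ⟨by linarith [not_le.1 h'], by linarith [mem_Iic.1 ht]⟩
  have hF2 : (F p).real (Iio (((j : ℝ) + 2) / n)) ≤ (F p).real (Iic q) + ε / 2 := by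
    refine (measureReal_mono (s₂ := Iic q ∪ Icc (q - η) (q + η))
      fun t ht => ?_).trans ((measureReal_union_le _ _).trans (by gcongr))
    by_cases h' : t ≤ q
    · exact Or.inl h'
    · have ht := mem_Iio.1 ht
      rw [add_div] at ht
      exact Or.inr ⟨by linarith [not_le.1 h'], by linarith⟩
  exact abs_le.2 ⟨by linarith, by linarith⟩

end ClampConvergence

theorem tendsto_gradError {m : ℕ} {fD : Kernel (ℝ × EuclideanSpace ℝ (Fin m)) ℝ}
    [IsMarkovKernel fD] {c s pl pu ql qu : ℝ} (hsc : s < c) (hcp : c ≤ pl) (hql : 0 ≤ ql)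
    {g : ℝ → ℝ → ℝ → EuclideanSpace ℝ (Fin 2)} (hg : ∀ p q d, g p q d ∈ profitSubgrad c s p q d)
    {z : EuclideanSpace ℝ (Fin m)} (hatom : ∀ p ∈ Icc pl pu, ∀ d, fD (p, z) {d} = 0)
    (hnn : ∀ p ∈ Icc pl pu, ∀ᵐ t ∂(fD (p, z)), 0 ≤ t)
    (hcont : ∀ φ : ℝ →ᵇ ℝ, ContinuousOn (fun p => ∫ t, φ t ∂(fD (p, z))) (Icc pl pu))
    {W : ℕ → ℕ → EuclideanSpace ℝ (Fin (m + 1)) → ℝ} (hW : ∀ N i y, 0 ≤ W N i y)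
    {d : ℕ → ℝ} (hd : ∀ i, 0 ≤ d i)
    (hconv : ClampConvergence (Icc pl pu) (fun p => fD (p, z))
      (fun N p i => W N i (covariate p z)) d) :
    Tendsto (fun N => gradError fD g pl pu ql qu N (W N) d z) atTop (𝓝 0) := by
  rw [ENNReal.tendsto_nhds_zero]
  intro r hr
  obtain ⟨ε, hε0, hεr⟩ := ENNReal.lt_iff_exists_nnreal_btwn.1 hr
  have hε : (0 : ℝ) < ε := by exact_mod_cast hε0
  -- One unit for the first component; the second has the coefficients `p - c` on the total weight
  -- and `p - s` on the jump, both in `[0, pu - s]`.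
  set B : ℝ := 1 + 2 * |pu - s| with hB
  have hB0 : 0 < B := by positivity
  have hη : 0 < (ε : ℝ) / B := by positivity
  filter_upwards [hconv.sum_weights hη, hconv.min_const (fun N p i => hW N i _) hd hnn qu hη,
    hconv.indicator (fun N p i => hW N i _) isCompact_Icc hatom hcont qu hη] with N h1 h2 h3
  refine le_trans (iSup₂_le fun p hp => iSup₂_le fun q hq => ?_) hεr.le
  have hq0 : q ∈ Icc 0 qu := ⟨hql.trans hq.1, hq.2⟩
  have h1 := h1 p hp
  have h2 := h2 p hp q hq0
  choose e he hge using fun t => hg p q t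
  have h3 := h3 p hp q hq0 (fun i => e (d i)) fun i => he (d i)
  obtain ⟨hE0, hE1⟩ := integral_profitSubgrad (hg p q) hq0.1 (hatom p hp q) (hnn p hp)
  set w : ℕ → ℝ := fun i => W N i (covariate p z) with hw
  change |∑ i ∈ Finset.range N, w i - 1| ≤ ε / B at h1
  change |∑ i ∈ Finset.range N, w i * min (d i) q - _| ≤ ε / B at h2
  change |∑ i ∈ Finset.range N, w i * e (d i) - _| ≤ ε / B at h3
  have hA0 : approxGrad g N (W N) d p q z 0 = ∑ i ∈ Finset.range N, w i * min (d i) q := by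
    simp [approxGrad, hge, hw]
  have hA1 : approxGrad g N (W N) d p q z 1 =
      (p - c) * ∑ i ∈ Finset.range N, w i - (p - s) * ∑ i ∈ Finset.range N, w i * e (d i) := by
    rw [Finset.mul_sum, Finset.mul_sum, ← Finset.sum_sub_distrib]
    simp only [approxGrad, hge]
    simp only [WithLp.ofLp_sum, WithLp.ofLp_smul, Finset.sum_apply, Pi.smul_apply, smul_eq_mul,
      Matrix.cons_val_one, Matrix.cons_val_fin_one]
    exact Finset.sum_congr rfl fun i _ => by simp only [hw]; ring
  have hnorm : ‖approxGrad g N (W N) d p q z - expectedGrad fD g p q z‖ ≤ ε := by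
    refine (euclidean_norm_le_abs_add_abs _).trans ?_
    rw [PiLp.sub_apply, PiLp.sub_apply, hA0, hA1, expectedGrad, hE0, hE1]
    have hpc : 0 ≤ p - c := by linarith [hp.1]
    have hps : 0 ≤ p - s := by linarith [hp.1]
    have hpu : pu - s ≤ |pu - s| := le_abs_self _
    have h4 : |(p - c) * ∑ i ∈ Finset.range N, w i -
        (p - s) * ∑ i ∈ Finset.range N, w i * e (d i) -
        ((p - c) - (p - s) * (fD (p, z)).real (Iic q))| ≤ |pu - s| * (ε / B) +
          |pu - s| * (ε / B) := by
      have h5 : (p - c) * ∑ i ∈ Finset.range N, w i -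
          (p - s) * ∑ i ∈ Finset.range N, w i * e (d i) -
          ((p - c) - (p - s) * (fD (p, z)).real (Iic q)) =
          (p - c) * (∑ i ∈ Finset.range N, w i - 1) -
          (p - s) * (∑ i ∈ Finset.range N, w i * e (d i) - (fD (p, z)).real (Iic q)) := by ring
      rw [h5]
      refine (abs_sub _ _).trans (add_le_add ?_ ?_)
      · rw [abs_mul, abs_of_nonneg hpc]
        exact mul_le_mul (by linarith [hp.2]) h1 (abs_nonneg _) (abs_nonneg _)
      · rw [abs_mul, abs_of_nonneg hps]
        exact mul_le_mul (by linarith [hp.2]) h3 (abs_nonneg _) (abs_nonneg _)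
    have h6 : (ε : ℝ) / B * B = ε := by field_simp
    have h7 : (ε : ℝ) / B + (|pu - s| * (ε / B) + |pu - s| * (ε / B)) = ε / B * B := by
      rw [hB]; ring
    linarith
  rw [← ofReal_norm, ← ENNReal.ofReal_coe_nnreal]
  exact ENNReal.ofReal_le_ofReal hnorm

/-! ### Covariates and the bias along the query segment -/

theorem dist_covariate_sq {m : ℕ} (p p' : ℝ) (z z' : EuclideanSpace ℝ (Fin m)) :
    dist (covariate p z) (covariate p' z') ^ 2 = (p - p') ^ 2 + ‖z - z'‖ ^ 2 := by
  rw [EuclideanSpace.dist_eq, Real.sq_sqrt (Finset.sum_nonneg fun _ _ => sq_nonneg _),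
    Fin.sum_univ_succ, EuclideanSpace.norm_eq, Real.sq_sqrt (Finset.sum_nonneg fun _ _ => sq_nonneg _)]
  simp [covariate, Real.dist_eq, sq_abs]

theorem dist_covariate_le_iff {m : ℕ} (p : ℝ) (z : EuclideanSpace ℝ (Fin m))
    (x y : ℝ × EuclideanSpace ℝ (Fin m)) :
    dist (covariate x.1 x.2) (covariate p z) ≤ dist (covariate y.1 y.2) (covariate p z) ↔
      (x.1 - p) ^ 2 + ‖x.2 - z‖ ^ 2 ≤ (y.1 - p) ^ 2 + ‖y.2 - z‖ ^ 2 := by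
  rw [← dist_covariate_sq, ← dist_covariate_sq, pow_le_pow_iff_left₀ dist_nonneg dist_nonneg
    two_ne_zero]

theorem dist_covariate_left {m : ℕ} (p p' : ℝ) (z : EuclideanSpace ℝ (Fin m)) :
    dist (covariate p z) (covariate p' z) = |p - p'| := by
  have h := dist_covariate_sq p p' z z
  rw [sub_self, norm_zero, zero_pow two_ne_zero, add_zero, ← sq_abs (p - p')] at h
  exact (pow_left_inj₀ dist_nonneg (abs_nonneg _) two_ne_zero).1 h

theorem dist_le_dist_covariate {m : ℕ} (x y : ℝ × EuclideanSpace ℝ (Fin m)) :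
    dist x y ≤ dist (covariate x.1 x.2) (covariate y.1 y.2) := by
  have h := dist_covariate_sq x.1 y.1 x.2 y.2
  rw [Prod.dist_eq]
  refine max_le ?_ ?_ <;> refine (pow_le_pow_iff_left₀ dist_nonneg dist_nonneg two_ne_zero).1 ?_
  · rw [h, Real.dist_eq, sq_abs]
    linarith [sq_nonneg ‖x.2 - y.2‖]
  · rw [h, dist_eq_norm]
    linarith [sq_nonneg (x.1 - y.1)]

theorem measurable_covariate {m : ℕ} :
    Measurable fun x : ℝ × EuclideanSpace ℝ (Fin m) => covariate x.1 x.2 := by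
  refine (WithLp.measurable_toLp 2 (Fin (m + 1) → ℝ)).comp (measurable_pi_iff.2 fun i => ?_)
  refine Fin.cases ?_ (fun j => ?_) i
  · simpa using measurable_fst
  · simp only [Fin.cons_succ]
    fun_prop

/-- Uniform closeness of the means of `φ` at query points and at nearby points of the support. -/
theorem exists_forall_abs_integral_sub_le {m : ℕ}
    {fD : Kernel (ℝ × EuclideanSpace ℝ (Fin m)) ℝ} {SX : Set (ℝ × EuclideanSpace ℝ (Fin m))}
    {φ : ℝ →ᵇ ℝ} (hcont : ContinuousOn (fun x => ∫ d, φ d ∂(fD x)) SX) {pl pu : ℝ}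
    {z : EuclideanSpace ℝ (Fin m)} (hz : ∀ p ∈ Icc pl pu, (p, z) ∈ SX) {ε : ℝ} (hε : 0 < ε) :
    ∃ δ > 0, ∀ p ∈ Icc pl pu, ∀ x ∈ SX, dist (covariate x.1 x.2) (covariate p z) ≤ δ →
      |∫ d, φ d ∂(fD x) - ∫ d, φ d ∂(fD (p, z))| ≤ ε := by
  let ι : Icc pl pu → SX := fun p => ⟨(p, z), hz p p.2⟩
  have hι : Continuous ι := by fun_prop
  have hK : IsCompact (range ι) := isCompact_range hι
  have hf : Continuous (SX.domRestrict fun x => ∫ d, φ d ∂(fD x)) :=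
    continuousOn_iff_continuous_domRestrict.1 hcont
  -- The support need not be compact: continuity at each point of the compact segment yields one `δ`
  -- valid against all points of the support.
  have hu := hK.uniformContinuousAt_of_continuousAt _ (fun x _ => hf.continuousAt)
    (Metric.dist_mem_uniformity hε)
  obtain ⟨δ, hδ, hu⟩ := Metric.mem_uniformity_dist.1 hu
  refine ⟨δ / 2, by positivity, fun p hp x hx hxp => ?_⟩
  have h1 : dist (ι ⟨p, hp⟩) (⟨x, hx⟩ : SX) < δ := by
    rw [Subtype.dist_eq, dist_comm]
    exact ((dist_le_dist_covariate x (p, z)).trans hxp).trans_lt (by linarith)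
  have h2 : dist (∫ d, φ d ∂(fD (p, z))) (∫ d, φ d ∂(fD x)) < ε := hu h1 (mem_range_self _)
  rw [dist_comm, Real.dist_eq] at h2
  exact h2.le

theorem tendsto_gradError_of_consistentWeights {m : ℕ}
    {fD : Kernel (ℝ × EuclideanSpace ℝ (Fin m)) ℝ} [IsMarkovKernel fD]
    {SX : Set (ℝ × EuclideanSpace ℝ (Fin m))}
    (hnn : ∀ x ∈ SX, fD x (Iio 0) = 0) (hatom : ∀ x ∈ SX, ∀ d : ℝ, fD x {d} = 0)
    (hcont : ∀ φ : ℝ →ᵇ ℝ, ContinuousOn (fun x => ∫ d, φ d ∂(fD x)) SX)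
    {c s pl pu ql qu : ℝ} (hsc : s < c) (hcp : c ≤ pl) (hql : 0 ≤ ql)
    {g : ℝ → ℝ → ℝ → EuclideanSpace ℝ (Fin 2)} (hg : ∀ p q d, g p q d ∈ profitSubgrad c s p q d)
    {z : EuclideanSpace ℝ (Fin m)} (hz : ∀ p ∈ Icc pl pu, (p, z) ∈ SX)
    {X : ℕ → ℝ × EuclideanSpace ℝ (Fin m)} {D : ℕ → ℝ} (hX : ∀ i, X i ∈ SX) (hD : ∀ i, 0 ≤ D i)
    {W : ℕ → ℕ → EuclideanSpace ℝ (Fin (m + 1)) → ℝ}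
    (hW : ∀ a b : ℚ, ConsistentWeights (fun i => covariate (X i).1 (X i).2)
      (fun p => covariate p z) (Icc pl pu) (condResidual fD (clampBCF a b) X D) W) :
    Tendsto (fun N => gradError fD g pl pu ql qu N (W N) D z) atTop (𝓝 0) := by
  refine tendsto_gradError hsc hcp hql hg (fun p hp => hatom _ (hz p hp)) (fun p hp => ?_)
    (fun φ => ?_) (hW 0 0).nonneg hD fun a b => ?_
  · filter_upwards [measure_eq_zero_iff_ae_notMem.1 (hnn _ (hz p hp))] with t ht
    exact not_lt.1 ht
  · exact (hcont φ).comp (by fun_prop) hz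
  · have hbound : ∀ x, |∫ t, clampBCF a b t ∂(fD x)| ≤ ‖clampBCF a b‖ := fun x => by
      have := norm_integral_le_of_norm_le_const (μ := fD x) (f := clampBCF a b)
        (C := ‖clampBCF a b‖) (Eventually.of_forall (clampBCF a b).norm_coe_le_norm)
      simpa using this
    refine (hW a b).eventually_abs_sub_le (a := fun i => clampBCF a b (D i))
      (b := fun i => ∫ t, clampBCF a b t ∂(fD (X i)))
      (ψ := fun p => ∫ t, clampBCF a b t ∂(fD (p, z))) (fun i => hbound _) (fun p => hbound _)
      fun ε hε => ?_
    obtain ⟨δ, hδ, h⟩ := exists_forall_abs_integral_sub_le (hcont (clampBCF a b)) hz hε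
    exact ⟨δ, hδ, fun p hp i hi => h p hp (X i) (hX i) hi⟩

/-! ### The kernels -/

theorem exists_radial_profile_uniform (d : ℕ) :
    ∃ k : ℝ → ℝ, (∀ u, uniformKernel d u = k ‖u‖) ∧ AntitoneOn k (Ici 0) ∧ (∀ r, 0 ≤ k r) ∧
      (∀ r, k r ≤ 1) ∧ 0 < k (1 / 2) ∧ ∀ n : ℕ, Tendsto (fun r => r ^ n * k r) atTop (𝓝 0) := by
  classical
  refine ⟨fun r => if r ≤ 1 then 1 else 0, fun u => ?_, fun a _ b _ hab => ?_, fun r => ?_,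
    fun r => ?_, by norm_num, fun n => ?_⟩
  · unfold uniformKernel
    congr
  · by_cases hb : b ≤ 1
    · simp [hb, hab.trans hb]
    · simp only [hb, if_false]; split_ifs <;> norm_num
  · dsimp only; split_ifs <;> norm_num
  · dsimp only; split_ifs <;> norm_num
  · refine tendsto_const_nhds.congr' ?_
    filter_upwards [eventually_gt_atTop 1] with r hr
    simp [hr.not_ge]

theorem exists_radial_profile_triangular (d : ℕ) :
    ∃ k : ℝ → ℝ, (∀ u, triangularKernel d u = k ‖u‖) ∧ AntitoneOn k (Ici 0) ∧ (∀ r, 0 ≤ k r) ∧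
      (∀ r, k r ≤ 1) ∧ 0 < k (1 / 2) ∧ ∀ n : ℕ, Tendsto (fun r => r ^ n * k r) atTop (𝓝 0) := by
  refine ⟨fun r => max (1 - |r|) 0, fun u => by simp [triangularKernel], fun a ha b hb hab => ?_,
    fun r => le_max_right _ _, fun r => max_le (by linarith [abs_nonneg r]) zero_le_one,
    by norm_num, fun n => ?_⟩
  · simp only [abs_of_nonneg (mem_Ici.1 ha), abs_of_nonneg (mem_Ici.1 hb)]
    exact max_le_max (by linarith) le_rfl
  · refine tendsto_const_nhds.congr' ?_
    filter_upwards [eventually_gt_atTop 1] with r hr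
    have : 1 - |r| ≤ 0 := by linarith [le_abs_self r]
    simp [max_eq_right this]

theorem exists_radial_profile_gaussian (d : ℕ) :
    ∃ k : ℝ → ℝ, (∀ u, gaussianKernel d u = k ‖u‖) ∧ AntitoneOn k (Ici 0) ∧ (∀ r, 0 ≤ k r) ∧
      (∀ r, k r ≤ 1) ∧ 0 < k (1 / 2) ∧ ∀ n : ℕ, Tendsto (fun r => r ^ n * k r) atTop (𝓝 0) := by
  have hpi : 0 < Real.sqrt (2 * Real.pi) := Real.sqrt_pos.2 (by positivity)
  have hC : 1 / Real.sqrt (2 * Real.pi) ≤ 1 := by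
    rw [div_le_one hpi]
    exact Real.one_le_sqrt.2 (by linarith [Real.two_le_pi])
  refine ⟨fun r => 1 / Real.sqrt (2 * Real.pi) * Real.exp (-r ^ 2 / 2), fun u => rfl,
    fun a ha b hb hab => ?_, fun r => by positivity, fun r => ?_, by positivity, fun n => ?_⟩
  · have := pow_le_pow_left₀ (mem_Ici.1 ha) hab 2
    dsimp only
    gcongr
  · refine mul_le_one₀ hC (Real.exp_pos _).le (Real.exp_le_one_iff.2 ?_)
    linarith [sq_nonneg r]
  · have h1 := (Real.tendsto_pow_mul_exp_neg_atTop_nhds_zero n).const_mul (Real.exp (1 / 2))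
    rw [mul_zero] at h1
    refine squeeze_zero' ?_ ?_ h1
    · filter_upwards [eventually_ge_atTop 0] with r hr
      positivity
    · filter_upwards [eventually_ge_atTop 0] with r hr
      -- This is $(r-1)^2\ge0$ in the exponent.
      have h2 : Real.exp (-r ^ 2 / 2) ≤ Real.exp (1 / 2) * Real.exp (-r) := by
        rw [← Real.exp_add]
        exact Real.exp_le_exp.2 (by nlinarith [sq_nonneg (r - 1)])
      calc r ^ n * (1 / Real.sqrt (2 * Real.pi) * Real.exp (-r ^ 2 / 2))
          ≤ r ^ n * (1 * (Real.exp (1 / 2) * Real.exp (-r))) := by gcongr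
        _ = _ := by ring

theorem exists_radial_profile {d : ℕ} {K : EuclideanSpace ℝ (Fin d) → ℝ}
    (hK : K ∈ ({uniformKernel d, triangularKernel d, gaussianKernel d} :
      Set (EuclideanSpace ℝ (Fin d) → ℝ))) :
    ∃ k : ℝ → ℝ, (∀ u, K u = k ‖u‖) ∧ AntitoneOn k (Ici 0) ∧ (∀ r, 0 ≤ k r) ∧
      (∀ r, k r ≤ 1) ∧ 0 < k (1 / 2) ∧ ∀ n : ℕ, Tendsto (fun r => r ^ n * k r) atTop (𝓝 0) := by
  rcases hK with rfl | rfl | rfl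
  · exact exists_radial_profile_uniform d
  · exact exists_radial_profile_triangular d
  · exact exists_radial_profile_gaussian d

/-! ### The law of the covariates -/

section Law

variable {Ω : Type*} [MeasurableSpace Ω] {μ : Measure Ω} {m : ℕ}
  {Z : Ω → EuclideanSpace ℝ (Fin m)} {P Q : Ω → ℝ} {z : EuclideanSpace ℝ (Fin m)}

/-- Fubini: the fibres in the price direction are finite, hence null, so the set lifted to the joint
space is Lebesgue null. -/
theorem map_covariates_null_of_finite (hZ : Measurable Z) (hP : Measurable P) (hQ : Measurable Q)
    (hac : μ.map (fun ω => (Z ω, P ω, Q ω)) ≪ volume)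
    {A : Set (ℝ × EuclideanSpace ℝ (Fin m))} (hA : MeasurableSet A)
    (hfin : ∀ z', {t | (t, z') ∈ A}.Finite) : μ.map (fun ω => (P ω, Z ω)) A = 0 := by
  have hm : Measurable fun y : EuclideanSpace ℝ (Fin m) × ℝ × ℝ => (y.2.1, y.1) := by fun_prop
  have h0 : (volume : Measure (EuclideanSpace ℝ (Fin m) × ℝ × ℝ))
      ((fun y => (y.2.1, y.1)) ⁻¹' A) = 0 := by
    rw [Measure.volume_eq_prod, Measure.measure_prod_null (hm hA)]
    refine Eventually.of_forall fun z' => ?_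
    have : Prod.mk z' ⁻¹' ((fun y : EuclideanSpace ℝ (Fin m) × ℝ × ℝ => (y.2.1, y.1)) ⁻¹' A) =
        {t | (t, z') ∈ A} ×ˢ univ := by
      ext y; simp
    refine (congrArg volume this).trans ?_
    rw [Measure.volume_eq_prod, Measure.prod_prod, (hfin z').measure_zero, zero_mul]
    rfl
  have h1 := hac h0
  rw [Measure.map_apply (by fun_prop) (hm hA)] at h1
  rw [Measure.map_apply (by fun_prop) hA]
  exact h1

theorem mem_support_map_covariates (hZ : Measurable Z) (hP : Measurable P) (hQ : Measurable Q)
    {p q : ℝ} (h : (z, p, q) ∈ (μ.map (fun ω => (Z ω, P ω, Q ω))).support) :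
    (p, z) ∈ (μ.map (fun ω => (P ω, Z ω))).support := by
  rw [Measure.mem_support_iff_forall] at h ⊢
  intro U hU
  obtain ⟨V, hVU, hVo, hV⟩ := mem_nhds_iff.1 hU
  refine lt_of_lt_of_le ?_ (measure_mono hVU)
  have hc : Continuous fun y : EuclideanSpace ℝ (Fin m) × ℝ × ℝ => (y.2.1, y.1) := by fun_prop
  have h1 := h ((fun y => (y.2.1, y.1)) ⁻¹' V) ((hVo.preimage hc).mem_nhds hV)
  rw [Measure.map_apply (by fun_prop) (hVo.preimage hc).measurableSet] at h1
  rw [Measure.map_apply (by fun_prop) hVo.measurableSet]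
  exact h1

theorem measurableSet_covariate_ball (p r : ℝ) :
    MeasurableSet {x : ℝ × EuclideanSpace ℝ (Fin m) |
      dist (covariate x.1 x.2) (covariate p z) ≤ r} :=
  measurableSet_le (measurable_covariate.dist measurable_const) measurable_const

theorem measureReal_covariate_ball_pos
    {ν : Measure (ℝ × EuclideanSpace ℝ (Fin m))} [IsFiniteMeasure ν] {p r : ℝ}
    (h : (p, z) ∈ ν.support) (hr : 0 < r) :
    0 < ν.real {x | dist (covariate x.1 x.2) (covariate p z) ≤ r} := by
  rw [measureReal_def, ENNReal.toReal_pos_iff]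
  refine ⟨Measure.mem_support_iff_forall _ |>.1 h _ ?_, measure_lt_top _ _⟩
  refine mem_of_superset (Metric.ball_mem_nhds _ (half_pos hr)) fun x hx => ?_
  rw [Metric.mem_ball, Prod.dist_eq, max_lt_iff, Real.dist_eq, dist_eq_norm] at hx
  have h1 := dist_covariate_sq x.1 p x.2 z
  refine (pow_le_pow_iff_left₀ dist_nonneg hr.le two_ne_zero).1 ?_
  rw [h1, ← sq_abs]
  have h2 := pow_le_pow_left₀ (abs_nonneg _) hx.1.le 2
  have h3 := pow_le_pow_left₀ (norm_nonneg _) hx.2.le 2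
  nlinarith

/-- The assumption bounds the mass of balls in the joint space by order $r^{m+2}$. A ball in `(p,
z)` of radius `r` is the shadow of a tube along the order-quantity axis that contains about $1/r$
disjoint joint balls, which gains one power of `r`. -/
theorem exists_covariate_ball_mass [IsProbabilityMeasure μ] (hZ : Measurable Z) (hP : Measurable P) (hQ : Measurable Q)
    {S : Set (EuclideanSpace ℝ (Fin m) × ℝ × ℝ)} (hS : MeasurableSet S)
    {f : EuclideanSpace ℝ (Fin m) × ℝ × ℝ → ℝ}
    (hlaw : μ.map (fun ω => (Z ω, P ω, Q ω)) =
      (volume.restrict S).withDensity (fun y => ENNReal.ofReal (f y)))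
    {a₀ : ℝ} (ha₀ : 0 < a₀) (hf : ∀ y ∈ S, a₀ ≤ f y) {pl pu ql qu : ℝ} (hq : ql < qu)
    {a : ℝ} (ha : 0 < a)
    (hvol : ∀ p ∈ Icc pl pu, ∀ q ∈ Icc ql qu, ∀ r ∈ Ioc (0 : ℝ) 1,
      ENNReal.ofReal (a * r ^ (m + 2)) ≤ volume (S ∩ Metric.closedBall (z, p, q) r)) :
    ∃ c > 0, ∀ p ∈ Icc pl pu, ∀ r ∈ Ioc (0 : ℝ) 1, c * r ^ (m + 1) ≤
      (μ.map (fun ω => (P ω, Z ω))).real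
        {x | dist (covariate x.1 x.2) (covariate p z) ≤ r} := by
  have hm : Measurable fun ω => (Z ω, P ω, Q ω) := by fun_prop
  set ρ := μ.map (fun ω => (Z ω, P ω, Q ω)) with hρ
  have : IsProbabilityMeasure ρ := Measure.isProbabilityMeasure_map hm.aemeasurable
  have hball : ∀ p ∈ Icc pl pu, ∀ q ∈ Icc ql qu, ∀ r ∈ Ioc (0 : ℝ) 1,
      a₀ * (a * r ^ (m + 2)) ≤ ρ.real (Metric.closedBall (z, p, q) r) := by
    intro p hp q hq r hr
    have hB : MeasurableSet (Metric.closedBall (z, p, q) r) := measurableSet_closedBall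
    have h1 : ENNReal.ofReal (a₀ * (a * r ^ (m + 2))) ≤ ρ (Metric.closedBall (z, p, q) r) := by
      rw [hlaw, withDensity_apply _ hB, Measure.restrict_restrict hB, inter_comm]
      calc ENNReal.ofReal (a₀ * (a * r ^ (m + 2)))
          = ENNReal.ofReal a₀ * ENNReal.ofReal (a * r ^ (m + 2)) := ENNReal.ofReal_mul ha₀.le
        _ ≤ ENNReal.ofReal a₀ * volume (S ∩ Metric.closedBall (z, p, q) r) := by
            gcongr; exact hvol p hp q hq r hr
        _ = ∫⁻ y in S ∩ Metric.closedBall (z, p, q) r, ENNReal.ofReal a₀ := by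
            rw [setLIntegral_const]
        _ ≤ _ := setLIntegral_mono' (hS.inter hB) fun y hy =>
            ENNReal.ofReal_le_ofReal (hf y hy.1)
    rw [measureReal_def]
    exact (ENNReal.ofReal_le_iff_le_toReal (measure_ne_top _ _)).1 h1
  refine ⟨(qu - ql) / 3 * (a₀ * a) / 2 ^ (m + 1), by have := sub_pos.2 hq; positivity,
    fun p hp r hr => ?_⟩
  have hr' : 0 < r / 2 := half_pos hr.1
  -- A joint ball of sup-norm radius `r / 2` projects into the Euclidean ball of radius `r`, as
  -- $\sqrt2/2\le1$. Centres spaced `3 * t` apart keep the balls disjoint.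
  set t := r / 2 with ht
  set M : ℕ := ⌊(qu - ql) / (3 * t)⌋₊ + 1 with hM
  have hMge : (qu - ql) / (3 * t) ≤ M := by
    rw [hM]; push_cast; exact (Nat.lt_floor_add_one _).le
  let U : ℕ → Set (EuclideanSpace ℝ (Fin m) × ℝ × ℝ) := fun j =>
    Metric.closedBall (z, p, ql + 3 * t * j) t
  have hmem : ∀ j ∈ Finset.range M, ql + 3 * t * j ∈ Icc ql qu := by
    intro j hj
    have hj' : j ≤ ⌊(qu - ql) / (3 * t)⌋₊ := Nat.lt_succ_iff.1 (Finset.mem_range.1 hj)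
    have h1 : (j : ℝ) ≤ (qu - ql) / (3 * t) :=
      (Nat.le_floor_iff (div_nonneg (sub_nonneg.2 hq.le) (by positivity))).1 hj'
    rw [le_div_iff₀ (by positivity)] at h1
    have : 0 ≤ 3 * t * j := by positivity
    exact ⟨by linarith, by linarith⟩
  have hdisj : Pairwise fun i j => Disjoint (U i) (U j) := by
    have hlt : ∀ i j : ℕ, i < j → Disjoint (U i) (U j) := by
      intro i j hij
      refine Metric.closedBall_disjoint_closedBall ?_
      refine lt_of_lt_of_le ?_ ((le_max_right _ _).trans (le_max_right _ _))
      have h1 : (i : ℝ) + 1 ≤ j := by exact_mod_cast hij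
      change t + t < dist (ql + 3 * t * i) (ql + 3 * t * j)
      rw [Real.dist_eq, abs_sub_comm]
      refine lt_of_lt_of_le ?_ (le_abs_self _)
      nlinarith
    intro i j hij
    rcases lt_or_gt_of_ne hij with h | h
    · exact hlt i j h
    · exact (hlt j i h).symm
  have hsum : ∑ j ∈ Finset.range M, ρ.real (U j) = ρ.real (⋃ j ∈ Finset.range M, U j) :=
    (measureReal_biUnion_finset (fun i _ j _ hij => hdisj hij)
      fun j _ => measurableSet_closedBall).symm
  have hsub : ρ.real (⋃ j ∈ Finset.range M, U j) ≤ (μ.map (fun ω => (P ω, Z ω))).real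
      {x | dist (covariate x.1 x.2) (covariate p z) ≤ r} := by
    rw [map_measureReal_apply (by fun_prop) (measurableSet_covariate_ball p r), hρ,
      map_measureReal_apply hm (Finset.measurableSet_biUnion _ fun j _ =>
        measurableSet_closedBall)]
    refine measureReal_mono fun ω hω => ?_
    simp only [mem_preimage, mem_iUnion] at hω
    obtain ⟨j, _, hω⟩ := hω
    simp only [Metric.mem_closedBall, Prod.dist_eq, max_le_iff] at hω
    obtain ⟨h1, h2, -⟩ := hω
    change dist (covariate (P ω) (Z ω)) (covariate p z) ≤ r
    refine (pow_le_pow_iff_left₀ dist_nonneg hr.1.le two_ne_zero).1 ?_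
    rw [dist_covariate_sq, ← dist_eq_norm, ← sq_abs, ← Real.dist_eq]
    have h3 := pow_le_pow_left₀ dist_nonneg h1 2
    have h4 := pow_le_pow_left₀ dist_nonneg h2 2
    have h5 : r = 2 * t := by rw [ht]; ring
    rw [h5]
    nlinarith
  calc (qu - ql) / 3 * (a₀ * a) / 2 ^ (m + 1) * r ^ (m + 1)
      = (qu - ql) / (3 * t) * (a₀ * (a * t ^ (m + 2))) := by
        rw [show r = 2 * t by rw [ht]; ring, mul_pow, pow_succ t (m + 1)]
        field_simp
    _ ≤ M * (a₀ * (a * t ^ (m + 2))) := by gcongr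
    _ = ∑ j ∈ Finset.range M, a₀ * (a * t ^ (m + 2)) := by
        rw [Finset.sum_const, Finset.card_range, nsmul_eq_mul]
    _ ≤ ∑ j ∈ Finset.range M, ρ.real (U j) := Finset.sum_le_sum fun j hj =>
        hball p hp _ (hmem j hj) t ⟨hr', by rw [ht]; linarith [hr.1, hr.2]⟩
    _ ≤ _ := hsum.le.trans hsub

end Law

/-! ### Sample counts in balls along the query segment -/

theorem exists_grid_point_near {pl pu r : ℝ} (hr : 0 < r) {p : ℝ} (hp : p ∈ Icc pl pu) :
    ∃ j < ⌊(pu - pl) / r⌋₊ + 1, |p - min pu (pl + j * r)| ≤ r := by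
  have h0 : 0 ≤ p - pl := sub_nonneg.2 hp.1
  refine ⟨⌊(p - pl) / r⌋₊, Nat.lt_succ_of_le (Nat.floor_le_floor ?_), ?_⟩
  · have := hp.2
    gcongr
  · have h1 : (⌊(p - pl) / r⌋₊ : ℝ) * r ≤ p - pl := by
      rw [← le_div_iff₀ hr]; exact Nat.floor_le (div_nonneg h0 hr.le)
    have h2 : p - pl < (⌊(p - pl) / r⌋₊ + 1 : ℝ) * r := by
      rw [← div_lt_iff₀ hr]; exact Nat.lt_floor_add_one _
    rw [min_eq_right (by linarith [hp.2])]
    exact abs_le.2 ⟨by linarith, by linarith⟩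

theorem grid_point_mem {pl pu r : ℝ} (hr : 0 < r) (hp : pl ≤ pu) (j : ℕ) :
    min pu (pl + j * r) ∈ Icc pl pu :=
  ⟨le_min hp (by have : 0 ≤ j * r := by positivity
                 linarith), min_le_left _ _⟩

/-- Every ball of radius `r` centred on the segment contains one of finitely many grid balls of
radius `r / 2`, each of positive mass; the smallest of these masses serves. -/
theorem exists_uniform_covariate_ball_mass {m : ℕ}
    {ν : Measure (ℝ × EuclideanSpace ℝ (Fin m))} [IsFiniteMeasure ν] {pl pu : ℝ} (hp : pl ≤ pu)
    {z : EuclideanSpace ℝ (Fin m)} (hz : ∀ p ∈ Icc pl pu, (p, z) ∈ ν.support) {r : ℝ}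
    (hr : 0 < r) : ∃ π > 0, ∀ p ∈ Icc pl pu,
      π ≤ ν.real {x | dist (covariate x.1 x.2) (covariate p z) ≤ r} := by
  have hr2 := half_pos hr
  let c : ℕ → ℝ := fun j => min pu (pl + j * (r / 2))
  obtain ⟨j₀, -, hmin⟩ := (Finset.range (⌊(pu - pl) / (r / 2)⌋₊ + 1)).exists_min_image
    (fun j => ν.real {x | dist (covariate x.1 x.2) (covariate (c j) z) ≤ r / 2})
    Finset.nonempty_range_add_one
  refine ⟨_, measureReal_covariate_ball_pos (hz (c j₀) (grid_point_mem hr2 hp j₀)) hr2,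
    fun p hp' => ?_⟩
  obtain ⟨j, hj, hjp⟩ := exists_grid_point_near hr2 hp'
  refine (hmin j (Finset.mem_range.2 hj)).trans (measureReal_mono fun x hx => ?_)
  refine (dist_triangle _ (covariate (c j) z) _).trans ?_
  rw [dist_covariate_left, abs_sub_comm]
  exact (add_le_add hx hjp).trans (by linarith)

open Classical in
/-- Balls around the query points contain about as many sample points as expected. -/
theorem ae_eventually_covariate_ball_count {Ω : Type*} [MeasurableSpace Ω] {μ : Measure Ω}
    [IsProbabilityMeasure μ] {m : ℕ} {ν : Measure (ℝ × EuclideanSpace ℝ (Fin m))}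
    {X : ℕ → Ω → ℝ × EuclideanSpace ℝ (Fin m)} (hX : ∀ i, Measurable (X i))
    (hindep : iIndepFun X μ) (hlaw : ∀ i, μ.map (X i) = ν) {pl pu : ℝ} (hp : pl ≤ pu)
    {z : EuclideanSpace ℝ (Fin m)} {r π : ℕ → ℝ} (hr : ∀ N, 0 < r N)
    (hπ : ∀ᶠ N in atTop, ∀ p ∈ Icc pl pu,
      π N ≤ ν.real {x | dist (covariate x.1 x.2) (covariate p z) ≤ r N})
    (hrN : ∃ C, ∀ᶠ N : ℕ in atTop, 1 / r N ≤ C * N)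
    (hlim : Tendsto (fun N : ℕ => N * π N / Real.log N) atTop atTop) :
    ∀ᵐ ω ∂μ, ∀ᶠ N : ℕ in atTop, ∀ p ∈ Icc pl pu, N * π N / 4 ≤
      ((Finset.range N).filter (fun i =>
        dist (covariate (X i ω).1 (X i ω).2) (covariate p z) ≤ 2 * r N)).card := by
  obtain ⟨C, hC⟩ := hrN
  -- A grid of mesh `r N` has $O(N)$ points, and every ball of radius `2 * r N` centred on the
  -- segment contains a grid ball of radius `r N`.
  have h := ae_eventually_card_ge hX hindep hlaw (fun N => ⌊(pu - pl) / r N⌋₊ + 1)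
    (fun N j => {x | dist (covariate x.1 x.2) (covariate (min pu (pl + j * r N)) z) ≤ r N})
    (fun N j => measurableSet_covariate_ball _ _) π
    (hπ.mono fun N h j _ => h _ (grid_point_mem (hr N) hp j))
    ⟨(pu - pl) * C + 1, by
      filter_upwards [hC, eventually_ge_atTop 1] with N h1 h2
      have hN : (1 : ℝ) ≤ N := by exact_mod_cast h2
      have h3 : (⌊(pu - pl) / r N⌋₊ : ℝ) ≤ (pu - pl) / r N :=
        Nat.floor_le (div_nonneg (sub_nonneg.2 hp) (hr N).le)
      have h4 : (pu - pl) / r N ≤ (pu - pl) * (C * N) := by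
        rw [div_eq_mul_one_div]
        exact mul_le_mul_of_nonneg_left h1 (sub_nonneg.2 hp)
      push_cast
      linarith⟩ hlim
  filter_upwards [h] with ω h
  filter_upwards [h] with N h p hp'
  obtain ⟨j, hj, hjp⟩ := exists_grid_point_near (hr N) hp'
  refine (h j hj).trans (Nat.cast_le.2 (Finset.card_le_card fun i hi => ?_))
  rw [Finset.mem_filter] at hi ⊢
  refine ⟨hi.1, (dist_triangle _ (covariate (min pu (pl + j * r N)) z) _).trans ?_⟩
  rw [dist_covariate_left, abs_sub_comm]
  exact (add_le_add hi.2 hjp).trans (by linarith)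

theorem tendsto_natCast_div_log_atTop :
    Tendsto (fun N : ℕ => (N : ℝ) / Real.log N) atTop atTop := by
  have h : Tendsto (fun x : ℝ => Real.log x / x) atTop (𝓝[>] 0) := by
    refine tendsto_nhdsWithin_iff.2
      ⟨by simpa using Real.isLittleO_log_id_atTop.tendsto_div_nhds_zero, ?_⟩
    filter_upwards [eventually_gt_atTop 1] with x hx
    exact div_pos (Real.log_pos hx) (by linarith)
  refine ((tendsto_inv_nhdsGT_zero.comp h).comp tendsto_natCast_atTop_atTop).congr fun N => ?_
  simp

open Classical in
-- A ball of fixed radius has mass bounded below along the segment and so holds a positive fraction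
-- of the sample, eventually more than $k_N=o(N)$ points. Radii `1 / (n + 1)` suffice.
theorem ae_covariate_knn_count {Ω : Type*} [MeasurableSpace Ω] {μ : Measure Ω}
    [IsProbabilityMeasure μ] {m : ℕ} {ν : Measure (ℝ × EuclideanSpace ℝ (Fin m))}
    [IsFiniteMeasure ν]
    {X : ℕ → Ω → ℝ × EuclideanSpace ℝ (Fin m)} (hX : ∀ i, Measurable (X i))
    (hindep : iIndepFun X μ) (hlaw : ∀ i, μ.map (X i) = ν) {pl pu : ℝ} (hp : pl ≤ pu)
    {z : EuclideanSpace ℝ (Fin m)} (hz : ∀ p ∈ Icc pl pu, (p, z) ∈ ν.support)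
    {k : ℕ → ℕ} (hk : Tendsto (fun N => (k N : ℝ) / N) atTop (𝓝 0)) :
    ∀ᵐ ω ∂μ, ∀ δ > 0, ∀ᶠ N : ℕ in atTop, ∀ p ∈ Icc pl pu, k N ≤
      ((Finset.range N).filter (fun i =>
        dist (covariate (X i ω).1 (X i ω).2) (covariate p z) ≤ δ)).card := by
  have key : ∀ n : ℕ, ∀ᵐ ω ∂μ, ∀ᶠ N : ℕ in atTop, ∀ p ∈ Icc pl pu, k N ≤
      ((Finset.range N).filter (fun i =>
        dist (covariate (X i ω).1 (X i ω).2) (covariate p z) ≤ 1 / ((n : ℝ) + 1))).card := by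
    intro n
    have hr : 0 < 1 / ((n : ℝ) + 1) / 2 := by positivity
    obtain ⟨π, hπ, hmass⟩ := exists_uniform_covariate_ball_mass hp hz hr
    have h := ae_eventually_covariate_ball_count hX hindep hlaw hp (z := z)
      (r := fun _ => 1 / ((n : ℝ) + 1) / 2) (π := fun _ => π) (fun _ => hr)
      (Eventually.of_forall fun _ => hmass)
      ⟨1 / (1 / ((n : ℝ) + 1) / 2), by
        filter_upwards [eventually_ge_atTop 1] with N hN
        have : (1 : ℝ) ≤ N := by exact_mod_cast hN
        exact le_mul_of_one_le_right (by positivity) this⟩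
      ((tendsto_natCast_div_log_atTop.atTop_mul_const hπ).congr fun N => by ring)
    filter_upwards [h] with ω h
    filter_upwards [h, hk.eventually_le_const (show 0 < π / 4 by positivity),
      eventually_ge_atTop 1] with N h1 h2 hN p hp'
    have hN0 : (0 : ℝ) < N := by exact_mod_cast hN
    have h3 := h1 p hp'
    rw [mul_div_cancel₀ _ two_ne_zero] at h3
    rw [div_le_iff₀ hN0] at h2
    exact (Nat.cast_le (α := ℝ)).1 (by linarith)
  filter_upwards [ae_all_iff.2 key] with ω h δ hδ
  obtain ⟨n, hn⟩ := exists_nat_one_div_lt hδ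
  filter_upwards [h n] with N h p hp'
  refine (h p hp').trans (Finset.card_le_card fun i hi => ?_)
  rw [Finset.mem_filter] at hi ⊢
  exact ⟨hi.1, hi.2.trans hn.le⟩

open Classical in
theorem ae_covariate_kernel_count {Ω : Type*} [MeasurableSpace Ω] {μ : Measure Ω}
    [IsProbabilityMeasure μ] {m : ℕ} {ν : Measure (ℝ × EuclideanSpace ℝ (Fin m))}
    {X : ℕ → Ω → ℝ × EuclideanSpace ℝ (Fin m)} (hX : ∀ i, Measurable (X i))
    (hindep : iIndepFun X μ) (hlaw : ∀ i, μ.map (X i) = ν) {pl pu : ℝ} (hp : pl ≤ pu)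
    {z : EuclideanSpace ℝ (Fin m)} {c : ℝ} (hc : 0 < c)
    (hmass : ∀ p ∈ Icc pl pu, ∀ r ∈ Ioc (0 : ℝ) 1, c * r ^ (m + 1) ≤
      ν.real {x | dist (covariate x.1 x.2) (covariate p z) ≤ r})
    {h : ℕ → ℝ} (hh : ∀ N, 0 < h N) (hh0 : Tendsto h atTop (𝓝 0))
    (hhN : Tendsto (fun N : ℕ => (N : ℝ) * h N ^ (m + 1) / Real.log N) atTop atTop) :
    ∀ᵐ ω ∂μ, ∀ᶠ N : ℕ in atTop, ∀ p ∈ Icc pl pu,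
      c / 4 ^ (m + 2) * (N * h N ^ (m + 1)) ≤ ((Finset.range N).filter (fun i =>
        dist (covariate (X i ω).1 (X i ω).2) (covariate p z) ≤ h N / 2)).card := by
  have hsmall : ∀ᶠ N in atTop, h N ≤ 1 := hh0.eventually_le_const one_pos
  have hcount := ae_eventually_covariate_ball_count hX hindep hlaw hp (z := z)
    (r := fun N => h N / 4) (π := fun N => c * (h N / 4) ^ (m + 1))
    (fun N => by have := hh N; positivity)
    (by
      filter_upwards [hsmall] with N hN p hp'
      exact hmass p hp' _ ⟨by have := hh N; positivity, by linarith⟩)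
    -- The grid for radius `h / 4` is small enough: eventually $Nh\ge Nh^{m+1}\ge\log N\ge1$, hence
    -- $4/h\le4N$.
    ⟨4, by
      have hlog : ∀ᶠ N : ℕ in atTop, 1 ≤ Real.log N :=
        (Real.tendsto_log_atTop.comp tendsto_natCast_atTop_atTop).eventually_ge_atTop 1
      filter_upwards [hsmall, hhN.eventually_ge_atTop 1, hlog] with N h1 h2 h3
      rw [le_div_iff₀ (by linarith)] at h2
      have h4 : h N ^ (m + 1) ≤ h N := pow_le_of_le_one (hh N).le h1 (by omega)
      have h5 : (N : ℝ) * h N ^ (m + 1) ≤ N * h N := by gcongr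
      have h6 := hh N
      rw [div_le_iff₀ (by positivity)]
      linarith⟩
    ((hhN.atTop_mul_const (show 0 < c / 4 ^ (m + 1) by positivity)).congr fun N => by
      rw [div_pow]; ring)
  filter_upwards [hcount] with ω hω
  filter_upwards [hω] with N hN p hp'
  have h1 := hN p hp'
  rw [show 2 * (h N / 4) = h N / 2 by ring] at h1
  refine le_trans (le_of_eq ?_) h1
  rw [div_pow, pow_succ 4 (m + 1)]
  field_simp

/-! ### Assembly of the four cases -/

theorem proposition1
    {Ω : Type*} [MeasurableSpace Ω] (μ : Measure Ω) [IsProbabilityMeasure μ]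
    -- data: features, prices, order quantities, demands
    (m : ℕ) (Z : ℕ → Ω → EuclideanSpace ℝ (Fin m)) (P Q D : ℕ → Ω → ℝ)
    (hZ : ∀ i, Measurable (Z i)) (hP : ∀ i, Measurable (P i)) (hQ : ∀ i, Measurable (Q i))
    (hD : ∀ i, Measurable (D i))
    -- the data are i.i.d.
    (hindep : iIndepFun (fun i ω => (Z i ω, P i ω, Q i ω, D i ω)) μ)
    (hident : ∀ i, IdentDistrib (fun ω => (Z i ω, P i ω, Q i ω, D i ω))
      (fun ω => (Z 0 ω, P 0 ω, Q 0 ω, D 0 ω)) μ μ)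
    -- the support of the joint law of `(z, p, q)`; the law has a `C²` density on its support that is
    -- bounded away from `0` and `∞` there, and historical decisions are bounded
    (S : Set (EuclideanSpace ℝ (Fin m) × ℝ × ℝ))
    (hS : S = (μ.map (fun ω => (Z 0 ω, P 0 ω, Q 0 ω))).support)
    (f : EuclideanSpace ℝ (Fin m) × ℝ × ℝ → ℝ)
    (hlaw : μ.map (fun ω => (Z 0 ω, P 0 ω, Q 0 ω)) =
      (volume.restrict S).withDensity (fun y => ENNReal.ofReal (f y)))
    (hf : ContDiffOn ℝ 2 f S)
    (hfb : ∃ a b : ℝ, 0 < a ∧ ∀ y ∈ S, a ≤ f y ∧ f y ≤ b)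
    (hbdd : Bornology.IsBounded (Prod.snd '' S))
    -- the demand distribution `f_D(p, z)`, i.e. the conditional law of demand given `(p, z)`:
    -- nonnegative, atomless, and weakly continuous on the support `SX` of the law of `(p, z)`
    (fD : Kernel (ℝ × EuclideanSpace ℝ (Fin m)) ℝ) [IsMarkovKernel fD]
    (hfD : μ.map (fun ω => ((P 0 ω, Z 0 ω), D 0 ω)) =
      (μ.map (fun ω => (P 0 ω, Z 0 ω))) ⊗ₘ fD)
    (SX : Set (ℝ × EuclideanSpace ℝ (Fin m)))
    (hSX : SX = (μ.map (fun ω => (P 0 ω, Z 0 ω))).support)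
    (hfD_nonneg : ∀ x ∈ SX, fD x (Iio 0) = 0)
    (hfD_atom : ∀ x ∈ SX, ∀ d : ℝ, fD x {d} = 0)
    (hfD_cont : ∀ φ : ℝ →ᵇ ℝ, ContinuousOn (fun x => ∫ d, φ d ∂(fD x)) SX)
    -- cost, salvage value, feasible rectangle, and a selection of the subgradient
    (c s pl pu ql qu : ℝ) (hsc : s < c) (hcp : c ≤ pl) (hp : pl < pu) (hql : 0 ≤ ql) (hq : ql < qu)
    (g : ℝ → ℝ → ℝ → EuclideanSpace ℝ (Fin 2))
    (hg : ∀ p q d, g p q d ∈ profitSubgrad c s p q d)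
    -- the feature: all feasible decisions with it lie in the support
    (z : EuclideanSpace ℝ (Fin m))
    (hz : ∀ p ∈ Icc pl pu, ∀ q ∈ Icc ql qu, (z, p, q) ∈ S) :
    -- the expected gradient is well defined
    (∀ p ∈ Icc pl pu, ∀ q ∈ Icc ql qu, Integrable (g p q) (fD (p, z))) ∧
    -- kNN weights
    (∀ k : ℕ → ℕ, Tendsto (fun N => (k N : ℝ) / Real.log N) atTop atTop →
      Tendsto (fun N => (k N : ℝ) / N) atTop (𝓝 0) →
      ∀ᵐ ω ∂μ, Tendsto (fun N => gradError fD g pl pu ql qu N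
        (knnWeight (k N) N (fun i => covariate (P i ω) (Z i ω))) (fun i => D i ω) z)
        atTop (𝓝 0)) ∧
    -- kernel regression weights, if balls around `(z, p, q)` meet the support in a fixed fraction
    (∀ K ∈ ({uniformKernel (m + 1), triangularKernel (m + 1), gaussianKernel (m + 1)} :
        Set (EuclideanSpace ℝ (Fin (m + 1)) → ℝ)),
      ∀ h : ℕ → ℝ, (∀ N, 0 < h N) → Tendsto h atTop (𝓝 0) →
      Tendsto (fun N : ℕ => (N : ℝ) * h N ^ (m + 1) / Real.log N) atTop atTop →
      (∃ a > 0, ∀ p ∈ Icc pl pu, ∀ q ∈ Icc ql qu, ∀ r ∈ Ioc (0 : ℝ) 1,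
        ENNReal.ofReal (a * r ^ (m + 2)) ≤ volume (S ∩ Metric.closedBall (z, p, q) r)) →
      ∀ᵐ ω ∂μ, Tendsto (fun N => gradError fD g pl pu ql qu N
        (kernelWeight K (h N) N (fun i => covariate (P i ω) (Z i ω))) (fun i => D i ω) z)
        atTop (𝓝 0)) ∧
    -- CART weights, with trees that may depend on the data
    (∀ T : ℕ → Ω → RegTree (m + 1),
      (∀ᵐ ω ∂μ, ForestTuned (fun _ => 1) (fun N _ => T N ω)
        (fun i => covariate (P i ω) (Z i ω)) ((fun x => covariate x.1 x.2) '' SX)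
        ((fun p => covariate p z) '' Icc pl pu)) →
      ∀ᵐ ω ∂μ, Tendsto (fun N => gradError fD g pl pu ql qu N
        (cartWeight (T N ω) N (fun i => covariate (P i ω) (Z i ω))) (fun i => D i ω) z)
        atTop (𝓝 0)) ∧
    -- random forest weights, with trees that may depend on the data
    (∀ (n : ℕ → ℕ) (T : ℕ → Ω → ℕ → RegTree (m + 1)), (∀ N, 0 < n N) →
      (∀ᵐ ω ∂μ, ForestTuned n (fun N e => T N ω e)
        (fun i => covariate (P i ω) (Z i ω)) ((fun x => covariate x.1 x.2) '' SX)
        ((fun p => covariate p z) '' Icc pl pu)) →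
      ∀ᵐ ω ∂μ, Tendsto (fun N => gradError fD g pl pu ql qu N
        (forestWeight (n N) (T N ω) N (fun i => covariate (P i ω) (Z i ω))) (fun i => D i ω) z)
        atTop (𝓝 0)) := by
  classical
  have hpT : pl ≤ pu := hp.le
  have hX : ∀ i, Measurable fun ω => (P i ω, Z i ω) := fun i => (hP i).prodMk (hZ i)
  have hmP : Measurable fun y : EuclideanSpace ℝ (Fin m) × ℝ × ℝ × ℝ => (y.2.1, y.1) := by
    fun_prop
  have hmPD : Measurable fun y : EuclideanSpace ℝ (Fin m) × ℝ × ℝ × ℝ =>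
      ((y.2.1, y.1), y.2.2.2) := by fun_prop
  have hindX : iIndepFun (fun i ω => (P i ω, Z i ω)) μ := hindep.comp _ fun _ => hmP
  have hindXD : iIndepFun (fun i ω => ((P i ω, Z i ω), D i ω)) μ := hindep.comp _ fun _ => hmPD
  set ν := μ.map (fun ω => (P 0 ω, Z 0 ω)) with hν
  have hνprob : IsProbabilityMeasure ν := Measure.isProbabilityMeasure_map (hX 0).aemeasurable
  have hlawX : ∀ i, μ.map (fun ω => (P i ω, Z i ω)) = ν := fun i => ((hident i).comp hmP).map_eq
  have hlawXD : ∀ i, μ.map (fun ω => ((P i ω, Z i ω), D i ω)) = ν ⊗ₘ fD := fun i =>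
    ((hident i).comp hmPD).map_eq.trans hfD
  have hzX : ∀ p ∈ Icc pl pu, (p, z) ∈ SX := by
    intro p hp'
    rw [hSX]
    refine mem_support_map_covariates (hZ 0) (hP 0) (hQ 0) (q := ql) ?_
    rw [← hS]
    exact hz p hp' ql ⟨le_rfl, hq.le⟩
  have hXS : ∀ᵐ ω ∂μ, ∀ i, (P i ω, Z i ω) ∈ SX := by
    refine ae_all_iff.2 fun i => ae_of_ae_map (hX i).aemeasurable ?_
    rw [hlawX, hSX]
    exact Measure.support_mem_ae
  have hD0 : ∀ᵐ ω ∂μ, ∀ i, 0 ≤ D i ω := by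
    refine ae_all_iff.2 fun i => ?_
    have hneg : MeasurableSet {y : (ℝ × EuclideanSpace ℝ (Fin m)) × ℝ | y.2 < 0} :=
      measurableSet_lt measurable_snd measurable_const
    have h0 : (ν ⊗ₘ fD) {y | y.2 < 0} = 0 := by
      rw [Measure.compProd_apply hneg,
        lintegral_eq_zero_iff (Kernel.measurable_kernel_prodMk_left hneg)]
      have : ∀ᵐ x ∂ν, x ∈ SX := by rw [hSX]; exact Measure.support_mem_ae
      exact this.mono fun x hx => hfD_nonneg x hx
    rw [← hlawXD i, Measure.map_apply ((hX i).prodMk (hD i)) hneg] at h0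
    filter_upwards [measure_eq_zero_iff_ae_notMem.1 h0] with ω hω
    exact not_lt.1 hω
  have hv : Measurable fun z' : EuclideanSpace ℝ (Fin m) => ‖z' - z‖ ^ 2 := by fun_prop
  -- Rational levels keep the family of test functions countable, so one null set serves for all of
  -- them.
  have hball : ∀ᵐ ω ∂μ, ∀ a b : ℚ, BallDeviation (fun i => covariate (P i ω) (Z i ω))
      (fun p => covariate p z)
      (condResidual fD (clampBCF a b) (fun i => (P i ω, Z i ω)) fun i => D i ω) := by
    refine ae_all_iff.2 fun a => ae_all_iff.2 fun b => ?_
    filter_upwards [ae_abs_sum_residual_ball_le hX hD hindXD hlawXD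
      (clampBCF a b).continuous.measurable (B := ‖clampBCF a b‖)
      (fun t => (clampBCF a b).norm_coe_le_norm t) hv] with ω h ε hε
    obtain ⟨C, hC, h⟩ := h ε hε
    refine ⟨C, hC, h.mono fun N h p t ht hdown => h p t ht fun i hi j hj hji => ?_⟩
    exact hdown i hi j hj
      ((dist_covariate_le_iff p z (P j ω, Z j ω) (P i ω, Z i ω)).2 hji)
  have hbox : ∀ᵐ ω ∂μ, ∀ a b : ℚ, BoxDeviation (fun i => covariate (P i ω) (Z i ω))
      (condResidual fD (clampBCF a b) (fun i => (P i ω, Z i ω)) fun i => D i ω) := by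
    refine ae_all_iff.2 fun a => ae_all_iff.2 fun b => ?_
    exact ae_abs_sum_residual_box_le hX hD hindXD hlawXD
      (clampBCF a b).continuous.measurable (B := ‖clampBCF a b‖)
      (fun t => (clampBCF a b).norm_coe_le_norm t)
      (fun j x => covariate x.1 x.2 j) fun j =>
        (measurable_pi_apply j).comp ((WithLp.measurable_ofLp 2 _).comp measurable_covariate)
  have hforest : ∀ (n : ℕ → ℕ) (T : ℕ → Ω → ℕ → RegTree (m + 1)), (∀ N, 0 < n N) →
      (∀ᵐ ω ∂μ, ForestTuned n (fun N e => T N ω e)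
        (fun i => covariate (P i ω) (Z i ω)) ((fun x => covariate x.1 x.2) '' SX)
        ((fun p => covariate p z) '' Icc pl pu)) →
      ∀ᵐ ω ∂μ, Tendsto (fun N => gradError fD g pl pu ql qu N
        (forestWeight (n N) (T N ω) N (fun i => covariate (P i ω) (Z i ω))) (fun i => D i ω) z)
        atTop (𝓝 0) := by
    intro n T hn hT
    filter_upwards [hT, hbox, hXS, hD0] with ω hT hbox hXS hD0
    exact tendsto_gradError_of_consistentWeights hfD_nonneg hfD_atom hfD_cont hsc hcp hql hg hzX
      hXS hD0 fun a b => consistentWeights_forestWeight (hbox a b)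
        (fun i => mem_image_of_mem (fun x : ℝ × EuclideanSpace ℝ (Fin m) => covariate x.1 x.2)
          (hXS i)) hn hT
  refine ⟨fun p hp' q hq' => ?_, fun k hk hkN => ?_, fun K hK h hh hh0 hhN hvol => ?_,
    fun T hT => ?_, hforest⟩
  · refine integrable_profitSubgrad (hg p q) (hql.trans hq'.1) (hfD_atom _ (hzX p hp') q) ?_
    filter_upwards [measure_eq_zero_iff_ae_notMem.1 (hfD_nonneg _ (hzX p hp'))] with t ht
    exact not_lt.1 ht
  · have hac : μ.map (fun ω => (Z 0 ω, P 0 ω, Q 0 ω)) ≪ volume := by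
      rw [hlaw]
      exact (withDensity_absolutelyContinuous _ _).trans
        Measure.restrict_le_self.absolutelyContinuous
    have hties := ae_not_three_equidistant hX hindX hlawX hv
      (fun t => map_covariates_null_of_finite (hZ 0) (hP 0) (hQ 0) hac
        (measurableSet_eq_fun measurable_fst measurable_const)
        fun z' => (finite_singleton t).subset fun u hu => hu)
      -- For a fixed feature, a sphere around a point of the query line contains at most two prices.
      (fun p r => map_covariates_null_of_finite (hZ 0) (hP 0) (hQ 0) hac
        (measurableSet_eq_fun (by fun_prop) measurable_const)
        fun z' => by
          refine (toFinite {p + Real.sqrt (r - ‖z' - z‖ ^ 2),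
            p - Real.sqrt (r - ‖z' - z‖ ^ 2)}).subset fun u hu => ?_
          have hu' : (u - p) ^ 2 = r - ‖z' - z‖ ^ 2 := eq_sub_of_add_eq hu
          have h1 : |u - p| = Real.sqrt (r - ‖z' - z‖ ^ 2) := by
            rw [← hu', Real.sqrt_sq_eq_abs]
          rcases abs_choice (u - p) with h2 | h2
          · left; rw [← h1, h2]; ring
          · right; rw [mem_singleton_iff, ← h1, h2]; ring)
    filter_upwards [hties, hball, hXS, hD0, ae_covariate_knn_count hX hindX hlawX hpT
      (fun p hp' => hSX ▸ hzX p hp') hkN] with ω hties hball hXS hD0 hcount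
    refine tendsto_gradError_of_consistentWeights hfD_nonneg hfD_atom hfD_cont hsc hcp hql hg hzX
      hXS hD0 fun a b => consistentWeights_knnWeight (hball a b) hk hcount
        fun i j l hij hil hjl p heq heq' => ?_
    have h1 := congrArg (· ^ 2) heq
    have h2 := congrArg (· ^ 2) heq'
    simp only [dist_covariate_sq] at h1 h2
    exact hties i j l hij hil hjl p h1 h2
  · obtain ⟨a, ha, hvol⟩ := hvol
    obtain ⟨a₀, b₀, ha₀, hfb⟩ := hfb
    obtain ⟨κ, hKκ, hanti, hκ0, hκ1, hκpos, hκtail⟩ := exists_radial_profile hK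
    have hSm : MeasurableSet S := by
      rw [hS]; exact Measure.isClosed_support.measurableSet
    obtain ⟨c₀, hc₀, hmass⟩ := exists_covariate_ball_mass (hZ 0) (hP 0) (hQ 0) hSm hlaw ha₀
      (fun y hy => (hfb y hy).1) hq ha hvol
    filter_upwards [hball, hXS, hD0, ae_covariate_kernel_count hX hindX hlawX hpT hc₀ hmass hh hh0
      hhN] with ω hball hXS hD0 hcount
    exact tendsto_gradError_of_consistentWeights hfD_nonneg hfD_atom hfD_cont hsc hcp hql hg hzX
      hXS hD0 fun a b => consistentWeights_kernelWeight (hball a b) hKκ hanti hκ0 hκ1 hκpos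
        (hκtail (m + 1)) hh hh0 hhN (by positivity) hcount
  -- A single tree is a forest of size one.
  · filter_upwards [hforest (fun _ => 1) (fun N ω _ => T N ω) (fun _ => one_pos) hT] with ω h
    refine h.congr fun N => ?_
    congr 1
    funext i x
    simp [forestWeight]
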